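/- **Setup.** Let $d\ge 1$, $\mathfrak p\ge 0$ be integers and let $(\mathbf x_i,y_i)_{i\ge1}$ be i.i.d. random vectors in $\mathbb R^d\times\mathbb R$ with $\mathbb E|y_i|<\infty$, where $\mathbf x_i\sim\mathbb P_X$ has a Lebesgue density $f_X$ that is continuous and positive on its support $\mathcal X=[0,1]^d$. Let $K:\mathbb R^d\to[0,\infty)$ be a compactly supported Lipschitz kernel with $K(\mathbf 0)>0$, and let $b=b_n>0$ be a bounded sequence of bandwidths. Let $\mathbf p(\mathbf u)$ be the vector of all monomials $\mathbf u^{\boldsymbol\nu}$ with $|\boldsymbol\nu|\le\mathfrak p$, the first one being the constant $1$, and let $\mathbf e_1$ be the first unit vector. Put $\mathscr R_1=\{\mathrm{Id}\}$ and $\mathscr R_2=\{\mathbb 1(\cdot\le t):t\in\mathbb R\}$, let $\mathcal W\subseteq\mathcal X$, and for $r\in\mathscr R_1\cup\mathscr R_2$ let $\theta(\cdot,r)$ be a version of the regression function $\theta(\mathbf w,r)=\mathbb E[r(y_i)\mid\mathbf x_i=\mathbf w]$. The local polynomial estimator of $\theta(\mathbf w,r)$ is $$\widehat\theta(\mathbf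 w,r)=\mathbf e_1^\top\widehat{\boldsymbol\beta}(\mathbf w,r),\qquad \widehat{\boldsymbol\beta}(\mathbf w,r)\in\arg\min_{\boldsymbol\beta}\sum_{i=1}^n\big(r(y_i)-\mathbf p(\mathbf x_i-\mathbf w)^\top\boldsymbol\beta\big)^2K\Big(\frac{\mathbf x_i-\mathbf w}{b}\Big).$$ With $\mathbf u_i=(\mathbf x_i-\mathbf w)/b$ let $$\widehat{\mathbf H}_{\mathbf w}=\frac1n\sum_{i=1}^n\mathbf p(\mathbf u_i)\mathbf p(\mathbf u_i)^\top\frac{K(\mathbf u_i)}{b^d},\qquad \mathbf H_{\mathbf w}=\mathbb E[\widehat{\mathbf H}_{\mathbf w}],\qquad \mathbf S_{\mathbf w,r}=\frac1n\sum_{i=1}^n\mathbf p(\mathbf u_i)\frac{K(\mathbf u_i)}{b^d}\big(r(y_i)-\theta(\mathbf x_i,r)\big).$$ Assume that for every $r\in\mathscr R_1\cup\mathscr R_2$ the function $\theta(\cdot,r)$ is $(\mathfrak p+1)$-times continuously differentiable on $\mathcal X$, with $(\mathfrak p+1)$-th derivatives bounded uniformly over $\mathcal X$ and over $r\in\mathscr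 R_1\cup\mathscr R_2$. The conditional expectation $\mathbb E[\widehat\theta(\mathbf w,r)\mid\mathbf x_1,\dots,\mathbf x_n]$ is the integral of $\widehat\theta(\mathbf w,r)$ against a regular conditional law of $(y_1,\dots,y_n)$ given $(\mathbf x_1,\dots,\mathbf x_n)$. We write $T_n=O(a_n)$ a.s. if there is a constant $C$ such that almost surely $|T_n|\le C a_n$ for all large $n$. **Claim.** Suppose that $(nb^d)^{-1}\log n\to0$. Then $\mathbf H_{\mathbf w}$ is invertible for all $n$ and all $\mathbf w\in\mathcal W$. Almost surely, for all large $n$ and all $\mathbf w\in\mathcal W$, the matrix $\widehat{\mathbf H}_{\mathbf w}$ is invertible, the minimizer $\widehat{\boldsymbol\beta}(\mathbf w,r)$ is unique for every function $r:\mathbb R\to\mathbb R$ and all real values of the outcomes $y_1,\dots,y_n$, and for $r\in\mathscr R_1\cup\mathscr R_2$ the estimator $\widehat\theta(\mathbf w,r)$ is integrable under the conditional law given $(\mathbf x_1,\dots,\mathbf x_n)$. Moreover, $$\sup_{\mathbf w\in\mathcal W,\,r\in\mathscr R_2}\big|\mathbf e_1^\top(\widehat{\mathbf H}_{\mathbf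 w}^{-1}-\mathbf H_{\mathbf w}^{-1})\mathbf S_{\mathbf w,r}\big|=O\big((nb^d)^{-1}\log n\big)\quad\text{a.s.},$$ $$\sup_{\mathbf w\in\mathcal W,\,r\in\mathscr R_\ell}\big|\mathbb E[\widehat\theta(\mathbf w,r)\mid\mathbf x_1,\dots,\mathbf x_n]-\theta(\mathbf w,r)\big|=O(b^{1+\mathfrak p})\quad\text{a.s.},\qquad \ell=1,2.$$ If, in addition, $\mathbb E[\exp(|y_i|)\mid\mathbf x_i]\le2$ almost surely, then $$\sup_{\mathbf w\in\mathcal W,\,r\in\mathscr R_1}\big|\mathbf e_1^\top(\widehat{\mathbf H}_{\mathbf w}^{-1}-\mathbf H_{\mathbf w}^{-1})\mathbf S_{\mathbf w,r}\big|=O\big((nb^d)^{-1}\log n+(nb^d)^{-3/2}(\log n)^{5/2}\big)\quad\text{a.s.}$$ -/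

import Mathlib

open MeasureTheory ProbabilityTheory Filter Topology

noncomputable section

namespace LocalPoly

/-- Multi-indices `ν ∈ ℕ^d` with `|ν| = ν₁ + ⋯ + ν_d ≤ p` (each entry is then at most `p`). They
index the monomials of degree at most `p` in `d` variables. -/
abbrev MultiIdx (d p : ℕ) : Type := {ν : Fin d → Fin (p + 1) // ∑ i, (ν i : ℕ) ≤ p}

/-- The multi-index `0`, that is, the position of the constant monomial in the basis. -/
def MultiIdx.zero (d p : ℕ) : MultiIdx d p := ⟨fun _ => 0, by simp⟩

/-- The polynomial basis expansion of order `p`: the vector of all monomials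
`u^ν = u₁^{ν₁} ⋯ u_d^{ν_d}` with `|ν| ≤ p`. -/
def polyBasis {d : ℕ} (p : ℕ) (u : Fin d → ℝ) : MultiIdx d p → ℝ :=
  fun ν => ∏ i, u i ^ (ν.1 i : ℕ)

/-- The first unit vector: the one at the constant monomial. -/
def e₁ (d p : ℕ) : MultiIdx d p → ℝ := Pi.single (MultiIdx.zero d p) 1

/-- The rescaled position `(x - w) / b`. -/
def scaled {d : ℕ} (b : ℝ) (w x : Fin d → ℝ) : Fin d → ℝ := b⁻¹ • (x - w)

/-- The class `ℛ₁ = {Id}`. -/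
def R₁ : Set (ℝ → ℝ) := {id}

/-- The class `ℛ₂ = {𝟙(· ≤ t) : t ∈ ℝ}`. -/
def R₂ : Set (ℝ → ℝ) := Set.range fun t : ℝ => (Set.Iic t).indicator (fun _ => (1 : ℝ))

section Sample

variable {d n : ℕ} (K : (Fin d → ℝ) → ℝ) (p : ℕ) (b : ℝ)

/-- The kernel-weighted least squares criterion
`∑ᵢ (r(yᵢ) - p(xᵢ - w)ᵀ β)² K((xᵢ - w) / b)`. -/
def lsCriterion (x : Fin n → Fin d → ℝ) (y : Fin n → ℝ) (w : Fin d → ℝ) (r : ℝ → ℝ)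
    (β : MultiIdx d p → ℝ) : ℝ :=
  ∑ i, (r (y i) - polyBasis p (x i - w) ⬝ᵥ β) ^ 2 * K (scaled b w (x i))

/-- `β` minimizes the kernel-weighted least squares criterion. -/
def IsFit (x : Fin n → Fin d → ℝ) (y : Fin n → ℝ) (w : Fin d → ℝ) (r : ℝ → ℝ)
    (β : MultiIdx d p → ℝ) : Prop :=
  ∀ β', lsCriterion K p b x y w r β ≤ lsCriterion K p b x y w r β'

open Classical in
/-- The coefficient vector `β̂(w, r)`: a minimizer of the criterion (the minimizer, where it is
unique). -/
def betaHat (x : Fin n → Fin d → ℝ) (y : Fin n → ℝ) (w : Fin d → ℝ) (r : ℝ → ℝ) :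
    MultiIdx d p → ℝ :=
  if h : ∃ β, IsFit K p b x y w r β then h.choose else 0

/-- The local polynomial estimator `θ̂(w, r) = e₁ᵀ β̂(w, r)`. -/
def thetaHat (x : Fin n → Fin d → ℝ) (y : Fin n → ℝ) (w : Fin d → ℝ) (r : ℝ → ℝ) : ℝ :=
  e₁ d p ⬝ᵥ betaHat K p b x y w r

/-- One summand of the Gram matrix: `p(u) p(u)ᵀ b^{-d} K(u)` at `u = (x - w) / b`. -/
def gramTerm (w x : Fin d → ℝ) : Matrix (MultiIdx d p) (MultiIdx d p) ℝ :=
  ((b ^ d)⁻¹ * K (scaled b w x)) •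
    Matrix.vecMulVec (polyBasis p (scaled b w x)) (polyBasis p (scaled b w x))

/-- The sample matrix `Ĥ_w = n⁻¹ ∑ᵢ p(uᵢ) p(uᵢ)ᵀ b^{-d} K(uᵢ)`, `uᵢ = (xᵢ - w) / b`. -/
def gramHat (x : Fin n → Fin d → ℝ) (w : Fin d → ℝ) : Matrix (MultiIdx d p) (MultiIdx d p) ℝ :=
  (n : ℝ)⁻¹ • ∑ i, gramTerm K p b w (x i)

/-- The population matrix `H_w = E[p(u) p(u)ᵀ b^{-d} K(u)]`, `u = (x - w) / b`, where `x` has the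
law `P`; the expectation is taken entry by entry. -/
def gram (P : Measure (Fin d → ℝ)) (w : Fin d → ℝ) : Matrix (MultiIdx d p) (MultiIdx d p) ℝ :=
  Matrix.of fun ν ν' => ∫ x, gramTerm K p b w x ν ν' ∂P

/-- The score `S_{w,r} = n⁻¹ ∑ᵢ p(uᵢ) b^{-d} K(uᵢ) (r(yᵢ) - θ(xᵢ, r))`, `uᵢ = (xᵢ - w) / b`. -/
def score (θ : (Fin d → ℝ) → (ℝ → ℝ) → ℝ) (x : Fin n → Fin d → ℝ) (y : Fin n → ℝ)
    (w : Fin d → ℝ) (r : ℝ → ℝ) : MultiIdx d p → ℝ :=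
  (n : ℝ)⁻¹ • ∑ i, ((b ^ d)⁻¹ * K (scaled b w (x i)) * (r (y i) - θ (x i) r)) •
    polyBasis p (scaled b w (x i))

/-- The non-linearity error `e₁ᵀ (Ĥ_w⁻¹ - H_w⁻¹) S_{w,r}`. -/
def nonlinError (P : Measure (Fin d → ℝ)) (θ : (Fin d → ℝ) → (ℝ → ℝ) → ℝ)
    (x : Fin n → Fin d → ℝ) (y : Fin n → ℝ) (w : Fin d → ℝ) (r : ℝ → ℝ) : ℝ :=
  e₁ d p ⬝ᵥ (((gramHat K p b x w)⁻¹ - (gram K p b P w)⁻¹).mulVec (score K p b θ x y w r))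

end Sample

/-- The first `n` terms of a sequence of random variables, as one random vector. -/
def sample {Ω E : Type*} (Z : ℕ → Ω → E) (n : ℕ) (ω : Ω) : Fin n → E := fun i => Z i ω

/-- A regular conditional law of `(y₁, …, yₙ)` given `(x₁, …, xₙ)`, at the observed covariates. -/
def condLaw {Ω : Type*} [MeasurableSpace Ω] (μ : Measure Ω) [IsFiniteMeasure μ] {d : ℕ}
    (X : ℕ → Ω → Fin d → ℝ) (Y : ℕ → Ω → ℝ) (n : ℕ) (ω : Ω) : Measure (Fin n → ℝ) :=
  condDistrib (sample Y n) (sample X n) μ (sample X n ω)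

/-- The conditional mean `E[θ̂(w, r) | x₁, …, xₙ]`. It is the integral of `θ̂(w, r)` against the
regular conditional law of the outcomes given the covariates: a near-singular design can make
`θ̂(w, r)` fail to be integrable, while it has a finite mean conditionally on the covariates; and
one regular conditional law serves all `w` and `r` at the same time. -/
def condMeanThetaHat {Ω : Type*} [MeasurableSpace Ω] (μ : Measure Ω) [IsFiniteMeasure μ] {d : ℕ}
    (K : (Fin d → ℝ) → ℝ) (p : ℕ) (b : ℝ) (X : ℕ → Ω → Fin d → ℝ) (Y : ℕ → Ω → ℝ) (n : ℕ)
    (w : Fin d → ℝ) (r : ℝ → ℝ) (ω : Ω) : ℝ :=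
  ∫ y, thetaHat K p b (sample X n ω) y w r ∂(condLaw μ X Y n ω)

/-- `sup_{w ∈ W, r ∈ R} |T_n(w, r)| = O(a_n)` almost surely: for some constant `C`, almost surely
the supremum is at most `C a_n` for all large `n`. -/
def SupIsBigOAS {Ω α : Type*} [MeasurableSpace Ω] (μ : Measure Ω) (W : Set α)
    (R : Set (ℝ → ℝ)) (T : ℕ → α → (ℝ → ℝ) → Ω → ℝ) (a : ℕ → ℝ) : Prop :=
  ∃ C : ℝ, ∀ᵐ ω ∂μ, ∀ᶠ n in atTop,
    ⨆ w ∈ W, ⨆ r ∈ R, ENNReal.ofReal |T n w r ω| ≤ ENNReal.ofReal (C * a n)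

end LocalPoly

end

/-! Write `δ` for the rate `√(log n / (n b^d))`. The matrices, the scores and the bias are each
controlled uniformly in `w`; deterministic linear algebra then combines the bounds.

Invertibility. After rescaling, the quadratic form of `H_w` dominates a multiple of the integral of
a squared polynomial over a small box with a corner at the origin that stays inside the rescaled
cube. Only `2^d` boxes are needed, so `H_w` is coercive with one constant `c` for all `w` and all
bandwidths up to `B` (`exists_coercive_gram`). The entries of `Ĥ_w - H_w` are `O(δ)`, hence `Ĥ_w` is
eventually coercive with constant `c / 2`. The criterion is then a strictly convex quadratic, so the
minimizer is unique and linear in the responses.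

Non-linearity error. `Ĥ⁻¹ - H⁻¹ = -Ĥ⁻¹ (Ĥ - H) H⁻¹` has size `O(δ)`. If the score is `O(δ)` as well,
the product is `O(δ²)`, which is the claimed order. The score bound comes from Bernstein's
inequality, a union bound and the Borel–Cantelli lemma (`exists_ae_eventually_abs_avg_le`). A grid
of mesh `n⁻³` handles the supremum over `w`, and brackets built from monotonicity in `t` handle the
supremum over indicators. For the identity, Bernstein's inequality is run with the exponential
parameter `b^d δ`. Multiplied by the kernel bound `A b^{-d}` this is `A δ`, so conditional
exponential moments suffice without truncation. The resulting order is already `δ²`; the second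
summand of the stated rate is only added on top.

Bias. Given the covariates, the mean replaces `r(yᵢ)` by `θ(xᵢ, r)`. The fit reproduces polynomials
of degree at most `p`, so only the Taylor remainder, of order `b^{p+1}` on the support of the
kernel, is left.

The conditional law has the right means for each single `r` off a null set, but there are
uncountably many indicators. Rational cutoffs give one null set, and right continuity in `t` does
the rest. For `θ(x, 𝟙(· ≤ t))` this must hold at every `x`, and it does
(`RegressionModel.tendsto_theta_cutoff`): a population fit with an auxiliary bandwidth `β` bounds
increments in `t` by `O(β^{p+1})` plus `O(β^{-d})` times the increment of the distribution function
of `y`. -/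

namespace LocalPoly

/-! ### Coercive matrices and their inverses, in the sup norm -/

section Coercive

variable {ι : Type*} [Fintype ι]

/-- The quadratic form of `M` dominates `c` times the square of the sup norm. -/
def Coercive (c : ℝ) (M : Matrix ι ι ℝ) : Prop := ∀ a : ι → ℝ, c * ‖a‖ ^ 2 ≤ a ⬝ᵥ M.mulVec a

theorem abs_dotProduct_le (a v : ι → ℝ) : |a ⬝ᵥ v| ≤ Fintype.card ι * (‖a‖ * ‖v‖) := by
  calc |a ⬝ᵥ v| ≤ ∑ i, |a i * v i| := Finset.abs_sum_le_sum_abs _ _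
    _ ≤ ∑ _i : ι, ‖a‖ * ‖v‖ := by
        refine Finset.sum_le_sum fun i _ => ?_
        rw [abs_mul]
        exact mul_le_mul (norm_le_pi_norm a i) (norm_le_pi_norm v i) (abs_nonneg _)
          (norm_nonneg _)
    _ = _ := by simp

theorem norm_mulVec_le {M : Matrix ι ι ℝ} {δ : ℝ} (hδ : 0 ≤ δ) (hM : ∀ i j, |M i j| ≤ δ)
    (v : ι → ℝ) : ‖M.mulVec v‖ ≤ Fintype.card ι * δ * ‖v‖ := by
  refine (pi_norm_le_iff_of_nonneg (by positivity)).2 fun i => ?_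
  have h : ‖M i‖ ≤ δ := (pi_norm_le_iff_of_nonneg hδ).2 fun j => hM i j
  calc ‖M.mulVec v i‖ ≤ Fintype.card ι * (‖M i‖ * ‖v‖) := abs_dotProduct_le _ _
    _ ≤ Fintype.card ι * (δ * ‖v‖) := by gcongr
    _ = _ := by ring

/-- An entrywise error `δ` moves the quadratic form by at most `card² * δ * ‖a‖²`, and half of the
coercivity absorbs this. -/
theorem Coercive.perturb {c δ : ℝ} {M N : Matrix ι ι ℝ} (hM : Coercive c M) (hδ : 0 ≤ δ)
    (hMN : ∀ i j, |N i j - M i j| ≤ δ) (hc : (Fintype.card ι : ℝ) ^ 2 * δ ≤ c / 2) :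
    Coercive (c / 2) N := by
  intro a
  have h1 : a ⬝ᵥ N.mulVec a = a ⬝ᵥ M.mulVec a + a ⬝ᵥ (N - M).mulVec a := by
    rw [Matrix.sub_mulVec, dotProduct_sub]; ring
  have h2 : |a ⬝ᵥ (N - M).mulVec a| ≤ c / 2 * ‖a‖ ^ 2 := by
    calc _ ≤ Fintype.card ι * (‖a‖ * ‖(N - M).mulVec a‖) := abs_dotProduct_le _ _
      _ ≤ Fintype.card ι * (‖a‖ * (Fintype.card ι * δ * ‖a‖)) := by
          gcongr; exact norm_mulVec_le hδ hMN a
      _ = (Fintype.card ι : ℝ) ^ 2 * δ * ‖a‖ ^ 2 := by ring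
      _ ≤ _ := by gcongr
  have := hM a
  have := neg_le_of_abs_le h2
  rw [h1]; linarith

variable [DecidableEq ι]

theorem Coercive.isUnit_det {c : ℝ} (hc : 0 < c) {M : Matrix ι ι ℝ} (hM : Coercive c M) :
    IsUnit M.det := by
  rw [← Matrix.isUnit_iff_isUnit_det, ← Matrix.mulVec_injective_iff_isUnit]
  intro a a' h
  have h0 : M.mulVec (a - a') = 0 := by rw [Matrix.mulVec_sub]; exact sub_eq_zero.2 h
  have h1 := hM (a - a')
  rw [h0, dotProduct_zero] at h1
  have h2 : ‖a - a'‖ ^ 2 = 0 := le_antisymm (by nlinarith) (by positivity)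
  exact sub_eq_zero.1 (norm_eq_zero.1 (pow_eq_zero_iff two_ne_zero |>.1 h2))

theorem Coercive.mulVec_inv {c : ℝ} (hc : 0 < c) {M : Matrix ι ι ℝ} (hM : Coercive c M)
    (v : ι → ℝ) : M.mulVec (M⁻¹.mulVec v) = v := by
  rw [Matrix.mulVec_mulVec, Matrix.mul_nonsing_inv _ (hM.isUnit_det hc), Matrix.one_mulVec]

theorem Coercive.inv_mulVec {c : ℝ} (hc : 0 < c) {M : Matrix ι ι ℝ} (hM : Coercive c M)
    (v : ι → ℝ) : M⁻¹.mulVec (M.mulVec v) = v := by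
  rw [Matrix.mulVec_mulVec, Matrix.nonsing_inv_mul _ (hM.isUnit_det hc), Matrix.one_mulVec]

theorem Coercive.norm_inv_mulVec_le {c : ℝ} (hc : 0 < c) {M : Matrix ι ι ℝ} (hM : Coercive c M)
    (v : ι → ℝ) : ‖M⁻¹.mulVec v‖ ≤ Fintype.card ι / c * ‖v‖ := by
  set z := M⁻¹.mulVec v with hz
  have h1 := hM z
  rw [hz, hM.mulVec_inv hc, ← hz] at h1
  have h2 : c * ‖z‖ ^ 2 ≤ Fintype.card ι * (‖z‖ * ‖v‖) :=
    h1.trans ((le_abs_self _).trans (abs_dotProduct_le _ _))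
  rcases (norm_nonneg z).eq_or_lt with h | h
  · rw [← h]; positivity
  · have h3 : ‖z‖ * c ≤ Fintype.card ι * ‖v‖ := by
      refine le_of_mul_le_mul_left ?_ h
      nlinarith
    rw [div_mul_eq_mul_div, le_div_iff₀ hc]
    exact h3

/-- Resolvent identity `N⁻¹ - M⁻¹ = -N⁻¹ (N - M) M⁻¹`. The bound is a product of `δ` and `‖v‖`,
which is what makes the non-linearity error quadratic in the rate. -/
theorem Coercive.norm_inv_sub_inv_mulVec_le {c δ : ℝ} (hc : 0 < c) (hδ : 0 ≤ δ)
    {M N : Matrix ι ι ℝ} (hM : Coercive c M) (hN : Coercive c N)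
    (hMN : ∀ i j, |N i j - M i j| ≤ δ) (v : ι → ℝ) :
    ‖(N⁻¹ - M⁻¹).mulVec v‖ ≤ (Fintype.card ι / c) ^ 2 * Fintype.card ι * δ * ‖v‖ := by
  have h : (N⁻¹ - M⁻¹).mulVec v = -N⁻¹.mulVec ((N - M).mulVec (M⁻¹.mulVec v)) := by
    rw [Matrix.sub_mulVec, Matrix.sub_mulVec, hM.mulVec_inv hc, Matrix.mulVec_sub,
      hN.inv_mulVec hc]
    abel
  rw [h, norm_neg]
  calc _ ≤ Fintype.card ι / c * ‖(N - M).mulVec (M⁻¹.mulVec v)‖ := hN.norm_inv_mulVec_le hc _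
    _ ≤ Fintype.card ι / c * (Fintype.card ι * δ * (Fintype.card ι / c * ‖v‖)) := by
        gcongr
        exact (norm_mulVec_le hδ hMN _).trans (by gcongr; exact hM.norm_inv_mulVec_le hc v)
    _ = _ := by ring

end Coercive

/-! ### Compactly supported Lipschitz functions and their rescalings -/

section Bumps

variable {d : ℕ}

/-- A Lipschitz function that is bounded and vanishes off a ball, with one constant `A` for the
bound and the Lipschitz constant. -/
structure IsBump (ρ A : ℝ) (g : (Fin d → ℝ) → ℝ) : Prop where
  lip : ∀ u v, |g u - g v| ≤ A * ‖u - v‖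
  bdd : ∀ u, |g u| ≤ A
  supp : ∀ u, ρ < ‖u‖ → g u = 0

namespace IsBump

variable {ρ A : ℝ} {g : (Fin d → ℝ) → ℝ}

theorem nonneg_const (hg : IsBump ρ A g) : 0 ≤ A := (abs_nonneg _).trans (hg.bdd 0)

theorem mono {A' : ℝ} (hg : IsBump ρ A g) (h : A ≤ A') : IsBump ρ A' g where
  lip u v := (hg.lip u v).trans (by gcongr)
  bdd u := (hg.bdd u).trans h
  supp := hg.supp

theorem continuous (hg : IsBump ρ A g) : Continuous g := by
  have : LipschitzWith ⟨A, hg.nonneg_const⟩ g := LipschitzWith.of_dist_le_mul fun u v => by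
    rw [Real.dist_eq, dist_eq_norm]; exact hg.lip u v
  exact this.continuous

theorem coord_mul (hg : IsBump ρ A g) (hρ : 0 ≤ ρ) (i : Fin d) :
    IsBump ρ (ρ * A + A) fun u => u i * g u := by
  have hA := hg.nonneg_const
  -- The factor `u i` is unbounded, but only one of the two points has to lie in the ball; by
  -- symmetry it can be either.
  have key : ∀ u v : Fin d → ℝ, ‖u‖ ≤ ρ → |u i * g u - v i * g v| ≤ (ρ * A + A) * ‖u - v‖ := by
    intro u v hu
    have h1 : u i * g u - v i * g v = u i * (g u - g v) + (u - v) i * g v := by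
      simp only [Pi.sub_apply]; ring
    rw [h1]
    calc _ ≤ |u i| * |g u - g v| + |(u - v) i| * |g v| := by
          rw [← abs_mul, ← abs_mul]; exact abs_add_le _ _
      _ ≤ ρ * (A * ‖u - v‖) + ‖u - v‖ * A := by
          gcongr
          · exact (norm_le_pi_norm u i).trans hu
          · exact hg.lip u v
          · exact norm_le_pi_norm (u - v) i
          · exact hg.bdd v
      _ = _ := by ring
  refine ⟨fun u v => ?_, fun u => ?_, fun u hu => by rw [hg.supp u hu, mul_zero]⟩
  · rcases le_or_gt ‖u‖ ρ with hu | hu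
    · exact key u v hu
    rcases le_or_gt ‖v‖ ρ with hv | hv
    · rw [abs_sub_comm, norm_sub_rev]; exact key v u hv
    · rw [hg.supp u hu, hg.supp v hv]
      simp only [mul_zero, sub_zero, abs_zero]
      positivity
  · rcases le_or_gt ‖u‖ ρ with hu | hu
    · rw [abs_mul]
      have : |u i| * |g u| ≤ ρ * A := by
        gcongr
        · exact (norm_le_pi_norm u i).trans hu
        · exact hg.bdd u
      linarith
    · rw [hg.supp u hu]
      simp only [mul_zero, abs_zero]
      positivity

theorem exists_pow_mul (hg : IsBump ρ A g) (hρ : 0 ≤ ρ) (i : Fin d) (k : ℕ) :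
    ∃ A', IsBump ρ A' fun u => u i ^ k * g u := by
  induction k with
  | zero => exact ⟨A, by simpa using hg⟩
  | succ k ih =>
    obtain ⟨A', h⟩ := ih
    refine ⟨ρ * A' + A', ?_⟩
    convert h.coord_mul hρ i using 2 with u
    ring

theorem exists_prod_mul (hg : IsBump ρ A g) (hρ : 0 ≤ ρ) (k : Fin d → ℕ) (s : Finset (Fin d)) :
    ∃ A', IsBump ρ A' fun u => (∏ i ∈ s, u i ^ k i) * g u := by
  classical
  induction s using Finset.induction_on with
  | empty => exact ⟨A, by simpa using hg⟩
  | insert i s his ih =>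
    obtain ⟨A', h⟩ := ih
    obtain ⟨A'', h⟩ := h.exists_pow_mul hρ i (k i)
    refine ⟨A'', (funext fun u => ?_ :
      (fun u => (∏ i ∈ insert i s, u i ^ k i) * g u) = _) ▸ h⟩
    rw [Finset.prod_insert his, mul_assoc]

/-- Bracketing needs nonnegative weights, and kernel times monomials changes sign; positive and
negative parts keep the same constants. -/
theorem posPart (hg : IsBump ρ A g) : IsBump ρ A fun u => max (g u) 0 where
  lip u v := (abs_max_sub_max_le_abs _ _ _).trans (hg.lip u v)
  bdd u := by
    rw [abs_of_nonneg (le_max_right _ _)]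
    exact max_le ((le_abs_self _).trans (hg.bdd u)) hg.nonneg_const
  supp u hu := by rw [hg.supp u hu, max_self]

theorem neg (hg : IsBump ρ A g) : IsBump ρ A fun u => -g u where
  lip u v := by rw [← neg_sub', abs_neg]; exact hg.lip u v
  bdd u := by rw [abs_neg]; exact hg.bdd u
  supp u hu := by rw [hg.supp u hu, neg_zero]

end IsBump

/-- The kernel times two monomials. -/
def kernelMonomial (K : (Fin d → ℝ) → ℝ) (p : ℕ) (ν ν' : MultiIdx d p) (u : Fin d → ℝ) : ℝ :=
  K u * (polyBasis p u ν * polyBasis p u ν')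

/-- Finitely many index pairs allow a common `ρ` and `A`. The radius is enlarged to at least `1` so
that powers of `ρ` increase with the exponent. -/
theorem exists_isBump_kernelMonomial {K : (Fin d → ℝ) → ℝ} (hKlip : ∃ L, LipschitzWith L K)
    (hKsupp : HasCompactSupport K) (p : ℕ) :
    ∃ ρ A : ℝ, 1 ≤ ρ ∧ 0 < A ∧ ∀ ν ν', IsBump ρ A (kernelMonomial K p ν ν') := by
  obtain ⟨L, hL⟩ := hKlip
  obtain ⟨C, hC⟩ := hKsupp.exists_bound_of_continuous hL.continuous
  obtain ⟨ρ, hρ⟩ := hKsupp.isBounded.subset_closedBall 0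
  have hK : IsBump (max ρ 1) (max (L : ℝ) C) K := by
    refine ⟨fun u v => ?_, fun u => (hC u).trans (le_max_right _ _), fun u hu => ?_⟩
    · refine ((hL.norm_sub_le u v).trans ?_)
      gcongr
      exact le_max_left _ _
    · by_contra h
      have := hρ (subset_tsupport K h)
      rw [mem_closedBall_zero_iff] at this
      exact absurd (this.trans (le_max_left ρ 1)) (not_le.2 hu)
  have hρ0 : (0 : ℝ) ≤ max ρ 1 := zero_le_one.trans (le_max_right _ _)
  have key : ∀ q : MultiIdx d p × MultiIdx d p,
      ∃ A, IsBump (max ρ 1) A (kernelMonomial K p q.1 q.2) := by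
    intro q
    obtain ⟨A, h⟩ := hK.exists_prod_mul hρ0 (fun i => (q.2.1 i : ℕ)) Finset.univ
    obtain ⟨A, h⟩ := h.exists_prod_mul hρ0 (fun i => (q.1.1 i : ℕ)) Finset.univ
    refine ⟨A, (funext fun u => ?_ : kernelMonomial K p q.1 q.2 = _) ▸ h⟩
    simp only [kernelMonomial, polyBasis]
    ring
  choose A hA using key
  refine ⟨max ρ 1, ∑ q, A q + 1, le_max_right _ _, ?_, fun ν ν' => (hA (ν, ν')).mono ?_⟩
  · have := Finset.sum_nonneg fun q (_ : q ∈ Finset.univ) => (hA q).nonneg_const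
    linarith
  · have := Finset.single_le_sum (fun q _ => (hA q).nonneg_const) (Finset.mem_univ (ν, ν'))
    linarith

theorem polyBasis_zero (p : ℕ) (u : Fin d → ℝ) : polyBasis p u (MultiIdx.zero d p) = 1 := by
  simp [polyBasis, MultiIdx.zero]

theorem continuous_polyBasis_apply (p : ℕ) (ν : MultiIdx d p) :
    Continuous fun u : Fin d → ℝ => polyBasis p u ν := by
  unfold polyBasis; fun_prop

theorem continuous_scaled (b : ℝ) (w : Fin d → ℝ) : Continuous (scaled b w) := by
  unfold scaled; fun_prop

/-- The function `g` rescaled to the bandwidth `b` around `w`. -/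
noncomputable def localize (b : ℝ) (g : (Fin d → ℝ) → ℝ) (w x : Fin d → ℝ) : ℝ :=
  (b ^ d)⁻¹ * g (scaled b w x)

theorem gramTerm_apply (K : (Fin d → ℝ) → ℝ) (p : ℕ) (b : ℝ) (w x : Fin d → ℝ)
    (ν ν' : MultiIdx d p) :
    gramTerm K p b w x ν ν' = localize b (kernelMonomial K p ν ν') w x := by
  simp only [gramTerm, Matrix.smul_apply, Matrix.vecMulVec_apply, smul_eq_mul, localize,
    kernelMonomial]
  ring

namespace IsBump

variable {ρ A b : ℝ} {g : (Fin d → ℝ) → ℝ}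

theorem continuous_localize (hg : IsBump ρ A g) (w : Fin d → ℝ) : Continuous (localize b g w) :=
  continuous_const.mul (hg.continuous.comp (continuous_scaled b w))

theorem abs_localize_le (hg : IsBump ρ A g) (hb : 0 < b) (w x : Fin d → ℝ) :
    |localize b g w x| ≤ A * (b ^ d)⁻¹ := by
  rw [localize, abs_mul, abs_of_pos (by positivity : 0 < (b ^ d)⁻¹), mul_comm]
  gcongr
  exact hg.bdd _

theorem abs_localize_sub_le (hg : IsBump ρ A g) (hb : 0 < b) (w w' x : Fin d → ℝ) :
    |localize b g w x - localize b g w' x| ≤ A * ((b ^ d)⁻¹ * b⁻¹) * ‖w - w'‖ := by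
  have h1 : scaled b w x - scaled b w' x = b⁻¹ • (w' - w) := by
    simp only [scaled, ← smul_sub]; congr 1; abel
  have h2 := hg.lip (scaled b w x) (scaled b w' x)
  rw [h1, norm_smul, norm_inv, Real.norm_of_nonneg hb.le, norm_sub_rev] at h2
  rw [localize, localize, ← mul_sub, abs_mul, abs_of_pos (by positivity : 0 < (b ^ d)⁻¹)]
  calc _ ≤ (b ^ d)⁻¹ * (A * (b⁻¹ * ‖w - w'‖)) := by gcongr
    _ = _ := by ring

theorem norm_sub_le_of_localize_ne_zero (hg : IsBump ρ A g) (hb : 0 < b) {w x : Fin d → ℝ}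
    (h : localize b g w x ≠ 0) : ‖x - w‖ ≤ ρ * b := by
  by_contra hlt
  refine h ?_
  rw [localize, hg.supp, mul_zero]
  rw [scaled, norm_smul, norm_inv, Real.norm_of_nonneg hb.le, ← div_eq_inv_mul, lt_div_iff₀ hb]
  exact not_le.1 hlt

theorem integrable_localize (hg : IsBump ρ A g) (hb : 0 < b) (P : Measure (Fin d → ℝ))
    [IsFiniteMeasure P] (w : Fin d → ℝ) : Integrable (localize b g w) P :=
  Integrable.of_bound (hg.continuous_localize w).aestronglyMeasurable (A * (b ^ d)⁻¹)
    (ae_of_all _ fun x => hg.abs_localize_le hb w x)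

/-- The support lies in a sup-norm ball of volume `(2ρb)^d`, which cancels the factor `b^{-d}`. -/
theorem integral_abs_localize_le (hg : IsBump ρ A g) (hρ : 0 ≤ ρ) (hb : 0 < b)
    {P : Measure (Fin d → ℝ)} [IsFiniteMeasure P] {F : ℝ} (hF : 0 ≤ F)
    (hP : P ≤ ENNReal.ofReal F • volume) (w : Fin d → ℝ) :
    ∫ x, |localize b g w x| ∂P ≤ A * F * (2 * ρ) ^ d := by
  have hA := hg.nonneg_const
  have h1 : ∫ x, |localize b g w x| ∂P ≤
      ∫ x, (Metric.closedBall w (ρ * b)).indicator (fun _ => A * (b ^ d)⁻¹) x ∂P := by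
    refine integral_mono (hg.integrable_localize hb P w).abs
      ((integrable_const _).indicator Metric.isClosed_closedBall.measurableSet) fun x => ?_
    by_cases hx : x ∈ Metric.closedBall w (ρ * b)
    · rw [Set.indicator_of_mem hx]; exact hg.abs_localize_le hb w x
    · have : localize b g w x = 0 := by
        by_contra h
        exact hx (mem_closedBall_iff_norm.2 (hg.norm_sub_le_of_localize_ne_zero hb h))
      simp [this, Set.indicator_of_notMem hx]
  have h2 : P.real (Metric.closedBall w (ρ * b)) ≤ F * (2 * (ρ * b)) ^ d := by
    refine ENNReal.toReal_le_of_le_ofReal (by positivity) ?_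
    refine (hP _).trans ?_
    rw [Measure.smul_apply, Real.volume_pi_closedBall w (by positivity), smul_eq_mul,
      ← ENNReal.ofReal_mul hF, Fintype.card_fin]
  rw [integral_indicator Metric.isClosed_closedBall.measurableSet, setIntegral_const,
    smul_eq_mul] at h1
  calc _ ≤ _ := h1
    _ ≤ F * (2 * (ρ * b)) ^ d * (A * (b ^ d)⁻¹) := by gcongr
    _ = A * F * (2 * ρ) ^ d * (b ^ d * (b ^ d)⁻¹) := by simp only [mul_pow]; ring
    _ = _ := by rw [mul_inv_cancel₀ (by positivity), mul_one]

/-- Only one of the two factors `b^{-d}` cancels; this is the variance of order `b^{-d}` in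
Bernstein's inequality. -/
theorem integral_sq_localize_le (hg : IsBump ρ A g) (hρ : 0 ≤ ρ) (hb : 0 < b)
    {P : Measure (Fin d → ℝ)} [IsFiniteMeasure P] {F : ℝ} (hF : 0 ≤ F)
    (hP : P ≤ ENNReal.ofReal F • volume) (w : Fin d → ℝ) :
    ∫ x, localize b g w x ^ 2 ∂P ≤ A ^ 2 * F * (2 * ρ) ^ d * (b ^ d)⁻¹ := by
  have hA := hg.nonneg_const
  calc ∫ x, localize b g w x ^ 2 ∂P ≤ ∫ x, A * (b ^ d)⁻¹ * |localize b g w x| ∂P := by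
        refine integral_mono_of_nonneg (ae_of_all _ fun x => sq_nonneg _)
          ((hg.integrable_localize hb P w).abs.const_mul _) (ae_of_all _ fun x => ?_)
        simp only
        rw [← sq_abs, sq]
        gcongr
        exact hg.abs_localize_le hb w x
    _ = A * (b ^ d)⁻¹ * ∫ x, |localize b g w x| ∂P := integral_const_mul _ _
    _ ≤ A * (b ^ d)⁻¹ * (A * F * (2 * ρ) ^ d) := by
        gcongr
        exact hg.integral_abs_localize_le hρ hb hF hP w
    _ = _ := by ring

end IsBump

end Bumps

/-! ### Polynomials on boxes and the lower bound for the population Gram matrix -/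

section PolynomialBasis

variable {d : ℕ}

/-- Used to upgrade almost everywhere identities of continuous functions on a box to identities at
every point. -/
theorem subset_closure_interior_Icc {l h : Fin d → ℝ} (hlh : ∀ i, l i < h i) :
    Set.Icc l h ⊆ closure (interior (Set.Icc l h)) := by
  rw [← Set.pi_univ_Icc, interior_pi_set Set.finite_univ, closure_pi_set]
  refine Set.pi_mono fun i _ => ?_
  rw [closure_interior_Icc (hlh i).ne]

/-- The entries of `a` are the coefficients of distinct monomials in a polynomial that vanishes on a
product of infinite sets. -/
theorem eq_zero_of_polyBasis_dotProduct_eq_zero {p : ℕ} {l h : Fin d → ℝ} (hlh : ∀ i, l i < h i)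
    {a : MultiIdx d p → ℝ} (ha : ∀ u ∈ Set.Icc l h, polyBasis p u ⬝ᵥ a = 0) : a = 0 := by
  classical
  let e : MultiIdx d p → (Fin d →₀ ℕ) := fun ν =>
    Finsupp.equivFunOnFinite.symm fun i => (ν.1 i : ℕ)
  have he : Function.Injective e := by
    intro ν ν' h
    have h := Finsupp.equivFunOnFinite.symm.injective h
    exact Subtype.ext (funext fun i => Fin.ext (congrFun h i))
  let P : MvPolynomial (Fin d) ℝ := ∑ ν, MvPolynomial.monomial (e ν) (a ν)
  have hP : P = 0 := by
    refine MvPolynomial.funext_set (fun i => Set.Icc (l i) (h i))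
      (fun i => Set.Icc_infinite (hlh i)) fun u hu => ?_
    rw [Set.pi_univ_Icc] at hu
    rw [map_zero, ← ha u hu, map_sum, dotProduct]
    refine Finset.sum_congr rfl fun ν _ => ?_
    rw [MvPolynomial.eval_monomial, Finsupp.prod_fintype _ _ (fun i => pow_zero _), mul_comm]
    rfl
  funext ν
  have h1 : MvPolynomial.coeff (e ν) P = a ν := by
    simp only [P, MvPolynomial.coeff_sum, MvPolynomial.coeff_monomial, he.eq_iff]
    simp
  rw [← h1, hP, MvPolynomial.coeff_zero, Pi.zero_apply]

theorem continuous_sq_polyBasis_dotProduct (p : ℕ) (a : MultiIdx d p → ℝ) :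
    Continuous fun u : Fin d → ℝ => (polyBasis p u ⬝ᵥ a) ^ 2 := by
  have := continuous_polyBasis_apply (d := d) p
  unfold dotProduct
  fun_prop

/-- The integral is continuous in `a` and positive off zero, so it has a positive minimum on the
compact unit sphere; homogeneity of degree two extends the bound. -/
theorem exists_lower_bound_integral_polyBasis_sq (p : ℕ) {l h : Fin d → ℝ}
    (hlh : ∀ i, l i < h i) :
    ∃ c > 0, ∀ a : MultiIdx d p → ℝ,
      c * ‖a‖ ^ 2 ≤ ∫ u in Set.Icc l h, (polyBasis p u ⬝ᵥ a) ^ 2 := by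
  have hcont : Continuous (Function.uncurry
      fun (a : MultiIdx d p → ℝ) (u : Fin d → ℝ) => (polyBasis p u ⬝ᵥ a) ^ 2) := by
    have := continuous_polyBasis_apply (d := d) p
    unfold Function.uncurry dotProduct
    fun_prop
  set q : (MultiIdx d p → ℝ) → ℝ := fun a => ∫ u in Set.Icc l h, (polyBasis p u ⬝ᵥ a) ^ 2
  have hq : Continuous q := continuous_parametric_integral_of_continuous hcont isCompact_Icc
  have hpos : ∀ a, a ≠ 0 → 0 < q a := by
    intro a ha
    have hnn : ∀ u : Fin d → ℝ, 0 ≤ (polyBasis p u ⬝ᵥ a) ^ 2 := fun u => sq_nonneg _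
    have hq0 : 0 ≤ q a := integral_nonneg hnn
    refine hq0.lt_of_ne fun h0 => ha ?_
    have hc := continuous_sq_polyBasis_dotProduct (d := d) p a
    have h1 : (fun u : Fin d → ℝ => (polyBasis p u ⬝ᵥ a) ^ 2)
        =ᵐ[volume.restrict (Set.Icc l h)] fun _ => 0 :=
      (setIntegral_eq_zero_iff_of_nonneg_ae (ae_of_all _ hnn)
        (hc.continuousOn.integrableOn_compact isCompact_Icc)).1 h0.symm
    have h2 := Measure.eqOn_of_ae_eq h1 hc.continuousOn continuousOn_const
      (subset_closure_interior_Icc hlh)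
    exact eq_zero_of_polyBasis_dotProduct_eq_zero hlh fun u hu =>
      pow_eq_zero_iff two_ne_zero |>.1 (h2 hu)
  have hne : (Metric.sphere (0 : MultiIdx d p → ℝ) 1).Nonempty := by
    refine ⟨fun _ => 1, ?_⟩
    rw [mem_sphere_zero_iff_norm]
    have : Nonempty (MultiIdx d p) := ⟨MultiIdx.zero d p⟩
    rw [pi_norm_const, norm_one]
  obtain ⟨a₀, ha₀, hmin⟩ := (isCompact_sphere (0 : MultiIdx d p → ℝ) 1).exists_isMinOn hne
    hq.continuousOn
  have ha₀0 : a₀ ≠ 0 := by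
    rintro rfl
    simp at ha₀
  refine ⟨q a₀, hpos a₀ ha₀0, fun a => ?_⟩
  rcases eq_or_ne a 0 with rfl | ha
  · simp
  have hna : ‖a‖ ≠ 0 := norm_ne_zero_iff.2 ha
  have h1 : q a₀ ≤ q (‖a‖⁻¹ • a) := by
    refine hmin ?_
    rw [mem_sphere_zero_iff_norm, norm_smul, norm_inv, norm_norm, inv_mul_cancel₀ hna]
  have h2 : q (‖a‖⁻¹ • a) = (‖a‖⁻¹) ^ 2 * q a := by
    simp only [q, dotProduct_smul, smul_eq_mul, mul_pow, integral_const_mul]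
  rw [h2] at h1
  calc q a₀ * ‖a‖ ^ 2 ≤ (‖a‖⁻¹) ^ 2 * q a * ‖a‖ ^ 2 := by gcongr
    _ = q a := by field_simp

theorem sum_gramTerm (K : (Fin d → ℝ) → ℝ) (p : ℕ) (b : ℝ) (w x : Fin d → ℝ)
    (a : MultiIdx d p → ℝ) :
    ∑ ν, ∑ ν', a ν * (gramTerm K p b w x ν ν' * a ν') =
      (b ^ d)⁻¹ * (K (scaled b w x) * (polyBasis p (scaled b w x) ⬝ᵥ a) ^ 2) := by
  rw [sq, dotProduct, Finset.sum_mul_sum, Finset.mul_sum, Finset.mul_sum]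
  refine Finset.sum_congr rfl fun ν _ => ?_
  rw [Finset.mul_sum, Finset.mul_sum]
  refine Finset.sum_congr rfl fun ν' _ => ?_
  rw [gramTerm_apply, localize, kernelMonomial]
  ring

theorem dotProduct_gram_mulVec {K : (Fin d → ℝ) → ℝ} {p : ℕ} {ρ A b : ℝ} (hb : 0 < b)
    (hK : ∀ ν ν', IsBump ρ A (kernelMonomial K p ν ν')) (P : Measure (Fin d → ℝ))
    [IsFiniteMeasure P] (w : Fin d → ℝ) (a : MultiIdx d p → ℝ) :
    a ⬝ᵥ (gram K p b P w).mulVec a =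
      ∫ x, (b ^ d)⁻¹ * (K (scaled b w x) * (polyBasis p (scaled b w x) ⬝ᵥ a) ^ 2) ∂P := by
  have hint : ∀ ν ν', Integrable (fun x => a ν * (gramTerm K p b w x ν ν' * a ν')) P := by
    intro ν ν'
    simp only [gramTerm_apply]
    exact (((hK ν ν').integrable_localize hb P w).mul_const _).const_mul _
  simp only [dotProduct, Matrix.mulVec, gram, Matrix.of_apply]
  calc _ = ∑ ν, ∑ ν', ∫ x, a ν * (gramTerm K p b w x ν ν' * a ν') ∂P := by
        refine Finset.sum_congr rfl fun ν _ => ?_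
        rw [Finset.mul_sum]
        refine Finset.sum_congr rfl fun ν' _ => ?_
        rw [integral_const_mul, integral_mul_const]
    _ = ∫ x, ∑ ν, ∑ ν', a ν * (gramTerm K p b w x ν ν' * a ν') ∂P := by
        rw [integral_finsetSum _ fun ν _ => integrable_finsetSum _ fun ν' _ => hint ν ν']
        refine Finset.sum_congr rfl fun ν _ => ?_
        rw [integral_finsetSum _ fun ν' _ => hint ν ν']
    _ = _ := by
        simp only [sum_gramTerm]
        rfl

/-- The population Gram matrix is coercive, uniformly over the cube and over bounded
bandwidths. -/
theorem exists_coercive_gram {K : (Fin d → ℝ) → ℝ} {p : ℕ} {ρ A : ℝ}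
    (hK : ∀ ν ν', IsBump ρ A (kernelMonomial K p ν ν')) (hKc : Continuous K)
    (hKnonneg : ∀ u, 0 ≤ K u) (hKzero : 0 < K 0) {P : Measure (Fin d → ℝ)} [IsFiniteMeasure P]
    {F : ℝ} (hF : 0 < F)
    (hP : ENNReal.ofReal F • volume.restrict (Set.Icc (0 : Fin d → ℝ) 1) ≤ P) (B : ℝ) :
    ∃ c > 0, ∀ b, 0 < b → b ≤ B → ∀ w ∈ Set.Icc (0 : Fin d → ℝ) 1,
      Coercive c (gram K p b P w) := by
  rcases le_or_gt B 0 with hB | hB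
  · exact ⟨1, one_pos, fun b hb hbB => absurd (hb.trans_le hbB) (not_lt.2 hB)⟩
  obtain ⟨δ, hδ, hKδ⟩ : ∃ δ > 0, ∀ u : Fin d → ℝ, ‖u‖ ≤ δ → K 0 / 2 ≤ K u := by
    have h1 : ∀ᶠ u in 𝓝 (0 : Fin d → ℝ), K 0 / 2 < K u :=
      hKc.continuousAt.eventually (lt_mem_nhds (half_lt_self hKzero))
    obtain ⟨δ, hδ, h⟩ := Metric.nhds_basis_closedBall.eventually_iff.1 h1
    exact ⟨δ, hδ, fun u hu => (h (mem_closedBall_zero_iff.2 hu)).le⟩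
  -- `η ≤ δ` keeps `K ≥ K 0 / 2` on the box, and `η ≤ 1 / (2B)` gives `b η ≤ 1 / 2`, so the box
  -- scaled by `b` fits into half the side of the cube.
  set η := min δ (1 / (2 * B)) with hη
  have hη0 : 0 < η := by positivity
  -- The box extends downwards from the origin in the coordinates of `s` and upwards in the others.
  let l : Set (Fin d) → Fin d → ℝ := fun s => s.indicator fun _ => -η
  let h : Set (Fin d) → Fin d → ℝ := fun s => sᶜ.indicator fun _ => η
  have hlh : ∀ s i, l s i < h s i := by
    intro s i
    by_cases his : i ∈ s <;> simp [l, h, his, hη0]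
  choose c hc0 hc using fun s => exists_lower_bound_integral_polyBasis_sq p (hlh s)
  obtain ⟨c₀, hc₀, hcle⟩ : ∃ c₀ > 0, ∀ s, c₀ ≤ c s := by
    obtain ⟨s₀, hs₀⟩ := Finite.exists_min c
    exact ⟨c s₀, hc0 s₀, hs₀⟩
  refine ⟨F * (K 0 / 2 * c₀), by positivity, fun b hb hbB w hw a => ?_⟩
  rw [dotProduct_gram_mulVec hb hK P w a]
  -- Coordinates above `1 / 2` leave room below, the remaining ones leave room above.
  set s : Set (Fin d) := {i | 1 / 2 < w i}
  have hbη : b * η ≤ 1 / 2 := by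
    calc b * η ≤ B * (1 / (2 * B)) := by gcongr; exact min_le_right _ _
      _ = _ := by field_simp
  have hnorm : ∀ u ∈ Set.Icc (l s) (h s), ‖u‖ ≤ η := by
    intro u hu
    refine (pi_norm_le_iff_of_nonneg hη0.le).2 fun i => ?_
    have h1 := hu.1 i
    have h2 := hu.2 i
    rw [Real.norm_eq_abs, abs_le]
    by_cases his : i ∈ s <;> simp [l, h, his] at h1 h2 <;> constructor <;> linarith
  have hmem : ∀ x, scaled b w x ∈ Set.Icc (l s) (h s) → x ∈ Set.Icc (0 : Fin d → ℝ) 1 := by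
    intro x hx
    have hxw : ∀ i, x i = w i + b * scaled b w x i := by
      intro i
      simp only [scaled, Pi.smul_apply, Pi.sub_apply, smul_eq_mul]
      field_simp
      ring
    have key : ∀ i, 0 ≤ x i ∧ x i ≤ 1 := by
      intro i
      have h1 := hx.1 i
      have h2 := hx.2 i
      have hw0 : 0 ≤ w i := hw.1 i
      have hw1 : w i ≤ 1 := hw.2 i
      rw [hxw i]
      by_cases his : i ∈ s
      · have : 1 / 2 < w i := his
        simp [l, h, his] at h1 h2
        constructor <;> nlinarith
      · have : w i ≤ 1 / 2 := not_lt.1 his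
        simp [l, h, his] at h1 h2
        constructor <;> nlinarith
    exact ⟨fun i => (key i).1, fun i => (key i).2⟩
  set φ : (Fin d → ℝ) → ℝ := (Set.Icc (l s) (h s)).indicator
    fun u => K 0 / 2 * (polyBasis p u ⬝ᵥ a) ^ 2 with hφ
  have hpc := continuous_sq_polyBasis_dotProduct (d := d) p a
  set ψ : (Fin d → ℝ) → ℝ := fun x =>
    (b ^ d)⁻¹ * (K (scaled b w x) * (polyBasis p (scaled b w x) ⬝ᵥ a) ^ 2) with hψ
  have hψc : Continuous ψ := continuous_const.mul
    ((hKc.mul hpc).comp (continuous_scaled b w))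
  have hψ0 : ∀ x, 0 ≤ ψ x := fun x => by
    have := hKnonneg (scaled b w x)
    positivity
  have hψint : Integrable ψ P := by
    by_contra hn
    have h1 : ψ = fun x => ∑ ν, ∑ ν', a ν * (gramTerm K p b w x ν ν' * a ν') := by
      simp only [sum_gramTerm, hψ]
    refine hn (h1 ▸ integrable_finsetSum _ fun ν _ => integrable_finsetSum _ fun ν' _ => ?_)
    simp only [gramTerm_apply]
    exact (((hK ν ν').integrable_localize hb P w).mul_const _).const_mul _
  have hφint : Integrable φ := (continuous_const.mul hpc).continuousOn.integrableOn_compact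
    isCompact_Icc |>.integrable_indicator measurableSet_Icc
  have hle : ∀ x ∈ Set.Icc (0 : Fin d → ℝ) 1, (b ^ d)⁻¹ * φ (scaled b w x) ≤ ψ x := by
    intro x _
    by_cases hx : scaled b w x ∈ Set.Icc (l s) (h s)
    · simp only [hφ, hψ, Set.indicator_of_mem hx]
      gcongr
      exact hKδ _ ((hnorm _ hx).trans (min_le_left _ _))
    · rw [hφ, Set.indicator_of_notMem hx, mul_zero]
      exact hψ0 x
  -- The Jacobian `b ^ d` of the rescaling cancels the normalization, so the bound does not depend
  -- on `b`.
  have hscale : ∫ x, (b ^ d)⁻¹ * φ (scaled b w x) = ∫ u, φ u := by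
    rw [integral_const_mul]
    have : ∫ x, φ (scaled b w x) = b ^ d * ∫ u, φ u := by
      simp only [scaled]
      rw [integral_sub_right_eq_self (fun y => φ (b⁻¹ • y)) w, Measure.integral_comp_inv_smul]
      rw [Module.finrank_fin_fun, abs_of_pos (by positivity), smul_eq_mul]
    rw [this, ← mul_assoc, inv_mul_cancel₀ (by positivity), one_mul]
  have hsint : Integrable fun x => (b ^ d)⁻¹ * φ (scaled b w x) := by
    refine Integrable.const_mul ?_ _
    have := (hφint.comp_smul (inv_ne_zero hb.ne')).comp_sub_right w
    exact this
  have hsupp : ∫ x in Set.Icc (0 : Fin d → ℝ) 1, (b ^ d)⁻¹ * φ (scaled b w x) =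
      ∫ x, (b ^ d)⁻¹ * φ (scaled b w x) := by
    refine setIntegral_eq_integral_of_forall_compl_eq_zero fun x hx => ?_
    rw [hφ, Set.indicator_of_notMem (fun h' => hx (hmem x h')), mul_zero]
  calc F * (K 0 / 2 * c₀) * ‖a‖ ^ 2 = F * (K 0 / 2 * (c₀ * ‖a‖ ^ 2)) := by ring
    _ ≤ F * (K 0 / 2 * (c s * ‖a‖ ^ 2)) := by gcongr; exact hcle s
    _ ≤ F * (K 0 / 2 * ∫ u in Set.Icc (l s) (h s), (polyBasis p u ⬝ᵥ a) ^ 2) := by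
        gcongr; exact hc s a
    _ = F * ∫ u, φ u := by rw [hφ, integral_indicator measurableSet_Icc, integral_const_mul]
    _ = F * ∫ x in Set.Icc (0 : Fin d → ℝ) 1, (b ^ d)⁻¹ * φ (scaled b w x) := by
        rw [hsupp, hscale]
    _ ≤ F * ∫ x in Set.Icc (0 : Fin d → ℝ) 1, ψ x := by
        gcongr ?_ * ?_
        exact setIntegral_mono_on hsint.integrableOn
          (hψc.continuousOn.integrableOn_compact isCompact_Icc) measurableSet_Icc hle
    _ = ∫ x, ψ x ∂(ENNReal.ofReal F • volume.restrict (Set.Icc (0 : Fin d → ℝ) 1)) := by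
        rw [integral_smul_measure, ENNReal.toReal_ofReal hF.le, smul_eq_mul]
    _ ≤ ∫ x, ψ x ∂P := integral_mono_measure hP (ae_of_all _ hψ0) hψint

end PolynomialBasis

/-! ### Normal equations of the weighted least squares problem -/

section Fit

variable {d n p : ℕ} {K : (Fin d → ℝ) → ℝ} {b : ℝ}

theorem e₁_dotProduct (v : MultiIdx d p → ℝ) : e₁ d p ⬝ᵥ v = v (MultiIdx.zero d p) := by
  simp [e₁]

/-- The criterion is written in `x - w` and the Gram matrix in `(x - w) / b`. The diagonal change of
basis is `1` at the constant monomial, so it does not affect the estimator. -/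
theorem polyBasis_sub (hb : b ≠ 0) (w x : Fin d → ℝ) (ν : MultiIdx d p) :
    polyBasis p (x - w) ν = b ^ (∑ i, (ν.1 i : ℕ)) * polyBasis p (scaled b w x) ν := by
  simp only [polyBasis, ← Finset.prod_pow_eq_pow_sum, ← Finset.prod_mul_distrib, ← mul_pow]
  refine Finset.prod_congr rfl fun i _ => ?_
  rw [scaled, Pi.smul_apply, smul_eq_mul, mul_inv_cancel_left₀ hb]

/-- The kernel-weighted sample moment `n⁻¹ ∑ᵢ p(uᵢ) b^{-d} K(uᵢ) zᵢ` of the responses `z`. -/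
noncomputable def moment (K : (Fin d → ℝ) → ℝ) (p : ℕ) (b : ℝ) (x : Fin n → Fin d → ℝ)
    (w : Fin d → ℝ) (z : Fin n → ℝ) : MultiIdx d p → ℝ :=
  (n : ℝ)⁻¹ • ∑ i, ((b ^ d)⁻¹ * K (scaled b w (x i)) * z i) • polyBasis p (scaled b w (x i))

theorem moment_add (x : Fin n → Fin d → ℝ) (w : Fin d → ℝ) (z z' : Fin n → ℝ) :
    moment K p b x w (z + z') = moment K p b x w z + moment K p b x w z' := by
  simp only [moment, ← smul_add, ← Finset.sum_add_distrib, ← add_smul, Pi.add_apply, mul_add]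

theorem gramHat_mulVec (x : Fin n → Fin d → ℝ) (w : Fin d → ℝ) (a : MultiIdx d p → ℝ) :
    (gramHat K p b x w).mulVec a =
      moment K p b x w fun i => polyBasis p (scaled b w (x i)) ⬝ᵥ a := by
  simp only [gramHat, moment, gramTerm, Matrix.smul_mulVec, Matrix.sum_mulVec,
    Matrix.vecMulVec_mulVec, op_smul_eq_smul, smul_smul]

theorem dotProduct_moment (hb : 0 < b) (hn : 0 < n) (x : Fin n → Fin d → ℝ) (w : Fin d → ℝ)
    (z : Fin n → ℝ) (a : MultiIdx d p → ℝ) :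
    n * b ^ d * (a ⬝ᵥ moment K p b x w z) =
      ∑ i, K (scaled b w (x i)) * z i * (polyBasis p (scaled b w (x i)) ⬝ᵥ a) := by
  have hn' : (n : ℝ) ≠ 0 := by positivity
  have hb' : b ^ d ≠ 0 := by positivity
  rw [moment, dotProduct_smul, dotProduct_sum, smul_eq_mul, Finset.mul_sum, Finset.mul_sum]
  refine Finset.sum_congr rfl fun i _ => ?_
  rw [dotProduct_smul, dotProduct_comm, smul_eq_mul]
  field_simp

/-- Without observations the matrix is zero, hence not coercive on a nonempty index type. -/
theorem pos_of_coercive_gramHat {c : ℝ} (hc : 0 < c) {x : Fin n → Fin d → ℝ} {w : Fin d → ℝ}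
    (hH : Coercive c (gramHat K p b x w)) : 0 < n := by
  rcases Nat.eq_zero_or_pos n with rfl | hn
  · exfalso
    have h := hH fun _ => 1
    have : Nonempty (MultiIdx d p) := ⟨MultiIdx.zero d p⟩
    simp [gramHat] at h
    linarith
  · exact hn

/-- The criterion is a quadratic function around the solution of the normal equations. -/
theorem lsCriterion_eq (hb : 0 < b) {c : ℝ} (hc : 0 < c) {x : Fin n → Fin d → ℝ}
    {w : Fin d → ℝ} (hH : Coercive c (gramHat K p b x w)) (y : Fin n → ℝ) (r : ℝ → ℝ) :
    -- `δ` is tied to `β` by an equation so that the instance `δ = 0` can be supplied literally.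
    ∃ C, ∀ β : MultiIdx d p → ℝ, ∀ δ : MultiIdx d p → ℝ,
      (δ = fun ν => b ^ (∑ i, (ν.1 i : ℕ)) * β ν -
        ((gramHat K p b x w)⁻¹.mulVec (moment K p b x w fun i => r (y i))) ν) →
      lsCriterion K p b x y w r β =
        n * b ^ d * (δ ⬝ᵥ (gramHat K p b x w).mulVec δ) + C := by
  have hn := pos_of_coercive_gramHat hc hH
  set g := (gramHat K p b x w)⁻¹.mulVec (moment K p b x w fun i => r (y i)) with hg
  set q : Fin n → MultiIdx d p → ℝ := fun i => polyBasis p (scaled b w (x i)) with hq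
  set k : Fin n → ℝ := fun i => K (scaled b w (x i)) with hk
  refine ⟨∑ i, k i * (r (y i) - q i ⬝ᵥ g) ^ 2, fun β δ hδ => ?_⟩
  have h1 : ∀ i, polyBasis p (x i - w) ⬝ᵥ β = q i ⬝ᵥ g + q i ⬝ᵥ δ := by
    intro i
    rw [← dotProduct_add]
    refine Finset.sum_congr rfl fun ν _ => ?_
    rw [polyBasis_sub hb.ne', hδ, Pi.add_apply]
    simp only [hq]
    ring
  -- The normal equations, tested against `δ`; they remove the cross term when the square is
  -- completed around `g`.
  have h2 : ∑ i, k i * (q i ⬝ᵥ g) * (q i ⬝ᵥ δ) = ∑ i, k i * r (y i) * (q i ⬝ᵥ δ) := by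
    rw [← dotProduct_moment hb hn x w (fun i => r (y i)) δ,
      ← dotProduct_moment hb hn x w (fun i => q i ⬝ᵥ g) δ, ← gramHat_mulVec, hg,
      hH.mulVec_inv hc]
  rw [gramHat_mulVec, dotProduct_moment hb hn]
  have h3 : lsCriterion K p b x y w r β = ∑ i, k i * (q i ⬝ᵥ δ) * (q i ⬝ᵥ δ) +
      ∑ i, k i * (r (y i) - q i ⬝ᵥ g) ^ 2 -
      2 * (∑ i, k i * r (y i) * (q i ⬝ᵥ δ) - ∑ i, k i * (q i ⬝ᵥ g) * (q i ⬝ᵥ δ)) := by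
    rw [lsCriterion, ← Finset.sum_sub_distrib, Finset.mul_sum, ← Finset.sum_add_distrib,
      ← Finset.sum_sub_distrib]
    refine Finset.sum_congr rfl fun i _ => ?_
    rw [h1]
    ring
  rw [h3, h2, sub_self, mul_zero, sub_zero]

theorem isFit_iff (hb : 0 < b) {c : ℝ} (hc : 0 < c) {x : Fin n → Fin d → ℝ}
    {w : Fin d → ℝ} (hH : Coercive c (gramHat K p b x w)) (y : Fin n → ℝ) (r : ℝ → ℝ)
    (β : MultiIdx d p → ℝ) :
    IsFit K p b x y w r β ↔ ∀ ν, b ^ (∑ i, (ν.1 i : ℕ)) * β ν =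
      ((gramHat K p b x w)⁻¹.mulVec (moment K p b x w fun i => r (y i))) ν := by
  obtain ⟨C, hC⟩ := lsCriterion_eq hb hc hH y r
  set g := (gramHat K p b x w)⁻¹.mulVec (moment K p b x w fun i => r (y i)) with hg
  have hn : (0 : ℝ) < n := by exact_mod_cast pos_of_coercive_gramHat hc hH
  have hnb : 0 < n * b ^ d := by positivity
  have hpos : ∀ δ, c * ‖δ‖ ^ 2 ≤ δ ⬝ᵥ (gramHat K p b x w).mulVec δ := hH
  constructor
  · intro h
    have h1 := h fun ν => (b ^ (∑ i, (ν.1 i : ℕ)))⁻¹ * g ν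
    rw [hC β _ rfl, hC _ 0 (by
      funext ν
      have : b ^ (∑ i, (ν.1 i : ℕ)) ≠ 0 := by positivity
      rw [mul_inv_cancel_left₀ this, sub_self, Pi.zero_apply])] at h1
    rw [zero_dotProduct, mul_zero, zero_add] at h1
    set δ : MultiIdx d p → ℝ := fun ν => b ^ (∑ i, (ν.1 i : ℕ)) * β ν - g ν with hδ
    have h2 : n * b ^ d * (c * ‖δ‖ ^ 2) ≤ 0 := by
      have := mul_le_mul_of_nonneg_left (hpos δ) hnb.le
      linarith
    have h3 : ‖δ‖ = 0 := by
      by_contra h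
      have : 0 < ‖δ‖ := lt_of_le_of_ne (norm_nonneg _) (Ne.symm h)
      have : 0 < n * b ^ d * (c * ‖δ‖ ^ 2) := by positivity
      linarith
    intro ν
    exact sub_eq_zero.1 (congrFun (norm_eq_zero.1 h3) ν)
  · intro h β'
    rw [hC β 0 (funext fun ν => by rw [h ν, sub_self, Pi.zero_apply]), hC β' _ rfl,
      zero_dotProduct, mul_zero, zero_add]
    have := (hpos fun ν => b ^ (∑ i, (ν.1 i : ℕ)) * β' ν - g ν)
    have h5 : 0 ≤ c * ‖fun ν : MultiIdx d p => b ^ (∑ i, (ν.1 i : ℕ)) * β' ν - g ν‖ ^ 2 := by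
      positivity
    have := mul_nonneg hnb.le (h5.trans this)
    linarith

theorem existsUnique_isFit (hb : 0 < b) {c : ℝ} (hc : 0 < c) {x : Fin n → Fin d → ℝ}
    {w : Fin d → ℝ} (hH : Coercive c (gramHat K p b x w)) (y : Fin n → ℝ) (r : ℝ → ℝ) :
    ∃! β, IsFit K p b x y w r β := by
  have hs : ∀ ν : MultiIdx d p, b ^ (∑ i, (ν.1 i : ℕ)) ≠ 0 := fun ν => by positivity
  simp only [isFit_iff hb hc hH]
  refine ⟨fun ν => (b ^ (∑ i, (ν.1 i : ℕ)))⁻¹ *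
    ((gramHat K p b x w)⁻¹.mulVec (moment K p b x w fun i => r (y i))) ν,
    fun ν => mul_inv_cancel_left₀ (hs ν) _, fun β hβ => funext fun ν => ?_⟩
  rw [← hβ ν, inv_mul_cancel_left₀ (hs ν)]

theorem thetaHat_eq (hb : 0 < b) {c : ℝ} (hc : 0 < c) {x : Fin n → Fin d → ℝ}
    {w : Fin d → ℝ} (hH : Coercive c (gramHat K p b x w)) (y : Fin n → ℝ) (r : ℝ → ℝ) :
    thetaHat K p b x y w r = ((gramHat K p b x w)⁻¹.mulVec
      (moment K p b x w fun i => r (y i))) (MultiIdx.zero d p) := by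
  have hex := (existsUnique_isFit hb hc hH y r).exists
  have h1 : IsFit K p b x y w r (betaHat K p b x y w r) := by
    rw [betaHat, dif_pos hex]
    exact hex.choose_spec
  rw [thetaHat, e₁_dotProduct, ← (isFit_iff hb hc hH y r _).1 h1]
  simp [MultiIdx.zero]

/-- The weight of the `i`-th outcome in the local polynomial estimator. -/
noncomputable def fitWeight (K : (Fin d → ℝ) → ℝ) (p : ℕ) (b : ℝ) (x : Fin n → Fin d → ℝ)
    (w : Fin d → ℝ) (i : Fin n) : ℝ :=
  ((gramHat K p b x w)⁻¹.mulVec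
    (((n : ℝ)⁻¹ * ((b ^ d)⁻¹ * K (scaled b w (x i)))) • polyBasis p (scaled b w (x i))))
      (MultiIdx.zero d p)

/-- The weights depend on the covariates only, so a conditional mean can be taken response by
response. -/
theorem inv_gramHat_mulVec_moment_zero (x : Fin n → Fin d → ℝ) (w : Fin d → ℝ) (z : Fin n → ℝ) :
    ((gramHat K p b x w)⁻¹.mulVec (moment K p b x w z)) (MultiIdx.zero d p) =
      ∑ i, fitWeight K p b x w i * z i := by
  have : moment K p b x w z = ∑ i, z i • (((n : ℝ)⁻¹ * ((b ^ d)⁻¹ * K (scaled b w (x i)))) •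
      polyBasis p (scaled b w (x i))) := by
    rw [moment, Finset.smul_sum]
    refine Finset.sum_congr rfl fun i _ => ?_
    rw [smul_smul, smul_smul]
    congr 1
    ring
  rw [this, Matrix.mulVec_sum, Finset.sum_apply]
  refine Finset.sum_congr rfl fun i _ => ?_
  rw [Matrix.mulVec_smul, Pi.smul_apply, smul_eq_mul, mul_comm]
  rfl

end Fit

/-! ### Taylor expansion on the cube in the monomial basis -/

section Taylor

variable {d : ℕ}

theorem polyBasis_zero_right (p : ℕ) : polyBasis p (0 : Fin d → ℝ) = e₁ d p := by
  funext ν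
  rcases eq_or_ne ν (MultiIdx.zero d p) with rfl | hν
  · rw [polyBasis_zero]; simp [e₁]
  · rw [e₁, Pi.single_eq_of_ne hν]
    obtain ⟨i, hi⟩ : ∃ i, ν.1 i ≠ 0 := by
      by_contra! h
      exact hν (Subtype.ext (funext h))
    refine Finset.prod_eq_zero (Finset.mem_univ i) ?_
    rw [Pi.zero_apply, zero_pow]
    exact fun h => hi (Fin.ext h)

/-- The exponent of each coordinate is the number of times `r` takes it as a value; these numbers
add up to `k`. -/
theorem prod_comp_mem_span {p k : ℕ} (hk : k ≤ p) (r : Fin k → Fin d) :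
    (fun v : Fin d → ℝ => ∏ l, v (r l)) ∈
      Submodule.span ℝ (Set.range fun ν : MultiIdx d p => fun v : Fin d → ℝ => polyBasis p v ν) := by
  have hsum : ∑ i, (Finset.univ.filter fun l => r l = i).card = k := by
    rw [← Finset.card_eq_sum_card_fiberwise (fun _ _ => Finset.mem_univ _), Finset.card_univ,
      Fintype.card_fin]
  have hle : ∀ i, (Finset.univ.filter fun l => r l = i).card ≤ k := fun i =>
    (Finset.single_le_sum (fun _ _ => Nat.zero_le _) (Finset.mem_univ i)).trans hsum.le
  refine Submodule.subset_span ⟨⟨fun i => ⟨(Finset.univ.filter fun l => r l = i).card,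
    Nat.lt_succ_of_le ((hle i).trans hk)⟩, hsum.le.trans hk⟩, ?_⟩
  funext v
  simp only [polyBasis]
  rw [← Finset.prod_fiberwise' Finset.univ r v]
  exact Finset.prod_congr rfl fun i _ => (Finset.prod_const _).symm

theorem multilinear_diagonal_mem_span {p k : ℕ} (hk : k ≤ p)
    (T : ContinuousMultilinearMap ℝ (fun _ : Fin k => Fin d → ℝ) ℝ) :
    (fun v : Fin d → ℝ => T fun _ => v) ∈
      Submodule.span ℝ (Set.range fun ν : MultiIdx d p => fun v : Fin d → ℝ => polyBasis p v ν) := by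
  classical
  have h : (fun v : Fin d → ℝ => T fun _ => v) =
      ∑ r : Fin k → Fin d, (T fun l => Pi.single (r l) 1) • fun v : Fin d → ℝ => ∏ l, v (r l) := by
    funext v
    rw [Finset.sum_apply]
    have hv : (fun _ : Fin k => v) =
        fun _ : Fin k => ∑ i, v i • (Pi.single i 1 : Fin d → ℝ) := by
      funext l
      exact pi_eq_sum_univ' v
    conv_lhs => rw [hv]
    rw [ContinuousMultilinearMap.map_sum]
    refine Finset.sum_congr rfl fun r _ => ?_
    rw [ContinuousMultilinearMap.map_smul_univ, Pi.smul_apply, smul_eq_mul, smul_eq_mul, mul_comm]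
  rw [h]
  exact Submodule.sum_mem _ fun r _ => Submodule.smul_mem _ _ (prod_comp_mem_span hk r)

/-- Induction on `k`: by the chain rule each derivative along the segment fills one more slot with
`v`. -/
theorem iteratedDerivWithin_comp_line {s : Set (Fin d → ℝ)} (hs : UniqueDiffOn ℝ s) {N : ℕ}
    {h : (Fin d → ℝ) → ℝ} (hh : ContDiffOn ℝ (N : WithTop ℕ∞) h s) {w v : Fin d → ℝ}
    (hmem : ∀ t ∈ Set.Icc (0 : ℝ) 1, w + t • v ∈ s) {k : ℕ} (hk : k ≤ N) :
    ∀ t ∈ Set.Icc (0 : ℝ) 1, iteratedDerivWithin k (fun t => h (w + t • v)) (Set.Icc 0 1) t =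
      iteratedFDerivWithin ℝ k h s (w + t • v) fun _ => v := by
  have hT := hh.ftaylorSeriesWithin hs
  induction k with
  | zero => intro t _; simp
  | succ k ih =>
    intro t ht
    rw [iteratedDerivWithin_succ,
      derivWithin_congr (ih (Nat.le_of_succ_le hk)) (ih (Nat.le_of_succ_le hk) t ht)]
    have h1 := hT.fderivWithin k (by exact_mod_cast hk) (w + t • v) (hmem t ht)
    have h2 : HasDerivWithinAt (fun t : ℝ => w + t • v) v (Set.Icc 0 1) t := by
      simpa using ((hasDerivWithinAt_id t (Set.Icc 0 1)).smul_const v).const_add w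
    have h3 := h1.comp_hasDerivWithinAt t h2 hmem
    have h4 := ((ContinuousMultilinearMap.apply ℝ (fun _ : Fin k => Fin d → ℝ) ℝ
      fun _ => v).hasFDerivAt.comp_hasDerivWithinAt t h3)
    have h5 := h4.derivWithin (uniqueDiffOn_Icc_zero_one t ht)
    simp only [Function.comp_def, ContinuousMultilinearMap.apply_apply] at h5
    refine h5.trans ?_
    simp only [ContinuousMultilinearMap.curryLeft_apply, ftaylorSeriesWithin]
    congr 1
    funext i
    refine Fin.cases ?_ (fun j => ?_) i <;> simp

theorem uniqueDiffOn_cube : UniqueDiffOn ℝ (Set.Icc (0 : Fin d → ℝ) 1) := by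
  rw [← Set.pi_univ_Icc]
  exact UniqueDiffOn.univ_pi fun i => uniqueDiffOn_Icc zero_lt_one

/-- One-variable Taylor expansion along the segment from `w` to `x`, which stays in the convex cube.
The Taylor terms at `w` are diagonals of multilinear maps, so one coefficient vector serves all `x`.
-/
theorem exists_taylor_polyBasis {p : ℕ} {h : (Fin d → ℝ) → ℝ} {M : ℝ}
    (hh : ContDiffOn ℝ ((p + 1 : ℕ) : WithTop ℕ∞) h (Set.Icc 0 1))
    (hM : ∀ w ∈ Set.Icc (0 : Fin d → ℝ) 1,
      ‖iteratedFDerivWithin ℝ (p + 1) h (Set.Icc 0 1) w‖ ≤ M)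
    {w : Fin d → ℝ} (hw : w ∈ Set.Icc (0 : Fin d → ℝ) 1) :
    ∃ a : MultiIdx d p → ℝ, a (MultiIdx.zero d p) = h w ∧
      ∀ x ∈ Set.Icc (0 : Fin d → ℝ) 1, |h x - polyBasis p (x - w) ⬝ᵥ a| ≤ M * ‖x - w‖ ^ (p + 1) := by
  have hM0 : 0 ≤ M := (norm_nonneg _).trans (hM w hw)
  have hspan : (fun v : Fin d → ℝ => ∑ k ∈ Finset.range (p + 1),
      ((k.factorial : ℝ)⁻¹ * (1 - 0) ^ k) •
        iteratedFDerivWithin ℝ k h (Set.Icc 0 1) w fun _ => v) ∈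
      Submodule.span ℝ (Set.range fun ν : MultiIdx d p => fun v : Fin d → ℝ => polyBasis p v ν) := by
    have : (fun v : Fin d → ℝ => ∑ k ∈ Finset.range (p + 1), ((k.factorial : ℝ)⁻¹ * (1 - 0) ^ k) •
        iteratedFDerivWithin ℝ k h (Set.Icc 0 1) w fun _ => v) =
        ∑ k ∈ Finset.range (p + 1), ((k.factorial : ℝ)⁻¹ * (1 - 0) ^ k) •
          fun v : Fin d → ℝ => iteratedFDerivWithin ℝ k h (Set.Icc 0 1) w fun _ => v := by
      funext v
      simp only [Finset.sum_apply, Pi.smul_apply]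
    rw [this]
    exact Submodule.sum_mem _ fun k hk => Submodule.smul_mem _ _
      (multilinear_diagonal_mem_span (Nat.lt_succ_iff.1 (Finset.mem_range.1 hk)) _)
  obtain ⟨a, ha⟩ := (Submodule.mem_span_range_iff_exists_fun ℝ).1 hspan
  have key : ∀ x ∈ Set.Icc (0 : Fin d → ℝ) 1,
      |h x - polyBasis p (x - w) ⬝ᵥ a| ≤ M * ‖x - w‖ ^ (p + 1) := by
    intro x hx
    have hmem : ∀ t ∈ Set.Icc (0 : ℝ) 1, w + t • (x - w) ∈ Set.Icc (0 : Fin d → ℝ) 1 :=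
      fun t ht => (convex_Icc (0 : Fin d → ℝ) 1).add_smul_sub_mem hw hx ht
    have hφ : ContDiffOn ℝ ((p + 1 : ℕ) : WithTop ℕ∞) (fun t : ℝ => h (w + t • (x - w)))
        (Set.Icc 0 1) := by
      refine hh.comp (ContDiff.contDiffOn ?_) hmem
      fun_prop
    have hb := taylor_mean_remainder_bound (n := p) (C := M * ‖x - w‖ ^ (p + 1)) zero_le_one
      (by exact_mod_cast hφ) (Set.right_mem_Icc.2 zero_le_one) fun t ht => by
        rw [iteratedDerivWithin_comp_line uniqueDiffOn_cube hh hmem le_rfl t ht]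
        refine ((iteratedFDerivWithin ℝ (p + 1) h (Set.Icc 0 1) _).le_opNorm _).trans ?_
        rw [Finset.prod_const, Finset.card_univ, Fintype.card_fin]
        gcongr
        exact hM _ (hmem t ht)
    rw [taylor_within_apply] at hb
    have h1 : ∑ k ∈ Finset.range (p + 1), ((k.factorial : ℝ)⁻¹ * (1 - 0) ^ k) •
        iteratedDerivWithin k (fun t : ℝ => h (w + t • (x - w))) (Set.Icc 0 1) 0 =
        polyBasis p (x - w) ⬝ᵥ a := by
      have h2 := congrFun ha (x - w)
      simp only [Finset.sum_apply, Pi.smul_apply, smul_eq_mul] at h2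
      rw [dotProduct, Finset.sum_congr rfl fun ν _ => mul_comm _ _, h2]
      refine Finset.sum_congr rfl fun k hk => ?_
      rw [iteratedDerivWithin_comp_line uniqueDiffOn_cube hh hmem (Finset.mem_range.1 hk).le 0
        (Set.left_mem_Icc.2 zero_le_one), zero_smul, add_zero, smul_eq_mul]
    rw [h1] at hb
    simp only [one_smul, add_sub_cancel, sub_zero, one_pow, mul_one] at hb
    -- The gain `1 / p!` in the remainder is discarded.
    refine hb.trans (div_le_self (by positivity) ?_)
    exact_mod_cast Nat.one_le_iff_ne_zero.2 p.factorial_ne_zero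
  refine ⟨a, ?_, key⟩
  -- At `x = w` the remainder vanishes and the basis vector is `e₁`, which identifies the constant
  -- coefficient.
  have h0 := key w hw
  rw [sub_self, polyBasis_zero_right, e₁_dotProduct, norm_zero, zero_pow (Nat.succ_ne_zero p),
    mul_zero] at h0
  exact (sub_eq_zero.1 (abs_nonpos_iff.1 h0)).symm

end Taylor

/-! ### Bias of local polynomial fits, in the sample and in the population -/

section Bias

variable {d n p : ℕ} {K : (Fin d → ℝ) → ℝ} {b ρ A : ℝ}

theorem abs_polyBasis_le (hρ : 1 ≤ ρ) {u : Fin d → ℝ} (hu : ‖u‖ ≤ ρ) (ν : MultiIdx d p) :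
    |polyBasis p u ν| ≤ ρ ^ p := by
  rw [polyBasis, Finset.abs_prod]
  calc ∏ i, |u i ^ (ν.1 i : ℕ)| ≤ ∏ i, ρ ^ (ν.1 i : ℕ) := by
        refine Finset.prod_le_prod (fun _ _ => abs_nonneg _) fun i _ => ?_
        rw [abs_pow]
        gcongr
        exact (norm_le_pi_norm u i).trans hu
    _ = ρ ^ (∑ i, (ν.1 i : ℕ)) := Finset.prod_pow_eq_pow_sum _ _ _
    _ ≤ ρ ^ p := pow_le_pow_right₀ hρ ν.2

theorem kernelMonomial_zero_zero :
    kernelMonomial K p (MultiIdx.zero d p) (MultiIdx.zero d p) = K := by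
  funext u; simp [kernelMonomial, polyBasis_zero]

theorem kernelMonomial_zero_right (ν : MultiIdx d p) (u : Fin d → ℝ) :
    kernelMonomial K p ν (MultiIdx.zero d p) u = K u * polyBasis p u ν := by
  simp [kernelMonomial, polyBasis_zero]

/-- Rescaled Taylor coefficients. -/
theorem exists_taylor_scaled (hb : 0 < b) {h : (Fin d → ℝ) → ℝ} {M : ℝ}
    (hh : ContDiffOn ℝ ((p + 1 : ℕ) : WithTop ℕ∞) h (Set.Icc 0 1))
    (hM : ∀ w ∈ Set.Icc (0 : Fin d → ℝ) 1,
      ‖iteratedFDerivWithin ℝ (p + 1) h (Set.Icc 0 1) w‖ ≤ M)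
    {w : Fin d → ℝ} (hw : w ∈ Set.Icc (0 : Fin d → ℝ) 1) :
    ∃ a : MultiIdx d p → ℝ, a (MultiIdx.zero d p) = h w ∧
      ∀ x ∈ Set.Icc (0 : Fin d → ℝ) 1, |h x - polyBasis p (scaled b w x) ⬝ᵥ a| ≤
        M * ‖x - w‖ ^ (p + 1) := by
  obtain ⟨a, ha0, ha⟩ := exists_taylor_polyBasis hh hM hw
  refine ⟨fun ν => b ^ (∑ i, (ν.1 i : ℕ)) * a ν, by simp [MultiIdx.zero, ← ha0],
    fun x hx => ?_⟩
  have : polyBasis p (scaled b w x) ⬝ᵥ (fun ν => b ^ (∑ i, (ν.1 i : ℕ)) * a ν) =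
      polyBasis p (x - w) ⬝ᵥ a := by
    refine Finset.sum_congr rfl fun ν _ => ?_
    rw [polyBasis_sub hb.ne']
    ring
  rw [this]
  exact ha x hx

/-- Stability of the normal equations: a vector that nearly solves them is close to the solution. It
is applied to the rescaled Taylor coefficients. -/
theorem Coercive.abs_inv_mulVec_sub_le {ι : Type*} [Fintype ι] [DecidableEq ι] {c ε : ℝ}
    (hc : 0 < c) {H : Matrix ι ι ℝ} (hH : Coercive c H) {v a : ι → ℝ} (hε : 0 ≤ ε)
    (hv : ∀ i, |v i - H.mulVec a i| ≤ ε) (i : ι) :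
    |H⁻¹.mulVec v i - a i| ≤ Fintype.card ι / c * ε := by
  have h1 : H⁻¹.mulVec v i - a i = H⁻¹.mulVec (v - H.mulVec a) i := by
    rw [Matrix.mulVec_sub, hH.inv_mulVec hc, Pi.sub_apply]
  rw [h1]
  calc _ ≤ ‖H⁻¹.mulVec (v - H.mulVec a)‖ := norm_le_pi_norm (H⁻¹.mulVec (v - H.mulVec a)) i
    _ ≤ Fintype.card ι / c * ‖v - H.mulVec a‖ := hH.norm_inv_mulVec_le hc _
    _ ≤ _ := by
        gcongr
        exact (pi_norm_le_iff_of_nonneg hε).2 hv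

/-- The fit reproduces the Taylor polynomial, so only the moment of the remainder is left. On the
support of the kernel it is at most `ρ^p * M (ρ b)^(p+1)` times the average kernel weight, which is
the entry bounded by `G`. -/
theorem abs_inv_gramHat_mulVec_moment_sub_le (hb : 0 < b) (hρ : 1 ≤ ρ)
    (hK : ∀ ν ν', IsBump ρ A (kernelMonomial K p ν ν')) (hKnonneg : ∀ u, 0 ≤ K u)
    {h : (Fin d → ℝ) → ℝ} {M : ℝ}
    (hh : ContDiffOn ℝ ((p + 1 : ℕ) : WithTop ℕ∞) h (Set.Icc 0 1))
    (hM : ∀ w ∈ Set.Icc (0 : Fin d → ℝ) 1,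
      ‖iteratedFDerivWithin ℝ (p + 1) h (Set.Icc 0 1) w‖ ≤ M)
    {w : Fin d → ℝ} (hw : w ∈ Set.Icc (0 : Fin d → ℝ) 1) {x : Fin n → Fin d → ℝ}
    (hx : ∀ i, x i ∈ Set.Icc (0 : Fin d → ℝ) 1) {c G : ℝ} (hc : 0 < c)
    (hH : Coercive c (gramHat K p b x w))
    (hG : gramHat K p b x w (MultiIdx.zero d p) (MultiIdx.zero d p) ≤ G) :
    |((gramHat K p b x w)⁻¹.mulVec (moment K p b x w fun i => h (x i))) (MultiIdx.zero d p) - h w| ≤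
      Fintype.card (MultiIdx d p) / c * (ρ ^ p * (M * (ρ * b) ^ (p + 1)) * G) := by
  have hM0 : 0 ≤ M := (norm_nonneg _).trans (hM w hw)
  obtain ⟨a, ha0, ha⟩ := exists_taylor_scaled hb hh hM hw
  have hGram : gramHat K p b x w (MultiIdx.zero d p) (MultiIdx.zero d p) =
      (n : ℝ)⁻¹ * ∑ i, (b ^ d)⁻¹ * K (scaled b w (x i)) := by
    simp only [gramHat, Matrix.smul_apply, Matrix.sum_apply, gramTerm_apply,
      kernelMonomial_zero_zero, localize, smul_eq_mul]
  have hG0 : 0 ≤ G := by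
    refine le_trans ?_ hG
    rw [hGram]
    have : 0 ≤ ∑ i, (b ^ d)⁻¹ * K (scaled b w (x i)) := Finset.sum_nonneg fun i _ => by
      have := hKnonneg (scaled b w (x i)); positivity
    positivity
  rw [← ha0]
  refine hH.abs_inv_mulVec_sub_le hc (by positivity) (fun ν => ?_) _
  set R : Fin n → ℝ := fun i => h (x i) - polyBasis p (scaled b w (x i)) ⬝ᵥ a with hR
  have h1 : moment K p b x w (fun i => h (x i)) ν - (gramHat K p b x w).mulVec a ν =
      moment K p b x w R ν := by
    rw [gramHat_mulVec, sub_eq_iff_eq_add, ← Pi.add_apply, ← moment_add]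
    congr 2
    funext i
    simp [hR]
  rw [h1, moment, Pi.smul_apply, smul_eq_mul, Finset.sum_apply, abs_mul,
    abs_of_nonneg (by positivity : 0 ≤ (n : ℝ)⁻¹)]
  calc _ ≤ (n : ℝ)⁻¹ * ∑ i, (ρ ^ p * (M * (ρ * b) ^ (p + 1))) *
        ((b ^ d)⁻¹ * K (scaled b w (x i))) := by
        gcongr
        refine (Finset.abs_sum_le_sum_abs _ _).trans (Finset.sum_le_sum fun i _ => ?_)
        have hKi := hKnonneg (scaled b w (x i))
        rw [Pi.smul_apply, smul_eq_mul, abs_mul, abs_mul, abs_of_nonneg (by positivity)]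
        rcases hKi.eq_or_lt with h0 | h0
        · rw [← h0]; simp
        have hbump := hK (MultiIdx.zero d p) (MultiIdx.zero d p)
        rw [kernelMonomial_zero_zero] at hbump
        have hu : ‖scaled b w (x i)‖ ≤ ρ := by
          by_contra hlt
          exact h0.ne' (hbump.supp _ (not_le.1 hlt))
        have hxw : ‖x i - w‖ ≤ ρ * b :=
          hbump.norm_sub_le_of_localize_ne_zero hb
            (mul_ne_zero (by positivity) h0.ne')
        have hRi : |R i| ≤ M * (ρ * b) ^ (p + 1) :=
          (ha _ (hx i)).trans (by gcongr)
        have hq := abs_polyBasis_le (p := p) hρ hu ν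
        calc _ ≤ (b ^ d)⁻¹ * K (scaled b w (x i)) * (M * (ρ * b) ^ (p + 1)) * ρ ^ p := by
              gcongr
          _ = _ := by ring
    _ = ρ ^ p * (M * (ρ * b) ^ (p + 1)) *
        gramHat K p b x w (MultiIdx.zero d p) (MultiIdx.zero d p) := by
        rw [← Finset.mul_sum, hGram]; ring
    _ ≤ _ := by gcongr

/-- The population version of the local polynomial approximation. -/
theorem abs_inv_gram_mulVec_integral_sub_le (hb : 0 < b) (hρ : 1 ≤ ρ)
    (hK : ∀ ν ν', IsBump ρ A (kernelMonomial K p ν ν'))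
    {h : (Fin d → ℝ) → ℝ} {M : ℝ}
    (hh : ContDiffOn ℝ ((p + 1 : ℕ) : WithTop ℕ∞) h (Set.Icc 0 1))
    (hM : ∀ w ∈ Set.Icc (0 : Fin d → ℝ) 1,
      ‖iteratedFDerivWithin ℝ (p + 1) h (Set.Icc 0 1) w‖ ≤ M)
    {w : Fin d → ℝ} (hw : w ∈ Set.Icc (0 : Fin d → ℝ) 1)
    {P : Measure (Fin d → ℝ)} [IsFiniteMeasure P] {F : ℝ} (hF : 0 ≤ F)
    (hP : P ≤ ENNReal.ofReal F • volume) (hcube : ∀ᵐ x ∂P, x ∈ Set.Icc (0 : Fin d → ℝ) 1)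
    {c : ℝ} (hc : 0 < c) (hH : Coercive c (gram K p b P w)) :
    |((gram K p b P w)⁻¹.mulVec fun ν =>
        ∫ x, localize b (kernelMonomial K p ν (MultiIdx.zero d p)) w x * h x ∂P)
          (MultiIdx.zero d p) - h w| ≤
      Fintype.card (MultiIdx d p) / c * (M * (ρ * b) ^ (p + 1) * (A * F * (2 * ρ) ^ d)) := by
  have hM0 : 0 ≤ M := (norm_nonneg _).trans (hM w hw)
  have hρ0 : 0 ≤ ρ := zero_le_one.trans hρ
  have hA := (hK (MultiIdx.zero d p) (MultiIdx.zero d p)).nonneg_const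
  obtain ⟨a, ha0, ha⟩ := exists_taylor_scaled hb hh hM hw
  rw [← ha0]
  refine hH.abs_inv_mulVec_sub_le hc (by positivity) (fun ν => ?_) _
  set g := kernelMonomial K p ν (MultiIdx.zero d p)
  have hg : IsBump ρ A g := hK _ _
  -- `h` is continuous only on the cube, so its measurability is available for the restricted
  -- measure.
  have hrestr : P.restrict (Set.Icc (0 : Fin d → ℝ) 1) = P :=
    Measure.restrict_eq_self_of_ae_mem hcube
  obtain ⟨T, hT⟩ := isCompact_Icc.exists_bound_of_continuousOn hh.continuousOn
  have hint1 : Integrable (fun x => localize b g w x * h x) P := by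
    refine (hg.integrable_localize hb P w).mul_bdd (c := T) ?_ ?_
    · rw [← hrestr]
      exact hh.continuousOn.aestronglyMeasurable measurableSet_Icc
    · filter_upwards [hcube] with x hx using hT x hx
  have hmul : (gram K p b P w).mulVec a ν =
      ∫ x, localize b g w x * (polyBasis p (scaled b w x) ⬝ᵥ a) ∂P := by
    simp only [Matrix.mulVec, dotProduct, gram, Matrix.of_apply, Finset.mul_sum]
    rw [integral_finsetSum]
    · refine Finset.sum_congr rfl fun ν' _ => ?_
      rw [← integral_mul_const]
      refine integral_congr_ae (ae_of_all _ fun x => ?_)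
      simp only [gramTerm_apply, localize, g, kernelMonomial, polyBasis_zero]
      ring
    · intro ν' _
      have := ((hK ν ν').integrable_localize hb P w).mul_const (a ν')
      refine this.congr (ae_of_all _ fun x => ?_)
      simp only [localize, g, kernelMonomial, polyBasis_zero]
      ring
  have hint2 : Integrable (fun x => localize b g w x * (polyBasis p (scaled b w x) ⬝ᵥ a)) P := by
    simp only [dotProduct, Finset.mul_sum]
    refine integrable_finsetSum _ fun ν' _ => ?_
    have := ((hK ν ν').integrable_localize hb P w).mul_const (a ν')
    refine this.congr (ae_of_all _ fun x => ?_)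
    simp only [localize, g, kernelMonomial, polyBasis_zero]
    ring
  rw [hmul, ← integral_sub hint1 hint2, ← Real.norm_eq_abs]
  calc _ ≤ ∫ x, |localize b g w x| * (M * (ρ * b) ^ (p + 1)) ∂P := by
        refine norm_integral_le_of_norm_le ((hg.integrable_localize hb P w).abs.mul_const _) ?_
        filter_upwards [hcube] with x hx
        rw [← mul_sub, Real.norm_eq_abs, abs_mul]
        rcases eq_or_ne (localize b g w x) 0 with h0 | h0
        · rw [h0]; simp
        · have := hg.norm_sub_le_of_localize_ne_zero hb h0
          gcongr
          exact (ha x hx).trans (by gcongr)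
    _ = (M * (ρ * b) ^ (p + 1)) * ∫ x, |localize b g w x| ∂P := by
        rw [integral_mul_const, mul_comm]
    _ ≤ _ := by
        gcongr
        exact hg.integral_abs_localize_le hρ0 hb hF hP w

end Bias

/-! ### Bernstein's inequality without boundedness -/

section Concentration

/-- The rate `√((n β)⁻¹ log n)`. -/
noncomputable def rate (β : ℝ) (n : ℕ) : ℝ := √((n * β)⁻¹ * Real.log n)

theorem rate_nonneg (β : ℝ) (n : ℕ) : 0 ≤ rate β n := Real.sqrt_nonneg _

theorem rate_sq {β : ℝ} (hβ : 0 < β) (n : ℕ) : rate β n ^ 2 = (n * β)⁻¹ * Real.log n :=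
  Real.sq_sqrt (by have := Real.log_natCast_nonneg n; positivity)

/-- The sample mean of the first `n` values of `F`. -/
noncomputable def avg {Ω E : Type*} (Z : ℕ → Ω → E) (n : ℕ) (F : E → ℝ) (ω : Ω) : ℝ :=
  (n : ℝ)⁻¹ * ∑ i ∈ Finset.range n, F (Z i ω)

/-- For `|x| ≤ 1` this is the quadratic Taylor bound; for `x > 1` the last term alone dominates; for
`x < -1` the right side is at least `1`. -/
theorem exp_le_one_add_add_sq_mul (x : ℝ) : Real.exp x ≤ 1 + x + x ^ 2 * Real.exp |x| := by
  rcases le_or_gt |x| 1 with h | h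
  · have h1 := (abs_le.1 (Real.abs_exp_sub_one_sub_id_le h)).2
    have h2 : x ^ 2 * 1 ≤ x ^ 2 * Real.exp |x| := by
      gcongr; exact Real.one_le_exp (abs_nonneg x)
    linarith
  · rcases le_or_gt 0 x with h0 | h0
    · rw [abs_of_nonneg h0] at h ⊢
      have : 1 * Real.exp x ≤ x ^ 2 * Real.exp x := by gcongr; nlinarith
      linarith
    · have h2 : x ^ 2 * 1 ≤ x ^ 2 * Real.exp |x| := by
        gcongr; exact Real.one_le_exp (abs_nonneg x)
      rw [abs_of_neg h0] at h
      have : Real.exp x ≤ 1 := Real.exp_le_one_iff.2 h0.le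
      nlinarith

variable {Ω E : Type*} [MeasurableSpace Ω] [MeasurableSpace E] {μ : Measure Ω}
  [IsProbabilityMeasure μ]

/-- The variance is replaced by the moment of `Y² exp(t|Y|)`. This treats bounded summands and
summands with exponential moments alike; the mean zero removes the linear term. -/
theorem mgf_le_exp_sq_mul {Y : Ω → ℝ} {t V : ℝ} (ht : 0 ≤ t) (hY : Integrable Y μ)
    (hmean : ∫ ω, Y ω ∂μ = 0) (hint : Integrable (fun ω => Y ω ^ 2 * Real.exp (t * |Y ω|)) μ)
    (hV : ∫ ω, Y ω ^ 2 * Real.exp (t * |Y ω|) ∂μ ≤ V) :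
    Integrable (fun ω => Real.exp (t * Y ω)) μ ∧ mgf Y μ t ≤ Real.exp (t ^ 2 * V) := by
  have hpt : ∀ ω, Real.exp (t * Y ω) ≤
      1 + t * Y ω + t ^ 2 * (Y ω ^ 2 * Real.exp (t * |Y ω|)) := by
    intro ω
    have := exp_le_one_add_add_sq_mul (t * Y ω)
    rw [abs_mul, abs_of_nonneg ht] at this
    calc _ ≤ _ := this
      _ = _ := by ring
  have hr : Integrable (fun ω => 1 + t * Y ω + t ^ 2 * (Y ω ^ 2 * Real.exp (t * |Y ω|))) μ :=
    ((integrable_const _).add (hY.const_mul t)).add (hint.const_mul _)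
  have hexp : Integrable (fun ω => Real.exp (t * Y ω)) μ := by
    refine hr.mono' (Real.continuous_exp.comp_aestronglyMeasurable
      (hY.aestronglyMeasurable.const_mul t)) (ae_of_all _ fun ω => ?_)
    rw [Real.norm_eq_abs, Real.abs_exp]
    exact hpt ω
  refine ⟨hexp, ?_⟩
  calc mgf Y μ t ≤ ∫ ω, (1 + t * Y ω + t ^ 2 * (Y ω ^ 2 * Real.exp (t * |Y ω|))) ∂μ :=
        integral_mono hexp hr hpt
    _ = 1 + t ^ 2 * ∫ ω, Y ω ^ 2 * Real.exp (t * |Y ω|) ∂μ := by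
        have h1 : Integrable (fun ω => 1 + t * Y ω) μ := (integrable_const _).add (hY.const_mul t)
        rw [integral_add h1 (hint.const_mul _),
          integral_add (integrable_const _) (hY.const_mul t), integral_const_mul, hmean,
          integral_const_mul]
        simp
    _ ≤ t ^ 2 * V + 1 := by rw [add_comm]; gcongr
    _ ≤ _ := Real.add_one_le_exp _

variable {Z : ℕ → Ω → E}

theorem measureReal_le_avg (hZ : ∀ i, Measurable (Z i)) (hindep : iIndepFun Z μ)
    (hident : ∀ i, IdentDistrib (Z i) (Z 0) μ μ) {F : E → ℝ} (hF : Measurable F) {t V : ℝ}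
    (ht : 0 ≤ t) (hFint : Integrable (fun ω => F (Z 0 ω)) μ) (hmean : ∫ ω, F (Z 0 ω) ∂μ = 0)
    (hint : Integrable (fun ω => F (Z 0 ω) ^ 2 * Real.exp (t * |F (Z 0 ω)|)) μ)
    (hV : ∫ ω, F (Z 0 ω) ^ 2 * Real.exp (t * |F (Z 0 ω)|) ∂μ ≤ V) {n : ℕ} (hn : 0 < n) (ε : ℝ) :
    μ.real {ω | ε ≤ avg Z n F ω} ≤ Real.exp (n * (-(t * ε) + t ^ 2 * V)) := by
  obtain ⟨hexp, hmgf⟩ := mgf_le_exp_sq_mul ht hFint hmean hint hV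
  have hind : iIndepFun (fun i ω => F (Z i ω)) μ := hindep.comp (fun _ => F) fun _ => hF
  have hid : ∀ i, IdentDistrib (fun ω => F (Z i ω)) (fun ω => F (Z 0 ω)) μ μ := fun i =>
    (hident i).comp hF
  have hmeas : ∀ i, Measurable fun ω => F (Z i ω) := fun i => hF.comp (hZ i)
  have hexpi : ∀ i ∈ Finset.range n, Integrable (fun ω => Real.exp (t * F (Z i ω))) μ := fun i _ =>
    (((hid i).comp (measurable_const_mul t)).comp Real.measurable_exp).integrable_iff.2 hexp
  have h1 := measure_ge_le_exp_mul_mgf (μ := μ) (X := ∑ i ∈ Finset.range n, fun ω => F (Z i ω))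
    (n * ε) ht (hind.integrable_exp_mul_sum hmeas hexpi)
  have h2 : {ω | ε ≤ avg Z n F ω} = {ω | n * ε ≤ (∑ i ∈ Finset.range n, fun ω => F (Z i ω)) ω} := by
    ext ω
    simp only [Set.mem_ofPred_eq, avg, Finset.sum_apply]
    rw [← div_eq_inv_mul, le_div_iff₀ (by positivity), mul_comm]
  rw [h2]
  refine h1.trans ?_
  rw [hind.mgf_sum hmeas]
  calc _ = Real.exp (-t * (n * ε)) * ∏ i ∈ Finset.range n, mgf (fun ω => F (Z 0 ω)) μ t := by
        congr 1
        refine Finset.prod_congr rfl fun i _ => ?_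
        exact (((hid i).comp (measurable_const_mul t)).comp Real.measurable_exp).integral_eq
    _ ≤ Real.exp (-t * (n * ε)) * Real.exp (t ^ 2 * V) ^ n := by
        rw [Finset.prod_const, Finset.card_range]
        gcongr
        exact mgf_nonneg
    _ = _ := by
        rw [← Real.exp_nat_mul, ← Real.exp_add]
        congr 1
        ring

theorem measureReal_lt_abs_avg (hZ : ∀ i, Measurable (Z i)) (hindep : iIndepFun Z μ)
    (hident : ∀ i, IdentDistrib (Z i) (Z 0) μ μ) {F : E → ℝ} (hF : Measurable F) {t V : ℝ}
    (ht : 0 ≤ t) (hFint : Integrable (fun ω => F (Z 0 ω)) μ) (hmean : ∫ ω, F (Z 0 ω) ∂μ = 0)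
    (hint : Integrable (fun ω => F (Z 0 ω) ^ 2 * Real.exp (t * |F (Z 0 ω)|)) μ)
    (hV : ∫ ω, F (Z 0 ω) ^ 2 * Real.exp (t * |F (Z 0 ω)|) ∂μ ≤ V) {n : ℕ} (hn : 0 < n) (ε : ℝ) :
    μ.real {ω | ε < |avg Z n F ω|} ≤ 2 * Real.exp (n * (-(t * ε) + t ^ 2 * V)) := by
  have h1 := measureReal_le_avg hZ hindep hident hF ht hFint hmean hint hV hn ε
  have h2 := measureReal_le_avg hZ hindep hident hF.neg ht hFint.neg
    (by simp [integral_neg, hmean]) (by simpa using hint) (by simpa using hV) hn ε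
  have h3 : {ω | ε < |avg Z n F ω|} ⊆ {ω | ε ≤ avg Z n F ω} ∪ {ω | ε ≤ avg Z n (-F) ω} := by
    intro ω hω
    have hneg : avg Z n (-F) ω = -avg Z n F ω := by simp [avg]
    rcases lt_abs.1 (show ε < |avg Z n F ω| from hω) with h | h
    · exact Or.inl h.le
    · exact Or.inr (by rw [Set.mem_ofPred_eq, hneg]; exact h.le)
  calc _ ≤ _ := measureReal_mono h3
    _ ≤ _ := measureReal_union_le _ _
    _ ≤ _ := by linarith

/-- Bernstein's inequality, the union bound over polynomially many functions and the
Borel–Cantelli lemma. -/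
theorem exists_ae_eventually_abs_avg_le (hZ : ∀ i, Measurable (Z i)) (hindep : iIndepFun Z μ)
    (hident : ∀ i, IdentDistrib (Z i) (Z 0) μ μ) {ι : Type*} (J : ℕ → Finset ι)
    (F : ℕ → ι → E → ℝ) {β : ℕ → ℝ} (hβ : ∀ n, 0 < β n) (q : ℕ)
    (hJ : ∀ᶠ n in atTop, (J n).card ≤ n ^ q) (V : ℝ)
    (hF : ∀ᶠ n in atTop, ∀ j ∈ J n, Measurable (F n j) ∧ Integrable (fun ω => F n j (Z 0 ω)) μ ∧
      ∫ ω, F n j (Z 0 ω) ∂μ = 0 ∧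
      Integrable (fun ω => F n j (Z 0 ω) ^ 2 *
        Real.exp (β n * rate (β n) n * |F n j (Z 0 ω)|)) μ ∧
      ∫ ω, F n j (Z 0 ω) ^ 2 * Real.exp (β n * rate (β n) n * |F n j (Z 0 ω)|) ∂μ ≤
        V * (β n)⁻¹) :
    ∃ C, 0 ≤ C ∧ ∀ᵐ ω ∂μ, ∀ᶠ n in atTop, ∀ j ∈ J n, |avg Z n (F n j) ω| ≤ C * rate (β n) n := by
  -- With exponential parameter `β δ` and `n β δ² = log n` the exponent is `-(C - V) log n ≤ -(q +
  -- 2) log n`. The union over `n ^ q` functions leaves the summable `2 n⁻²`.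
  set C : ℝ := |V| + q + 2 with hC
  refine ⟨C, by positivity, ?_⟩
  obtain ⟨N, hN⟩ := eventually_atTop.1 (hJ.and (hF.and (eventually_ge_atTop 1)))
  -- The assumptions hold only from `N` on; the earlier events are made empty.
  set s : ℕ → Set Ω := fun n => if N ≤ n then
    ⋃ j ∈ J n, {ω | C * rate (β n) n < |avg Z n (F n j) ω|} else ∅ with hs
  have hbound : ∀ n, μ (s n) ≤ ENNReal.ofReal (2 * ((n : ℝ) ^ 2)⁻¹) := by
    intro n
    by_cases hNn : N ≤ n
    swap
    · simp [hs, hNn]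
    obtain ⟨hcard, hFn, hn⟩ := hN n hNn
    have hn0 : (0 : ℝ) < n := by exact_mod_cast hn
    have hβn := hβ n
    set δ := rate (β n) n with hδ
    have hδ2 : δ ^ 2 = (n * β n)⁻¹ * Real.log n := rate_sq hβn n
    have hj : ∀ j ∈ J n, μ {ω | C * δ < |avg Z n (F n j) ω|} ≤
        ENNReal.ofReal (2 * ((n : ℝ) ^ (q + 2))⁻¹) := by
      intro j hj
      obtain ⟨h1, h2, h3, h4, h5⟩ := hFn j hj
      rw [← ofReal_measureReal]
      refine ENNReal.ofReal_le_ofReal ((measureReal_lt_abs_avg hZ hindep hident h1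
        (mul_nonneg hβn.le (rate_nonneg _ _)) h2 h3 h4 h5 hn (C * δ)).trans ?_)
      gcongr
      have h6 : n * (-(β n * δ * (C * δ)) + (β n * δ) ^ 2 * (V * (β n)⁻¹)) =
          -((C - V) * Real.log n) := by
        calc _ = -(C - V) * (n * β n * δ ^ 2) := by field_simp; ring
          _ = _ := by rw [hδ2]; field_simp
      have h7 : ((n : ℝ) ^ (q + 2))⁻¹ = Real.exp (-(((q + 2 : ℕ) : ℝ) * Real.log n)) := by
        rw [Real.exp_neg, Real.exp_nat_mul, Real.exp_log hn0]
      rw [h6, h7]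
      gcongr
      push_cast
      have := le_abs_self V
      linarith
    simp only [hs, if_pos hNn]
    calc _ ≤ ∑ j ∈ J n, μ {ω | C * δ < |avg Z n (F n j) ω|} := measure_biUnion_finset_le _ _
      _ ≤ ∑ j ∈ J n, ENNReal.ofReal (2 * ((n : ℝ) ^ (q + 2))⁻¹) := Finset.sum_le_sum hj
      _ = ENNReal.ofReal ((J n).card * (2 * ((n : ℝ) ^ (q + 2))⁻¹)) := by
          rw [Finset.sum_const, nsmul_eq_mul, ENNReal.ofReal_mul (by positivity : (0 : ℝ) ≤ (J n).card),
            ENNReal.ofReal_natCast]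
      _ ≤ _ := by
          refine ENNReal.ofReal_le_ofReal ?_
          calc _ ≤ ((n : ℝ) ^ q) * (2 * ((n : ℝ) ^ (q + 2))⁻¹) := by
                gcongr; exact_mod_cast hcard
            _ = _ := by rw [pow_add]; field_simp
  have hsum : ∑' n, μ (s n) ≠ ⊤ := by
    refine ne_top_of_le_ne_top ?_ (ENNReal.tsum_le_tsum hbound)
    exact ((Real.summable_nat_pow_inv.2 one_lt_two).mul_left 2).tsum_ofReal_ne_top
  filter_upwards [ae_eventually_notMem hsum] with ω hω
  filter_upwards [hω, eventually_ge_atTop N] with n hn hNn j hj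
  by_contra hlt
  refine hn ?_
  simp only [hs, if_pos hNn, Set.mem_iUnion]
  exact ⟨j, hj, not_le.1 hlt⟩

end Concentration

/-! ### Consequences of the bandwidth condition -/

section Bandwidths

/-- Bounded bandwidths for which `n b ^ d` grows faster than `log n`. -/
structure Bandwidths (d : ℕ) (b : ℕ → ℝ) (B : ℝ) : Prop where
  one_le_dim : 1 ≤ d
  pos : ∀ n, 0 < b n
  le : ∀ n, b n ≤ B
  tendsto : Tendsto (fun n : ℕ => ((n : ℝ) * b n ^ d)⁻¹ * Real.log n) atTop (𝓝 0)

namespace Bandwidths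

variable {d : ℕ} {b : ℕ → ℝ} {B : ℝ}

theorem tendsto_rate (hb : Bandwidths d b B) :
    Tendsto (fun n => rate (b n ^ d) n) atTop (𝓝 0) := by
  have := (Real.continuous_sqrt.tendsto 0).comp hb.tendsto
  rwa [Real.sqrt_zero] at this

theorem eventually_rate_le (hb : Bandwidths d b B) {ε : ℝ} (hε : 0 < ε) :
    ∀ᶠ n in atTop, rate (b n ^ d) n ≤ ε :=
  (hb.tendsto_rate.eventually_lt_const hε).mono fun _ h => h.le

theorem eventually_one_le_log : ∀ᶠ n : ℕ in atTop, 1 ≤ Real.log n :=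
  (Real.tendsto_log_atTop.comp tendsto_natCast_atTop_atTop).eventually_ge_atTop 1

theorem eventually_inv_pow_le (hb : Bandwidths d b B) :
    ∀ᶠ n : ℕ in atTop, (b n ^ d)⁻¹ ≤ n := by
  filter_upwards [hb.tendsto.eventually_lt_const zero_lt_one, eventually_one_le_log,
    eventually_ge_atTop 1] with n h1 h2 h3
  have hn : (0 : ℝ) < n := by exact_mod_cast h3
  have hbn := pow_pos (hb.pos n) d
  have h4 : ((n : ℝ) * b n ^ d)⁻¹ ≤ 1 := by
    refine le_trans ?_ h1.le
    exact le_mul_of_one_le_right (by positivity) h2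
  rw [inv_le_one₀ (by positivity)] at h4
  rw [inv_le_iff_one_le_mul₀ hbn]
  exact h4

/-- If `b n < 1`, then `b ^ d ≤ b` because `d ≥ 1`, and the bound for `b^{-d}` applies. -/
theorem eventually_inv_le (hb : Bandwidths d b B) : ∀ᶠ n : ℕ in atTop, (b n)⁻¹ ≤ n := by
  filter_upwards [hb.eventually_inv_pow_le, eventually_ge_atTop 1] with n h1 h3
  have hn : (1 : ℝ) ≤ n := by exact_mod_cast h3
  rcases le_or_gt 1 (b n) with h | h
  · exact (inv_le_one_of_one_le₀ h).trans hn
  · refine le_trans ?_ h1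
    have h4 : b n ^ d ≤ b n := pow_le_of_le_one (hb.pos n).le h.le (by have := hb.one_le_dim; omega)
    exact inv_anti₀ (pow_pos (hb.pos n) d) h4

theorem bound_pos (hb : Bandwidths d b B) : 0 < B := (hb.pos 0).trans_le (hb.le 0)

/-- Lets the rate absorb discretization errors of order `1 / n`; boundedness of the bandwidths
enters here. -/
theorem eventually_inv_natCast_le (hb : Bandwidths d b B) :
    ∀ᶠ n : ℕ in atTop, (n : ℝ)⁻¹ ≤ (B ^ d + 1) * rate (b n ^ d) n := by
  filter_upwards [eventually_one_le_log, eventually_ge_atTop 1] with n h2 h3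
  have hn : (1 : ℝ) ≤ n := by exact_mod_cast h3
  have hn0 : (0 : ℝ) < n := by linarith
  have hbn := pow_pos (hb.pos n) d
  have hB := pow_pos hb.bound_pos d
  have hbB : b n ^ d ≤ B ^ d := pow_le_pow_left₀ (hb.pos n).le (hb.le n) d
  have hr := rate_nonneg (b n ^ d) n
  refine le_of_sq_le_sq ?_ (by positivity)
  rw [mul_pow, rate_sq hbn]
  calc ((n : ℝ)⁻¹) ^ 2 = (n : ℝ)⁻¹ * (n : ℝ)⁻¹ := by ring
    _ ≤ (n : ℝ)⁻¹ * 1 := by gcongr; exact inv_le_one_of_one_le₀ hn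
    _ = (n : ℝ)⁻¹ * (b n ^ d * (b n ^ d)⁻¹) * 1 := by rw [mul_inv_cancel₀ hbn.ne']; ring
    _ ≤ (n : ℝ)⁻¹ * ((B ^ d + 1) ^ 2 * (b n ^ d)⁻¹) * Real.log n := by
        gcongr
        nlinarith
    _ = _ := by rw [mul_inv]; ring

end Bandwidths

end Bandwidths

/-! ### A polynomially large grid in the cube -/

section Grid

variable {d : ℕ}

/-- The points of the unit cube with coordinates in `N⁻¹ ℤ`. -/
noncomputable def cubeGrid (d N : ℕ) : Finset (Fin d → ℝ) :=
  Finset.univ.image fun (k : Fin d → Fin (N + 1)) i => (k i : ℝ) / N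

theorem card_cubeGrid_le (d N : ℕ) : (cubeGrid d N).card ≤ (N + 1) ^ d := by
  refine Finset.card_image_le.trans ?_
  simp

theorem exists_mem_cubeGrid {N : ℕ} (hN : 0 < N) {w : Fin d → ℝ}
    (hw : w ∈ Set.Icc (0 : Fin d → ℝ) 1) : ∃ w' ∈ cubeGrid d N, ‖w - w'‖ ≤ (N : ℝ)⁻¹ := by
  have hN' : (0 : ℝ) < N := by exact_mod_cast hN
  have h0 : ∀ i, 0 ≤ N * w i := fun i => mul_nonneg hN'.le (hw.1 i)
  have hk : ∀ i, ⌊N * w i⌋₊ < N + 1 := by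
    intro i
    rw [Nat.lt_succ_iff]
    refine Nat.floor_le_of_le ?_
    exact mul_le_of_le_one_right hN'.le (hw.2 i)
  refine ⟨fun i => (⌊N * w i⌋₊ : ℝ) / N, ?_, ?_⟩
  · exact Finset.mem_image.2 ⟨fun i => ⟨⌊N * w i⌋₊, hk i⟩, Finset.mem_univ _, rfl⟩
  · refine (pi_norm_le_iff_of_nonneg (by positivity)).2 fun i => ?_
    have h1 := Nat.floor_le (h0 i)
    have h2 := (Nat.lt_floor_add_one (N * w i)).le
    rw [Pi.sub_apply, Real.norm_eq_abs, abs_le]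
    have h3 : w i - (⌊N * w i⌋₊ : ℝ) / N = (N * w i - ⌊N * w i⌋₊) * (N : ℝ)⁻¹ := by
      field_simp
    rw [h3]
    have : 0 < (N : ℝ)⁻¹ := by positivity
    constructor <;> nlinarith

/-- The mesh is `n⁻³` because rescaled bumps have Lipschitz constant `A b^{-d-1} ≤ A n²` in `w`, so
that the discretization error is `A / n`. -/
theorem eventually_card_cubeGrid_le (d : ℕ) :
    ∀ᶠ n : ℕ in atTop, (cubeGrid d (n ^ 3)).card ≤ n ^ (4 * d) := by
  filter_upwards [eventually_ge_atTop 2] with n hn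
  refine (card_cubeGrid_le d _).trans ?_
  rw [pow_mul]
  gcongr
  have : 1 ≤ n ^ 3 := Nat.one_le_pow _ _ (by omega)
  calc n ^ 3 + 1 ≤ n ^ 3 * 2 := by omega
    _ ≤ n ^ 3 * n := by gcongr
    _ = n ^ 4 := by ring

end Grid

/-! ### Uniform deviations over `w` for polynomially many bounded functions -/

section Uniform

/-- Independent and identically distributed random variables. -/
structure IsIIDSample {Ω E : Type*} [MeasurableSpace Ω] [MeasurableSpace E] (μ : Measure Ω)
    (Z : ℕ → Ω → E) : Prop where
  measurable : ∀ i, Measurable (Z i)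
  indep : iIndepFun Z μ
  ident : ∀ i, IdentDistrib (Z i) (Z 0) μ μ

theorem abs_avg_sub_avg_le {Ω E : Type*} (Z : ℕ → Ω → E) (n : ℕ) {F G D : E → ℝ} {c : ℝ}
    (h : ∀ z, |F z - G z| ≤ c * D z) (ω : Ω) :
    |avg Z n F ω - avg Z n G ω| ≤ c * avg Z n D ω := by
  simp only [avg]
  rw [← mul_sub, ← Finset.sum_sub_distrib, abs_mul, abs_of_nonneg (by positivity), mul_left_comm,
    Finset.mul_sum]
  gcongr
  exact (Finset.abs_sum_le_sum_abs _ _).trans (Finset.sum_le_sum fun i _ => h _)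

theorem avg_mono {Ω E : Type*} (Z : ℕ → Ω → E) (n : ℕ) {F G : E → ℝ} (h : ∀ z, F z ≤ G z) (ω : Ω) :
    avg Z n F ω ≤ avg Z n G ω := by
  simp only [avg]
  gcongr
  exact h _

theorem avg_one_le {Ω E : Type*} (Z : ℕ → Ω → E) (n : ℕ) (ω : Ω) :
    avg Z n (fun _ => 1) ω ≤ 1 := by
  simp only [avg, Finset.sum_const, Finset.card_range, nsmul_eq_mul, mul_one]
  exact inv_mul_le_one

theorem IsIIDSample.measurable_fst {Ω E E' : Type*} [MeasurableSpace Ω] [MeasurableSpace E]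
    [MeasurableSpace E'] {μ : Measure Ω} {Z : ℕ → Ω → E × E'} (hZ : IsIIDSample μ Z) :
    Measurable fun ω => (Z 0 ω).1 :=
  (hZ.measurable 0).fst

variable {Ω : Type*} [MeasurableSpace Ω] {μ : Measure Ω} [IsProbabilityMeasure μ] {d : ℕ}
  {Z : ℕ → Ω → (Fin d → ℝ) × ℝ} {b : ℕ → ℝ} {B ρ A F : ℝ} {g : (Fin d → ℝ) → ℝ}

theorem integral_sq_localize_le' (hZ : IsIIDSample μ Z)
    (hF : 0 ≤ F) (hP : μ.map (fun ω => (Z 0 ω).1) ≤ ENNReal.ofReal F • volume) (hρ : 0 ≤ ρ)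
    (hg : IsBump ρ A g) {β : ℝ} (hβ : 0 < β) (w : Fin d → ℝ) :
    ∫ ω, localize β g w (Z 0 ω).1 ^ 2 ∂μ ≤ A ^ 2 * F * (2 * ρ) ^ d * (β ^ d)⁻¹ := by
  have : IsProbabilityMeasure (μ.map fun ω => (Z 0 ω).1) :=
    Measure.isProbabilityMeasure_map hZ.measurable_fst.aemeasurable
  rw [← integral_map (φ := fun ω => (Z 0 ω).1) (f := fun x => localize β g w x ^ 2)
    hZ.measurable_fst.aemeasurable ((hg.continuous_localize w).pow 2).aestronglyMeasurable]
  exact hg.integral_sq_localize_le hρ hβ hF hP w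

/-- Moments of a bounded centred function. -/
theorem centered_moments {G : Ω → ℝ} (hG : Measurable G) {a t v : ℝ} (hbd : ∀ ω, |G ω| ≤ a)
    (ht : 0 ≤ t) (hta : t * (2 * a) ≤ 1) (hv : ∫ ω, G ω ^ 2 ∂μ ≤ v) :
    Integrable (fun ω => G ω - ∫ ω, G ω ∂μ) μ ∧ ∫ ω, (G ω - ∫ ω, G ω ∂μ) ∂μ = 0 ∧
      Integrable (fun ω => (G ω - ∫ ω, G ω ∂μ) ^ 2 * Real.exp (t * |G ω - ∫ ω, G ω ∂μ|)) μ ∧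
      ∫ ω, (G ω - ∫ ω, G ω ∂μ) ^ 2 * Real.exp (t * |G ω - ∫ ω, G ω ∂μ|) ∂μ ≤
        v * Real.exp 1 := by
  have hGi : Integrable G μ := Integrable.of_bound hG.aestronglyMeasurable a (ae_of_all _ hbd)
  have hG2 : Integrable (fun ω => G ω ^ 2) μ :=
    Integrable.of_bound (hG.pow_const 2).aestronglyMeasurable (a ^ 2) (ae_of_all _ fun ω => by
      rw [Real.norm_eq_abs, abs_pow]
      exact pow_le_pow_left₀ (abs_nonneg _) (hbd ω) 2)
  set m := ∫ ω, G ω ∂μ with hm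
  have hma : |m| ≤ a := by
    have := norm_integral_le_of_norm_le_const (μ := μ) (f := G) (C := a) (ae_of_all _ hbd)
    simpa using this
  have hsub : ∀ ω, |G ω - m| ≤ 2 * a := fun ω => by
    calc |G ω - m| ≤ |G ω| + |m| := abs_sub _ _
      _ ≤ _ := by linarith [hbd ω]
  have hmeas : Measurable fun ω => G ω - m := hG.sub_const m
  -- Since `|G - m| ≤ 2 a` and `t * (2 a) ≤ 1`, the exponential factor costs only the constant `e`.
  have hle : ∀ ω, (G ω - m) ^ 2 * Real.exp (t * |G ω - m|) ≤ (G ω - m) ^ 2 * Real.exp 1 := by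
    intro ω
    gcongr
    exact (mul_le_mul_of_nonneg_left (hsub ω) ht).trans hta
  have hsqe : ∀ ω, (G ω - m) ^ 2 = G ω ^ 2 - 2 * m * G ω + m ^ 2 := fun ω => by ring
  have hsq : Integrable (fun ω => (G ω - m) ^ 2) μ := by
    simp only [hsqe]
    exact (hG2.sub (hGi.const_mul _)).add (integrable_const _)
  have hint : Integrable (fun ω => (G ω - m) ^ 2 * Real.exp (t * |G ω - m|)) μ := by
    refine (hsq.mul_const (Real.exp 1)).mono'
      ((hmeas.pow_const 2).mul (by fun_prop)).aestronglyMeasurable (ae_of_all _ fun ω => ?_)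
    rw [Real.norm_of_nonneg (by positivity)]
    exact hle ω
  refine ⟨hGi.sub (integrable_const _), ?_, hint, ?_⟩
  · rw [integral_sub hGi (integrable_const _), integral_const]
    simp [hm]
  · calc _ ≤ ∫ ω, (G ω - m) ^ 2 * Real.exp 1 ∂μ := integral_mono hint (hsq.mul_const _) hle
      _ = (∫ ω, (G ω - m) ^ 2 ∂μ) * Real.exp 1 := integral_mul_const _ _
      _ ≤ v * Real.exp 1 := by
          gcongr
          have h1 : Integrable (fun ω => G ω ^ 2 - 2 * m * G ω) μ := hG2.sub (hGi.const_mul _)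
          simp only [hsqe]
          rw [integral_add h1 (integrable_const _), integral_sub hG2 (hGi.const_mul _),
            integral_const_mul, ← hm]
          simp only [integral_const, probReal_univ, one_smul]
          nlinarith [sq_nonneg m]

/-- Uniform deviations of kernel averages of polynomially many functions with values in
`[0, 1]`. -/
theorem exists_ae_eventually_abs_avg_localize_mul_le (hZ : IsIIDSample μ Z)
    (hb : Bandwidths d b B)
    (hF : 0 ≤ F) (hP : μ.map (fun ω => (Z 0 ω).1) ≤ ENNReal.ofReal F • volume) (hρ : 0 ≤ ρ)
    (hg : IsBump ρ A g) {κ : Type*} (H : ℕ → Finset κ) (h : ℕ → κ → (Fin d → ℝ) × ℝ → ℝ)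
    (hh : ∀ n k, Measurable (h n k)) (hh0 : ∀ n k z, 0 ≤ h n k z) (hh1 : ∀ n k z, h n k z ≤ 1)
    (q : ℕ) (hH : ∀ᶠ n in atTop, (H n).card ≤ n ^ q) :
    ∃ C, 0 ≤ C ∧ ∀ᵐ ω ∂μ, ∀ᶠ n in atTop, ∀ w ∈ Set.Icc (0 : Fin d → ℝ) 1, ∀ k ∈ H n,
      |avg Z n (fun z => localize (b n) g w z.1 * h n k z) ω -
        ∫ ω, localize (b n) g w (Z 0 ω).1 * h n k (Z 0 ω) ∂μ| ≤ C * rate (b n ^ d) n := by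
  have hA := hg.nonneg_const
  let G : ℕ → (Fin d → ℝ) × κ → (Fin d → ℝ) × ℝ → ℝ := fun n j z =>
    localize (b n) g j.1 z.1 * h n j.2 z
  have hGm : ∀ n j, Measurable (G n j) := fun n j =>
    ((hg.continuous_localize j.1).measurable.comp measurable_fst).mul (hh n j.2)
  have habs : ∀ n j z, |G n j z| ≤ |localize (b n) g j.1 z.1| := by
    intro n j z
    rw [abs_mul, abs_of_nonneg (hh0 _ _ _)]
    exact mul_le_of_le_one_right (abs_nonneg _) (hh1 _ _ _)
  have hGint : ∀ n j, Integrable (fun ω => G n j (Z 0 ω)) μ := fun n j =>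
    Integrable.of_bound ((hGm n j).comp (hZ.measurable 0)).aestronglyMeasurable
      (A * (b n ^ d)⁻¹) (ae_of_all _ fun ω =>
        (habs n j _).trans (hg.abs_localize_le (hb.pos n) _ _))
  obtain ⟨C, hC0, hC⟩ := exists_ae_eventually_abs_avg_le hZ.measurable hZ.indep hZ.ident
    (fun n => cubeGrid d (n ^ 3) ×ˢ H n)
    (fun n j z => G n j z - ∫ ω, G n j (Z 0 ω) ∂μ) (β := fun n => b n ^ d)
    (fun n => pow_pos (hb.pos n) d) (4 * d + q)
    (by
      filter_upwards [hH, eventually_card_cubeGrid_le d] with n h1 h2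
      rw [Finset.card_product, pow_add]
      exact Nat.mul_le_mul h2 h1)
    (A ^ 2 * F * (2 * ρ) ^ d * Real.exp 1)
    (by
      filter_upwards [hb.eventually_rate_le (ε := 1 / (2 * (A + 1))) (by positivity)]
        with n hn j _
      have hbn := pow_pos (hb.pos n) d
      have hr := rate_nonneg (b n ^ d) n
      refine ⟨(hGm n j).sub_const _, ?_⟩
      -- The powers of `b` cancel and leave `2 A` times the rate, which tends to zero.
      have h1 : b n ^ d * rate (b n ^ d) n * (2 * (A * (b n ^ d)⁻¹)) ≤ 1 := by
        calc _ = rate (b n ^ d) n * (2 * A) := by field_simp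
          _ ≤ 1 / (2 * (A + 1)) * (2 * A) := by gcongr
          _ ≤ 1 := by rw [div_mul_eq_mul_div, div_le_one (by positivity)]; linarith
      have h2 : ∫ ω, G n j (Z 0 ω) ^ 2 ∂μ ≤ A ^ 2 * F * (2 * ρ) ^ d * (b n ^ d)⁻¹ := by
        refine le_trans ?_ (integral_sq_localize_le' hZ hF hP hρ hg (hb.pos n) j.1)
        refine integral_mono_of_nonneg (ae_of_all _ fun ω => sq_nonneg _) ?_
          (ae_of_all _ fun ω => ?_)
        · refine Integrable.of_bound (((hg.continuous_localize j.1).measurable.comp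
            hZ.measurable_fst).pow_const 2).aestronglyMeasurable ((A * (b n ^ d)⁻¹) ^ 2)
            (ae_of_all _ fun ω => ?_)
          rw [Real.norm_eq_abs, abs_pow]
          exact pow_le_pow_left₀ (abs_nonneg _) (hg.abs_localize_le (hb.pos n) _ _) 2
        · exact sq_le_sq.2 (habs n j _)
      obtain ⟨m1, m2, m3, m4⟩ := centered_moments ((hGm n j).comp (hZ.measurable 0))
        (fun ω => (habs n j _).trans (hg.abs_localize_le (hb.pos n) _ _))
        (mul_nonneg hbn.le hr) h1 h2
      refine ⟨m1, m2, m3, m4.trans (le_of_eq ?_)⟩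
      ring)
  refine ⟨C + 2 * A * (B ^ d + 1), ?_, ?_⟩
  · have := hb.bound_pos; positivity
  filter_upwards [hC] with ω hω
  filter_upwards [hω, hb.eventually_inv_pow_le, hb.eventually_inv_le,
    hb.eventually_inv_natCast_le, eventually_ge_atTop 1] with n h1 h2 h3 h4 h5 w hw k hk
  have hn : (0 : ℝ) < n := by exact_mod_cast h5
  have hbn := pow_pos (hb.pos n) d
  obtain ⟨w', hw', hww'⟩ := exists_mem_cubeGrid (N := n ^ 3) (by positivity) hw
  -- Passing to the nearest grid point costs `A / n`, both in the average and in the mean.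
  have hclose : ∀ z, |G n (w, k) z - G n (w', k) z| ≤ A * (n : ℝ)⁻¹ * 1 := by
    intro z
    simp only [G]
    rw [← sub_mul, abs_mul, abs_of_nonneg (hh0 _ _ _)]
    calc _ ≤ (A * ((b n ^ d)⁻¹ * (b n)⁻¹) * ‖w - w'‖) * 1 := by
          refine mul_le_mul (hg.abs_localize_sub_le (hb.pos n) _ _ _) (hh1 _ _ _) (hh0 _ _ _) ?_
          have := hb.pos n
          positivity
      _ ≤ (A * (n * n) * ((n ^ 3 : ℕ) : ℝ)⁻¹) * 1 := by
          have := hb.pos n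
          gcongr
      _ = _ := by push_cast; field_simp
  have hd1 : |avg Z n (G n (w, k)) ω - avg Z n (G n (w', k)) ω| ≤ A * (n : ℝ)⁻¹ := by
    refine (abs_avg_sub_avg_le Z n (D := fun _ => 1) hclose ω).trans ?_
    exact mul_le_of_le_one_right (by positivity) (avg_one_le Z n ω)
  have hd2 : |∫ ω, G n (w, k) (Z 0 ω) ∂μ - ∫ ω, G n (w', k) (Z 0 ω) ∂μ| ≤ A * (n : ℝ)⁻¹ := by
    rw [← integral_sub (hGint _ _) (hGint _ _)]
    have := norm_integral_le_of_norm_le_const (μ := μ)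
      (f := fun ω => G n (w, k) (Z 0 ω) - G n (w', k) (Z 0 ω)) (C := A * (n : ℝ)⁻¹)
      (ae_of_all _ fun ω => (hclose (Z 0 ω)).trans_eq (mul_one _))
    simpa using this
  have hd3 : |avg Z n (G n (w', k)) ω - ∫ ω, G n (w', k) (Z 0 ω) ∂μ| ≤
      C * rate (b n ^ d) n := by
    have := h1 (w', k) (Finset.mem_product.2 ⟨hw', hk⟩)
    refine le_trans (le_of_eq ?_) this
    congr 1
    simp only [avg, Finset.sum_sub_distrib, Finset.sum_const, Finset.card_range, nsmul_eq_mul,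
      mul_sub, inv_mul_cancel_left₀ hn.ne']
  have h6 : A * (n : ℝ)⁻¹ ≤ A * ((B ^ d + 1) * rate (b n ^ d) n) := by gcongr
  change |avg Z n (G n (w, k)) ω - ∫ ω, G n (w, k) (Z 0 ω) ∂μ| ≤ _
  rw [abs_le] at *
  constructor <;> nlinarith

end Uniform

/-! ### Brackets for monotone families -/

section Bracketing

variable {E : Type*} [MeasurableSpace E]

/-- The supremum over the interval `S` is taken along a monotone cofinal sequence. This makes it
measurable, and monotone convergence bounds its integral. -/
theorem exists_upper_bracket (Q : Measure E) [IsProbabilityMeasure Q] {h : ℝ → E → ℝ}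
    (hm : ∀ t, Measurable (h t)) (h0 : ∀ t z, 0 ≤ h t z) (h1 : ∀ t z, h t z ≤ 1)
    (hmono : ∀ z, Monotone fun t => h t z) {S : Set ℝ} [S.OrdConnected] (hS : S.Nonempty) {v : ℝ}
    (hv : ∀ t ∈ S, ∫ z, h t z ∂Q ≤ v) :
    ∃ u : E → ℝ, Measurable u ∧ (∀ z, 0 ≤ u z) ∧ (∀ z, u z ≤ 1) ∧ (∀ t ∈ S, ∀ z, h t z ≤ u z) ∧
      ∫ z, u z ∂Q ≤ v := by
  have : Nonempty S := hS.to_subtype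
  obtain ⟨xs, hxs, hlim⟩ := exists_seq_monotone_tendsto_atTop_atTop S
  have hbdd : ∀ z, BddAbove (Set.range fun n => h (xs n) z) := fun z =>
    ⟨1, by rintro _ ⟨n, rfl⟩; exact h1 _ _⟩
  have hu0 : ∀ z, 0 ≤ ⨆ n, h (xs n) z := fun z => (h0 _ z).trans (le_ciSup (hbdd z) 0)
  have hu1 : ∀ z, ⨆ n, h (xs n) z ≤ 1 := fun z => ciSup_le fun n => h1 _ _
  have hum : Measurable fun z => ⨆ n, h (xs n) z := Measurable.iSup fun n => hm _
  have hint : ∀ {f : E → ℝ}, Measurable f → (∀ z, 0 ≤ f z) → (∀ z, f z ≤ 1) → Integrable f Q := by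
    intro f hf hf0 hf1
    refine Integrable.of_bound hf.aestronglyMeasurable 1 (ae_of_all _ fun z => ?_)
    rw [Real.norm_of_nonneg (hf0 z)]
    exact hf1 z
  refine ⟨fun z => ⨆ n, h (xs n) z, hum, hu0, hu1, fun t ht z => ?_, ?_⟩
  · obtain ⟨n, hn⟩ := (hlim.eventually_ge_atTop ⟨t, ht⟩).exists
    exact (hmono z (show t ≤ xs n from hn)).trans (le_ciSup (hbdd z) n)
  · refine le_of_tendsto' (integral_tendsto_of_tendsto_of_monotone (fun n => hint (hm (xs n))
      (h0 _) (h1 _)) (hint hum hu0 hu1) (ae_of_all _ fun z i j hij => hmono z (hxs hij))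
      (ae_of_all _ fun z => tendsto_atTop_ciSup (fun i j hij => hmono z (hxs hij)) (hbdd z)))
      fun n => hv _ (xs n).2

theorem exists_bracket (Q : Measure E) [IsProbabilityMeasure Q] {h : ℝ → E → ℝ}
    (hm : ∀ t, Measurable (h t)) (h0 : ∀ t z, 0 ≤ h t z) (h1 : ∀ t z, h t z ≤ 1)
    (hmono : ∀ z, Monotone fun t => h t z) {S : Set ℝ} [S.OrdConnected] (hS : S.Nonempty)
    {v v' : ℝ} (hv : ∀ t ∈ S, ∫ z, h t z ∂Q ≤ v) (hv' : ∀ t ∈ S, v' ≤ ∫ z, h t z ∂Q) :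
    ∃ l u : E → ℝ, (Measurable l ∧ (∀ z, 0 ≤ l z) ∧ ∀ z, l z ≤ 1) ∧
      (Measurable u ∧ (∀ z, 0 ≤ u z) ∧ ∀ z, u z ≤ 1) ∧
      (∀ t ∈ S, ∀ z, l z ≤ h t z ∧ h t z ≤ u z) ∧ ∫ z, (u z - l z) ∂Q ≤ v - v' := by
  have hint : ∀ {f : E → ℝ}, Measurable f → (∀ z, 0 ≤ f z) → (∀ z, f z ≤ 1) → Integrable f Q := by
    intro f hf hf0 hf1
    refine Integrable.of_bound hf.aestronglyMeasurable 1 (ae_of_all _ fun z => ?_)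
    rw [Real.norm_of_nonneg (hf0 z)]
    exact hf1 z
  obtain ⟨u, hu, hu0, hu1, hub, hui⟩ := exists_upper_bracket Q hm h0 h1 hmono hS hv
  have hS' : (-S).OrdConnected := by
    refine ⟨fun x hx y hy z hz => ?_⟩
    have : Set.OrdConnected S := inferInstance
    exact this.out hy hx ⟨neg_le_neg hz.2, neg_le_neg hz.1⟩
  -- The lower bracket is the upper one for the reflected family `1 - h (-t)` on `-S`.
  obtain ⟨l, hl, hl0, hl1, hlb, hli⟩ := exists_upper_bracket Q (h := fun t z => 1 - h (-t) z)
    (fun t => (hm _).const_sub 1) (fun t z => by linarith [h1 (-t) z])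
    (fun t z => by linarith [h0 (-t) z])
    (fun z s t hst => sub_le_sub_left (hmono z (neg_le_neg hst)) 1) (S := -S) hS.neg (v := 1 - v')
    (fun t ht => by
      rw [integral_sub (integrable_const _) (hint (hm _) (h0 _) (h1 _))]
      have := hv' (-t) ht
      simp only [integral_const, probReal_univ, one_smul]
      linarith)
  refine ⟨fun z => 1 - l z, u, ⟨hl.const_sub 1, fun z => by linarith [hl1 z],
    fun z => by linarith [hl0 z]⟩, ⟨hu, hu0, hu1⟩, fun t ht z => ⟨?_, hub t ht z⟩, ?_⟩
  · have := hlb (-t) (by simpa using ht) z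
    rw [neg_neg] at this
    linarith
  · have hli' := hint hl hl0 hl1
    have hli2 : Integrable (fun z => 1 - l z) Q := (integrable_const _).sub hli'
    rw [integral_sub (hint hu hu0 hu1) hli2, integral_sub (integrable_const _) hli']
    simp only [integral_const, probReal_univ, one_smul]
    linarith

/-- The line is cut at the levels `⌊N m(t)⌋` of the mean `m`. As `m` is monotone the pieces are
intervals, and `m` varies by at most `1 / N` on each. The level `N` occurs when `m = 1`, hence `N +
1` pieces. -/
theorem exists_brackets (Q : Measure E) [IsProbabilityMeasure Q] {h : ℝ → E → ℝ}
    (hm : ∀ t, Measurable (h t)) (h0 : ∀ t z, 0 ≤ h t z) (h1 : ∀ t z, h t z ≤ 1)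
    (hmono : ∀ z, Monotone fun t => h t z) {N : ℕ} (hN : 0 < N) :
    ∃ l u : ℕ → E → ℝ, (∀ k, Measurable (l k) ∧ (∀ z, 0 ≤ l k z) ∧ ∀ z, l k z ≤ 1) ∧
      (∀ k, Measurable (u k) ∧ (∀ z, 0 ≤ u k z) ∧ ∀ z, u k z ≤ 1) ∧
      ∀ t, ∃ k ∈ Finset.range (N + 1), (∀ z, l k z ≤ h t z ∧ h t z ≤ u k z) ∧
        ∫ z, (u k z - l k z) ∂Q ≤ (N : ℝ)⁻¹ := by
  have hN' : (0 : ℝ) < N := by exact_mod_cast hN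
  have hint : ∀ t, Integrable (h t) Q := by
    intro t
    refine Integrable.of_bound (hm t).aestronglyMeasurable 1 (ae_of_all _ fun z => ?_)
    rw [Real.norm_of_nonneg (h0 t z)]
    exact h1 t z
  set m : ℝ → ℝ := fun t => ∫ z, h t z ∂Q with hmdef
  have hm0 : ∀ t, 0 ≤ m t := fun t => integral_nonneg (h0 t)
  have hm1 : ∀ t, m t ≤ 1 := fun t => by
    have := integral_mono (hint t) (integrable_const 1) (h1 t)
    simpa using this
  have hmm : Monotone m := fun s t hst => integral_mono (hint s) (hint t) fun z => hmono z hst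
  have hfloor : Monotone fun t => ⌊N * m t⌋₊ := fun s t hst =>
    Nat.floor_le_floor (mul_le_mul_of_nonneg_left (hmm hst) hN'.le)
  have key : ∀ k : ℕ, ∃ lu : (E → ℝ) × (E → ℝ),
      (Measurable lu.1 ∧ (∀ z, 0 ≤ lu.1 z) ∧ ∀ z, lu.1 z ≤ 1) ∧
      (Measurable lu.2 ∧ (∀ z, 0 ≤ lu.2 z) ∧ ∀ z, lu.2 z ≤ 1) ∧
      ∀ t, ⌊N * m t⌋₊ = k → (∀ z, lu.1 z ≤ h t z ∧ h t z ≤ lu.2 z) ∧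
        ∫ z, (lu.2 z - lu.1 z) ∂Q ≤ (N : ℝ)⁻¹ := by
    intro k
    rcases Set.eq_empty_or_nonempty {t | ⌊N * m t⌋₊ = k} with hS | hS
    · refine ⟨(0, 0), ⟨measurable_const, fun _ => le_rfl, fun _ => zero_le_one⟩,
        ⟨measurable_const, fun _ => le_rfl, fun _ => zero_le_one⟩, fun t ht => ?_⟩
      have : t ∈ {t | ⌊N * m t⌋₊ = k} := ht
      rw [hS] at this
      exact this.elim
    · have : ({t | ⌊N * m t⌋₊ = k}).OrdConnected :=
        (Set.ordConnected_singleton (a := k)).preimage_mono hfloor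
      obtain ⟨l, u, hl, hu, hb, hi⟩ := exists_bracket Q hm h0 h1 hmono hS
        (v := (k + 1) * (N : ℝ)⁻¹) (v' := k * (N : ℝ)⁻¹)
        (fun t ht => by
          have h2 := (Nat.lt_floor_add_one (N * m t)).le
          rw [show ⌊N * m t⌋₊ = k from ht] at h2
          rw [← div_eq_mul_inv, le_div_iff₀ hN', mul_comm]
          exact h2)
        (fun t ht => by
          have h2 := Nat.floor_le (mul_nonneg hN'.le (hm0 t))
          rw [show ⌊N * m t⌋₊ = k from ht] at h2
          rw [← div_eq_mul_inv, div_le_iff₀ hN', mul_comm]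
          exact h2)
      exact ⟨(l, u), hl, hu, fun t ht => ⟨hb t ht, hi.trans_eq (by ring)⟩⟩
  choose lu hl hu hlu using key
  refine ⟨fun k => (lu k).1, fun k => (lu k).2, hl, hu, fun t => ⟨⌊N * m t⌋₊, ?_, hlu _ t rfl⟩⟩
  rw [Finset.mem_range, Nat.lt_succ_iff]
  exact Nat.floor_le_of_le (mul_le_of_le_one_right hN'.le (hm1 t))

end Bracketing

/-! ### Uniform deviations over `w` and over a monotone family -/

section Monotone

variable {Ω : Type*} [MeasurableSpace Ω] {μ : Measure Ω} [IsProbabilityMeasure μ] {d : ℕ}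
  {Z : ℕ → Ω → (Fin d → ℝ) × ℝ} {b : ℕ → ℝ} {B ρ A F : ℝ} {g : (Fin d → ℝ) → ℝ}

theorem integrable_localize_mul (hZ : IsIIDSample μ Z) (hg : IsBump ρ A g) {β : ℝ} (hβ : 0 < β)
    (w : Fin d → ℝ) {h : (Fin d → ℝ) × ℝ → ℝ} (hm : Measurable h) (h0 : ∀ z, 0 ≤ h z)
    (h1 : ∀ z, h z ≤ 1) : Integrable (fun ω => localize β g w (Z 0 ω).1 * h (Z 0 ω)) μ := by
  refine Integrable.of_bound (((hg.continuous_localize w).measurable.comp hZ.measurable_fst).mul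
    (hm.comp (hZ.measurable 0))).aestronglyMeasurable (A * (β ^ d)⁻¹) (ae_of_all _ fun ω => ?_)
  rw [Real.norm_eq_abs, abs_mul, abs_of_nonneg (h0 _)]
  exact (mul_le_of_le_one_right (abs_nonneg _) (h1 _)).trans (hg.abs_localize_le hβ _ _)

/-- Nonnegative weights preserve brackets, so the average and the mean at `t` lie between those of
the bracket functions. The two bracket means differ by at most `A / n`. -/
theorem exists_ae_eventually_abs_avg_localize_mul_monotone_le_of_nonneg (hZ : IsIIDSample μ Z)
    (hb : Bandwidths d b B)
    (hF : 0 ≤ F) (hP : μ.map (fun ω => (Z 0 ω).1) ≤ ENNReal.ofReal F • volume) (hρ : 0 ≤ ρ)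
    (hg : IsBump ρ A g) (hg0 : ∀ u, 0 ≤ g u) (h : ℝ → (Fin d → ℝ) × ℝ → ℝ)
    (hm : ∀ t, Measurable (h t)) (h0 : ∀ t z, 0 ≤ h t z) (h1 : ∀ t z, h t z ≤ 1)
    (hmono : ∀ z, Monotone fun t => h t z) :
    ∃ C, 0 ≤ C ∧ ∀ᵐ ω ∂μ, ∀ᶠ n in atTop, ∀ w ∈ Set.Icc (0 : Fin d → ℝ) 1, ∀ t,
      |avg Z n (fun z => localize (b n) g w z.1 * h t z) ω -
        ∫ ω, localize (b n) g w (Z 0 ω).1 * h t (Z 0 ω) ∂μ| ≤ C * rate (b n ^ d) n := by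
  have hA := hg.nonneg_const
  have hQ : IsProbabilityMeasure (μ.map (Z 0)) :=
    Measure.isProbabilityMeasure_map (hZ.measurable 0).aemeasurable
  choose l u hl hu hlu using fun n : ℕ =>
    -- The kernel bound `A b^{-d} ≤ A n` loses one power of `n`, so brackets of size about `n⁻²` are
    -- needed; the `+ 1` covers `n = 0`.
    exists_brackets (μ.map (Z 0)) hm h0 h1 hmono (N := n ^ 2 + 1) (Nat.succ_pos _)
  have hlu' : ∀ n (κ : ℕ × Bool), Measurable (if κ.2 then u n κ.1 else l n κ.1) ∧
      (∀ z, 0 ≤ (if κ.2 then u n κ.1 else l n κ.1) z) ∧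
      ∀ z, (if κ.2 then u n κ.1 else l n κ.1) z ≤ 1 := by
    rintro n ⟨k, _ | _⟩
    · simpa using hl n k
    · simpa using hu n k
  obtain ⟨C, hC0, hC⟩ := exists_ae_eventually_abs_avg_localize_mul_le hZ hb hF hP hρ hg
    (fun n => Finset.range (n ^ 2 + 1 + 1) ×ˢ (Finset.univ : Finset Bool))
    (fun n κ => if κ.2 then u n κ.1 else l n κ.1) (fun n κ => (hlu' n κ).1)
    (fun n κ => (hlu' n κ).2.1) (fun n κ => (hlu' n κ).2.2) 4
    (by
      filter_upwards [eventually_ge_atTop 2] with n hn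
      simp only [Finset.card_product, Finset.card_range, Finset.card_univ, Fintype.card_bool]
      have : 4 ≤ n ^ 2 := by nlinarith
      calc (n ^ 2 + 1 + 1) * 2 ≤ 4 * n ^ 2 := by omega
        _ ≤ n ^ 2 * n ^ 2 := by gcongr
        _ = n ^ 4 := by ring)
  refine ⟨C + A * (B ^ d + 1), ?_, ?_⟩
  · have := hb.bound_pos; positivity
  filter_upwards [hC] with ω hω
  filter_upwards [hω, hb.eventually_inv_pow_le, hb.eventually_inv_natCast_le,
    eventually_ge_atTop 1] with n h2 h3 h4 h5 w hw t
  have hn : (0 : ℝ) < n := by exact_mod_cast h5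
  have hbp := hb.pos n
  have hbn := pow_pos (hb.pos n) d
  obtain ⟨k, hk, hb1, hb2⟩ := hlu n t
  have hU := h2 w hw (k, true) (Finset.mem_product.2 ⟨hk, Finset.mem_univ _⟩)
  have hL := h2 w hw (k, false) (Finset.mem_product.2 ⟨hk, Finset.mem_univ _⟩)
  simp only [if_true, Bool.false_eq_true, if_false] at hU hL
  have hloc : ∀ x, 0 ≤ localize (b n) g w x := fun x =>
    mul_nonneg (by positivity) (hg0 _)
  have hIu := integrable_localize_mul hZ hg hbp w (hu n k).1 (hu n k).2.1 (hu n k).2.2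
  have hIl := integrable_localize_mul hZ hg hbp w (hl n k).1 (hl n k).2.1 (hl n k).2.2
  have hIt := integrable_localize_mul hZ hg hbp w (hm t) (h0 t) (h1 t)
  have hgap : ∫ ω, localize (b n) g w (Z 0 ω).1 * u n k (Z 0 ω) ∂μ -
      ∫ ω, localize (b n) g w (Z 0 ω).1 * l n k (Z 0 ω) ∂μ ≤ A * (n : ℝ)⁻¹ := by
    rw [← integral_sub hIu hIl]
    have hmul : Measurable fun z => u n k z - l n k z := (hu n k).1.sub (hl n k).1
    have hdiff : ∀ z, 0 ≤ u n k z - l n k z := fun z => by linarith [(hb1 z).1, (hb1 z).2]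
    have hdi : Integrable (fun ω => u n k (Z 0 ω) - l n k (Z 0 ω)) μ := by
      refine Integrable.of_bound (hmul.comp (hZ.measurable 0)).aestronglyMeasurable 1
        (ae_of_all _ fun ω => ?_)
      rw [Real.norm_of_nonneg (hdiff _)]
      linarith [(hu n k).2.2 (Z 0 ω), (hl n k).2.1 (Z 0 ω)]
    calc _ ≤ ∫ ω, A * (b n ^ d)⁻¹ * (u n k (Z 0 ω) - l n k (Z 0 ω)) ∂μ := by
          refine integral_mono (hIu.sub hIl) (hdi.const_mul _) fun ω => ?_
          simp only
          rw [← mul_sub]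
          have := hdiff (Z 0 ω)
          gcongr
          exact (le_abs_self _).trans (hg.abs_localize_le hbp _ _)
      _ = A * (b n ^ d)⁻¹ * ∫ z, (u n k z - l n k z) ∂(μ.map (Z 0)) := by
          rw [integral_const_mul, integral_map (hZ.measurable 0).aemeasurable
            hmul.aestronglyMeasurable]
      _ ≤ A * n * ((n ^ 2 + 1 : ℕ) : ℝ)⁻¹ := by
          gcongr
          exact integral_nonneg hdiff
      _ ≤ A * n * ((n : ℝ) ^ 2)⁻¹ := by
          gcongr
          push_cast
          linarith
      _ = _ := by field_simp
  have h6 : A * (n : ℝ)⁻¹ ≤ A * ((B ^ d + 1) * rate (b n ^ d) n) := by gcongr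
  have a1 := avg_mono Z n (fun z => mul_le_mul_of_nonneg_left (hb1 z).1 (hloc z.1)) ω
  have a2 := avg_mono Z n (fun z => mul_le_mul_of_nonneg_left (hb1 z).2 (hloc z.1)) ω
  have a3 := integral_mono hIl hIt fun ω => mul_le_mul_of_nonneg_left (hb1 (Z 0 ω)).1 (hloc _)
  have a4 := integral_mono hIt hIu fun ω => mul_le_mul_of_nonneg_left (hb1 (Z 0 ω)).2 (hloc _)
  rw [abs_le] at *
  constructor <;> nlinarith

/-- Uniform deviations of kernel averages over a monotone family of functions with values in
`[0, 1]`. -/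
theorem exists_ae_eventually_abs_avg_localize_mul_monotone_le (hZ : IsIIDSample μ Z)
    (hb : Bandwidths d b B)
    (hF : 0 ≤ F) (hP : μ.map (fun ω => (Z 0 ω).1) ≤ ENNReal.ofReal F • volume) (hρ : 0 ≤ ρ)
    (hg : IsBump ρ A g) (h : ℝ → (Fin d → ℝ) × ℝ → ℝ)
    (hm : ∀ t, Measurable (h t)) (h0 : ∀ t z, 0 ≤ h t z) (h1 : ∀ t z, h t z ≤ 1)
    (hmono : ∀ z, Monotone fun t => h t z) :
    ∃ C, 0 ≤ C ∧ ∀ᵐ ω ∂μ, ∀ᶠ n in atTop, ∀ w ∈ Set.Icc (0 : Fin d → ℝ) 1, ∀ t,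
      |avg Z n (fun z => localize (b n) g w z.1 * h t z) ω -
        ∫ ω, localize (b n) g w (Z 0 ω).1 * h t (Z 0 ω) ∂μ| ≤ C * rate (b n ^ d) n := by
  obtain ⟨C, hC0, hC⟩ := exists_ae_eventually_abs_avg_localize_mul_monotone_le_of_nonneg hZ hb hF
    hP hρ hg.posPart (fun u => le_max_right _ _) h hm h0 h1 hmono
  obtain ⟨C', hC0', hC'⟩ := exists_ae_eventually_abs_avg_localize_mul_monotone_le_of_nonneg hZ hb
    hF hP hρ hg.neg.posPart (fun u => le_max_right _ _) h hm h0 h1 hmono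
  refine ⟨C + C', by positivity, ?_⟩
  filter_upwards [hC, hC'] with ω hω hω'
  filter_upwards [hω, hω'] with n hn hn' w hw t
  -- The sign of `g` is removed by splitting it into positive and negative parts.
  have hdec : ∀ x, localize (b n) g w x = localize (b n) (fun u => max (g u) 0) w x -
      localize (b n) (fun u => max (-g u) 0) w x := by
    intro x
    simp only [localize, ← mul_sub]
    congr 1
    rcases le_total 0 (g (scaled (b n) w x)) with h | h
    · rw [max_eq_left h, max_eq_right (by linarith)]; ring
    · rw [max_eq_right h, max_eq_left (by linarith)]; ring
  have e1 : avg Z n (fun z => localize (b n) g w z.1 * h t z) ω =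
      avg Z n (fun z => localize (b n) (fun u => max (g u) 0) w z.1 * h t z) ω -
      avg Z n (fun z => localize (b n) (fun u => max (-g u) 0) w z.1 * h t z) ω := by
    simp only [avg, hdec, sub_mul, Finset.sum_sub_distrib, mul_sub]
  have e2 : ∫ ω, localize (b n) g w (Z 0 ω).1 * h t (Z 0 ω) ∂μ =
      ∫ ω, localize (b n) (fun u => max (g u) 0) w (Z 0 ω).1 * h t (Z 0 ω) ∂μ -
      ∫ ω, localize (b n) (fun u => max (-g u) 0) w (Z 0 ω).1 * h t (Z 0 ω) ∂μ := by
    rw [← integral_sub (integrable_localize_mul hZ hg.posPart (hb.pos n) w (hm t) (h0 t) (h1 t))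
      (integrable_localize_mul hZ hg.neg.posPart (hb.pos n) w (hm t) (h0 t) (h1 t))]
    simp only [hdec, sub_mul]
  have b1 := hn w hw t
  have b2 := hn' w hw t
  rw [e1, e2]
  rw [abs_le] at *
  constructor <;> linarith

end Monotone

/-! ### Uniform deviations of the regression errors under exponential moments -/

section Subexponential

/-- Outcomes are unbounded, so the error of moving `w` to the grid is controlled by the average of
`|y|`, through the law of large numbers. -/
theorem ae_eventually_avg_abs_snd_le {Ω : Type*} [MeasurableSpace Ω] {μ : Measure Ω} {d : ℕ}
    {Z : ℕ → Ω → (Fin d → ℝ) × ℝ} (hZ : IsIIDSample μ Z)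
    (hY : Integrable (fun ω => (Z 0 ω).2) μ) :
    ∀ᵐ ω ∂μ, ∀ᶠ n in atTop, avg Z n (fun z => |z.2|) ω ≤ ∫ ω, |(Z 0 ω).2| ∂μ + 1 := by
  have hm : Measurable fun z : (Fin d → ℝ) × ℝ => |z.2| := measurable_snd.abs
  have := strong_law_ae_real (fun i ω => |(Z i ω).2|) hY.abs
    (fun i j hij => (hZ.indep.indepFun hij).comp hm hm) (fun i => (hZ.ident i).comp hm)
  filter_upwards [this] with ω hω
  filter_upwards [hω.eventually_lt_const (lt_add_one _)] with n hn
  rw [avg, ← div_eq_inv_mul]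
  exact hn.le

variable {Ω : Type*} [MeasurableSpace Ω] {μ : Measure Ω} [IsProbabilityMeasure μ] {d : ℕ}
  {Z : ℕ → Ω → (Fin d → ℝ) × ℝ} {b : ℕ → ℝ} {B ρ A F : ℝ} {g : (Fin d → ℝ) → ℝ}

/-- The square is at most `8 exp(|x| / 2)`, and the two half exponentials combine. -/
theorem sq_mul_exp_half_le {x T y : ℝ} (h : |x| ≤ |y| + T) :
    x ^ 2 * Real.exp (|x| / 2) ≤ 8 * Real.exp T * Real.exp |y| := by
  have h1 := Real.quadratic_le_exp_of_nonneg (x := |x| / 2) (by positivity)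
  have h2 : x ^ 2 ≤ 8 * Real.exp (|x| / 2) := by
    have : (|x| / 2) ^ 2 = x ^ 2 / 4 := by rw [div_pow, sq_abs]; norm_num
    rw [this] at h1
    linarith [abs_nonneg x]
  calc _ ≤ 8 * Real.exp (|x| / 2) * Real.exp (|x| / 2) := by gcongr
    _ = 8 * Real.exp |x| := by rw [mul_assoc, ← Real.exp_add, add_halves]
    _ ≤ 8 * Real.exp (|y| + T) := by gcongr
    _ = _ := by rw [Real.exp_add]; ring

/-- Uniform deviations of the kernel averages of the regression errors, under conditional
exponential moments. -/
theorem exists_ae_eventually_abs_avg_localize_mul_residual_le (hZ : IsIIDSample μ Z)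
    (hb : Bandwidths d b B)
    (hF : 0 ≤ F) (hP : μ.map (fun ω => (Z 0 ω).1) ≤ ENNReal.ofReal F • volume) (hρ : 0 ≤ ρ)
    (hg : IsBump ρ A g) {m : (Fin d → ℝ) → ℝ} (hm : Measurable m) {T : ℝ} (hT : ∀ x, |m x| ≤ T)
    (hY : Integrable (fun ω => (Z 0 ω).2) μ)
    (hmean : ∀ φ : (Fin d → ℝ) → ℝ, Measurable φ → (∃ a, ∀ x, |φ x| ≤ a) →
      ∫ ω, φ (Z 0 ω).1 * ((Z 0 ω).2 - m (Z 0 ω).1) ∂μ = 0)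
    (hexp : Integrable (fun ω => Real.exp |(Z 0 ω).2|) μ)
    (hexp2 : ∀ φ : (Fin d → ℝ) → ℝ, Measurable φ → (∃ a, ∀ x, |φ x| ≤ a) → (∀ x, 0 ≤ φ x) →
      ∫ ω, φ (Z 0 ω).1 * Real.exp |(Z 0 ω).2| ∂μ ≤ 2 * ∫ ω, φ (Z 0 ω).1 ∂μ) :
    ∃ C, 0 ≤ C ∧ ∀ᵐ ω ∂μ, ∀ᶠ n in atTop, ∀ w ∈ Set.Icc (0 : Fin d → ℝ) 1,
      |avg Z n (fun z => localize (b n) g w z.1 * (z.2 - m z.1)) ω| ≤ C * rate (b n ^ d) n := by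
  have hA := hg.nonneg_const
  have hT0 : 0 ≤ T := (abs_nonneg _).trans (hT 0)
  let G : ℕ → (Fin d → ℝ) → (Fin d → ℝ) × ℝ → ℝ := fun n w z =>
    localize (b n) g w z.1 * (z.2 - m z.1)
  have hGm : ∀ n w, Measurable (G n w) := fun n w =>
    ((hg.continuous_localize w).measurable.comp measurable_fst).mul
      (measurable_snd.sub (hm.comp measurable_fst))
  have hres : ∀ z : (Fin d → ℝ) × ℝ, |z.2 - m z.1| ≤ |z.2| + T := fun z =>
    (abs_sub _ _).trans (by linarith [hT z.1])
  have hresint : Integrable (fun ω => (Z 0 ω).2 - m (Z 0 ω).1) μ := by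
    refine hY.sub (Integrable.of_bound (hm.comp hZ.measurable_fst).aestronglyMeasurable T
      (ae_of_all _ fun ω => hT _))
  have hGint : ∀ n w, Integrable (fun ω => G n w (Z 0 ω)) μ := fun n w =>
    hresint.bdd_mul (c := A * (b n ^ d)⁻¹)
      ((hg.continuous_localize w).measurable.comp hZ.measurable_fst).aestronglyMeasurable
      (ae_of_all _ fun ω => hg.abs_localize_le (hb.pos n) _ _)
  obtain ⟨C, hC0, hC⟩ := exists_ae_eventually_abs_avg_le hZ.measurable hZ.indep hZ.ident
    (fun n => cubeGrid d (n ^ 3)) G (β := fun n => b n ^ d)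
    (fun n => pow_pos (hb.pos n) d) (4 * d) (eventually_card_cubeGrid_le d)
    (16 * Real.exp T * (A ^ 2 * F * (2 * ρ) ^ d))
    (by
      filter_upwards [hb.eventually_rate_le (ε := 1 / (2 * (A + 1))) (by positivity)]
        with n hn w _
      have hbp := hb.pos n
      have hbn := pow_pos (hb.pos n) d
      have hr := rate_nonneg (b n ^ d) n
      have hlm : Measurable (localize (b n) g w) := (hg.continuous_localize w).measurable
      have hsqb : ∀ x, |localize (b n) g w x ^ 2| ≤ (A * (b n ^ d)⁻¹) ^ 2 := fun x => by
        rw [abs_pow]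
        exact pow_le_pow_left₀ (abs_nonneg _) (hg.abs_localize_le hbp _ _) 2
      have hle : ∀ z, G n w z ^ 2 * Real.exp (b n ^ d * rate (b n ^ d) n * |G n w z|) ≤
          8 * Real.exp T * (localize (b n) g w z.1 ^ 2 * Real.exp |z.2|) := by
        intro z
        -- The small rate turns the kernel bound into the factor `1 / 2`, leaving half of the
        -- exponential moment to pay for the square.
        have h1 : b n ^ d * rate (b n ^ d) n * |G n w z| ≤ |z.2 - m z.1| / 2 := by
          calc _ ≤ b n ^ d * rate (b n ^ d) n * (A * (b n ^ d)⁻¹ * |z.2 - m z.1|) := by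
                simp only [G]
                rw [abs_mul]
                gcongr
                exact hg.abs_localize_le hbp _ _
            _ = rate (b n ^ d) n * A * |z.2 - m z.1| := by field_simp
            _ ≤ 1 / (2 * (A + 1)) * A * |z.2 - m z.1| := by gcongr
            _ ≤ 1 / 2 * |z.2 - m z.1| := by
                gcongr
                rw [div_mul_eq_mul_div, div_le_div_iff₀ (by positivity) (by positivity)]
                linarith
            _ = _ := by ring
        calc _ ≤ (localize (b n) g w z.1 * (z.2 - m z.1)) ^ 2 *
              Real.exp (|z.2 - m z.1| / 2) := by
              simp only [G] at h1 ⊢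
              gcongr
          _ = localize (b n) g w z.1 ^ 2 *
              ((z.2 - m z.1) ^ 2 * Real.exp (|z.2 - m z.1| / 2)) := by ring
          _ ≤ localize (b n) g w z.1 ^ 2 * (8 * Real.exp T * Real.exp |z.2|) := by
              exact mul_le_mul_of_nonneg_left (sq_mul_exp_half_le (hres z)) (sq_nonneg _)
          _ = _ := by ring
      have hdom : Integrable (fun ω => 8 * Real.exp T *
          (localize (b n) g w (Z 0 ω).1 ^ 2 * Real.exp |(Z 0 ω).2|)) μ := by
        refine Integrable.const_mul ?_ _
        refine hexp.bdd_mul (c := (A * (b n ^ d)⁻¹) ^ 2) ?_ (ae_of_all _ fun ω => hsqb _)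
        exact ((hlm.comp hZ.measurable_fst).pow_const 2).aestronglyMeasurable
      have hint : Integrable (fun ω => G n w (Z 0 ω) ^ 2 *
          Real.exp (b n ^ d * rate (b n ^ d) n * |G n w (Z 0 ω)|)) μ := by
        have := (hGm n w).comp (hZ.measurable 0)
        simp only [Function.comp_def] at this
        refine hdom.mono'
          ((this.pow_const 2).mul (this.abs.const_mul _).exp).aestronglyMeasurable (ae_of_all _ fun ω => ?_)
        rw [Real.norm_of_nonneg (by positivity)]
        exact hle _
      refine ⟨hGm n w, hGint n w, hmean _ hlm ⟨_, hg.abs_localize_le hbp w⟩, hint, ?_⟩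
      calc _ ≤ ∫ ω, 8 * Real.exp T *
            (localize (b n) g w (Z 0 ω).1 ^ 2 * Real.exp |(Z 0 ω).2|) ∂μ :=
            integral_mono hint hdom fun ω => hle _
        _ ≤ 8 * Real.exp T * (2 * ∫ ω, localize (b n) g w (Z 0 ω).1 ^ 2 ∂μ) := by
            rw [integral_const_mul]
            gcongr
            -- Conditioning on the covariates removes the exponential and keeps the kernel variance
            -- of order `b^{-d}`.
            exact hexp2 (fun x => localize (b n) g w x ^ 2) (hlm.pow_const 2) ⟨_, hsqb⟩
              fun x => sq_nonneg _
        _ ≤ 8 * Real.exp T * (2 * (A ^ 2 * F * (2 * ρ) ^ d * (b n ^ d)⁻¹)) := by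
            gcongr
            exact integral_sq_localize_le' hZ hF hP hρ hg hbp w
        _ = _ := by ring)
  set m₁ := ∫ ω, |(Z 0 ω).2| ∂μ + 1 with hm₁
  have hm₁0 : 0 ≤ m₁ := by
    have : 0 ≤ ∫ ω, |(Z 0 ω).2| ∂μ := integral_nonneg fun ω => abs_nonneg _
    linarith
  refine ⟨C + A * (m₁ + T) * (B ^ d + 1), ?_, ?_⟩
  · have := hb.bound_pos; positivity
  filter_upwards [hC, ae_eventually_avg_abs_snd_le hZ hY] with ω hω hω'
  filter_upwards [hω, hω', hb.eventually_inv_pow_le, hb.eventually_inv_le,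
    hb.eventually_inv_natCast_le, eventually_ge_atTop 1] with n h1 h1' h2 h3 h4 h5 w hw
  have hn : (0 : ℝ) < n := by exact_mod_cast h5
  have hbp := hb.pos n
  have hbn := pow_pos (hb.pos n) d
  obtain ⟨w', hw', hww'⟩ := exists_mem_cubeGrid (N := n ^ 3) (by positivity) hw
  have hclose : ∀ z, |G n w z - G n w' z| ≤ A * (n : ℝ)⁻¹ * (|z.2| + T) := by
    intro z
    simp only [G]
    rw [← sub_mul, abs_mul]
    calc _ ≤ (A * ((b n ^ d)⁻¹ * (b n)⁻¹) * ‖w - w'‖) * (|z.2| + T) := by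
          refine mul_le_mul (hg.abs_localize_sub_le (hb.pos n) _ _ _) (hres z) (abs_nonneg _) ?_
          positivity
      _ ≤ (A * (n * n) * ((n ^ 3 : ℕ) : ℝ)⁻¹) * (|z.2| + T) := by gcongr
      _ = _ := by push_cast; field_simp
  have hd1 : |avg Z n (G n w) ω - avg Z n (G n w') ω| ≤ A * (n : ℝ)⁻¹ * (m₁ + T) := by
    refine (abs_avg_sub_avg_le Z n hclose ω).trans ?_
    gcongr
    have : avg Z n (fun z => |z.2| + T) ω = avg Z n (fun z => |z.2|) ω + T := by
      simp only [avg, Finset.sum_add_distrib, Finset.sum_const, Finset.card_range, nsmul_eq_mul,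
        mul_add, inv_mul_cancel_left₀ hn.ne']
    rw [this]
    gcongr
  have hd3 := h1 w' hw'
  have h6 : A * (n : ℝ)⁻¹ * (m₁ + T) ≤ A * ((B ^ d + 1) * rate (b n ^ d) n) * (m₁ + T) := by
    gcongr
  change |avg Z n (G n w) ω| ≤ _
  rw [abs_le] at *
  constructor <;> nlinarith

end Subexponential

/-! ### The conditional law of the outcomes given all covariates -/

section CondLaw

variable {Ω : Type*} [MeasurableSpace Ω] {μ : Measure Ω} [IsProbabilityMeasure μ]

theorem integral_comp_mul_eq_integral_comp_mul_condExp {α : Type*} [mα : MeasurableSpace α]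
    {X : Ω → α} (hX : Measurable X) {V : Ω → ℝ} (hV : Integrable V μ) {φ : α → ℝ}
    (hφ : Measurable φ) {a : ℝ} (ha : ∀ x, |φ x| ≤ a) :
    ∫ ω, φ (X ω) * V ω ∂μ = ∫ ω, φ (X ω) * (μ[V | mα.comap X]) ω ∂μ := by
  have h1 : StronglyMeasurable[mα.comap X] fun ω => φ (X ω) :=
    (hφ.comp (comap_measurable X)).stronglyMeasurable
  have h2 : Integrable (fun ω => φ (X ω) * V ω) μ :=
    hV.bdd_mul (c := a) (hφ.comp hX).aestronglyMeasurable (ae_of_all _ fun ω => ha _)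
  have h3 := condExp_mul_of_stronglyMeasurable_left h1 h2 hV
  rw [← integral_condExp hX.comap_le (f := fun ω => φ (X ω) * V ω)]
  exact integral_congr_ae h3

theorem integral_eq_zero_of_indepFun {E₁ E₂ : Type*} [MeasurableSpace E₁] [MeasurableSpace E₂]
    {U : Ω → E₁} {V : Ω → E₂} (hU : Measurable U) (hV : Measurable V) (h : IndepFun U V μ)
    {G : E₁ × E₂ → ℝ} (hG : Measurable G) (hint : Integrable (fun ω => G (U ω, V ω)) μ)
    (h0 : ∀ v, ∫ ω, G (U ω, v) ∂μ = 0) : ∫ ω, G (U ω, V ω) ∂μ = 0 := by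
  have hUV : Measurable fun ω => (U ω, V ω) := hU.prodMk hV
  have hlaw := (indepFun_iff_map_prod_eq_prod_map_map hU.aemeasurable hV.aemeasurable).1 h
  have hint' : Integrable G ((μ.map U).prod (μ.map V)) := by
    rw [← hlaw, integrable_map_measure hG.aestronglyMeasurable hUV.aemeasurable]
    exact hint
  have : IsProbabilityMeasure (μ.map U) := Measure.isProbabilityMeasure_map hU.aemeasurable
  have : IsProbabilityMeasure (μ.map V) := Measure.isProbabilityMeasure_map hV.aemeasurable
  rw [← integral_map (φ := fun ω => (U ω, V ω)) (f := G) hUV.aemeasurable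
    hG.aestronglyMeasurable, hlaw, integral_prod_symm _ hint']
  refine integral_eq_zero_of_ae (ae_of_all _ fun v => ?_)
  simp only [Pi.zero_apply]
  have hGv : Measurable fun x => G (x, v) := hG.comp (by fun_prop)
  rw [integral_map hU.aemeasurable hGv.aestronglyMeasurable]
  exact h0 v

variable {d : ℕ} {X : ℕ → Ω → Fin d → ℝ} {Y : ℕ → Ω → ℝ}

theorem measurable_sample {E : Type*} [MeasurableSpace E] {Z : ℕ → Ω → E}
    (hZ : ∀ i, Measurable (Z i)) (n : ℕ) : Measurable (sample Z n) :=
  measurable_pi_lambda _ fun i => hZ i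

/-- With the other covariates frozen, which independence permits, the indicator is a bounded
function of `X i` alone, and `hmean` applies to it. -/
theorem integral_indicator_sample_mul_eq_zero (hZ : IsIIDSample μ fun i ω => (X i ω, Y i ω))
    {e : (Fin d → ℝ) × ℝ → ℝ} (he : Measurable e)
    (hint : Integrable (fun ω => e (X 0 ω, Y 0 ω)) μ)
    (hmean : ∀ φ : (Fin d → ℝ) → ℝ, Measurable φ → (∃ a, ∀ x, |φ x| ≤ a) →
      ∫ ω, φ (X 0 ω) * e (X 0 ω, Y 0 ω) ∂μ = 0) {n : ℕ} (i : Fin n)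
    {S : Set (Fin n → Fin d → ℝ)} (hS : MeasurableSet S) :
    ∫ ω, S.indicator (fun _ => (1 : ℝ)) (sample X n ω) * e (X i ω, Y i ω) ∂μ = 0 := by
  set Z : ℕ → Ω → (Fin d → ℝ) × ℝ := fun i ω => (X i ω, Y i ω) with hZdef
  set T : Finset ℕ := (Finset.range n).erase i with hT
  have hind := hZ.indep.indepFun_finset {(i : ℕ)} T
    (by rw [Finset.disjoint_singleton_left]; exact Finset.notMem_erase _ _) hZ.measurable
  have hU : Measurable fun v : ({(i : ℕ)} : Finset ℕ) → (Fin d → ℝ) × ℝ =>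
    v ⟨i, Finset.mem_singleton_self _⟩ := measurable_pi_apply _
  have hind' := hind.comp hU measurable_id
  -- `a` reassembles the covariate vector from the `i`-th pair and the remaining pairs.
  set a : ((Fin d → ℝ) × ℝ) × (T → (Fin d → ℝ) × ℝ) → Fin n → Fin d → ℝ := fun q k =>
    if h : k = i then q.1.1 else (q.2 ⟨k, Finset.mem_erase.2
      ⟨fun h' => h (Fin.ext h'), Finset.mem_range.2 k.2⟩⟩).1 with ha
  have ham : Measurable a := by
    refine measurable_pi_lambda _ fun k => ?_
    by_cases h : k = i
    · simp only [ha, h, dif_pos]; fun_prop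
    · simp only [ha, dif_neg h]; fun_prop
  have hind1 : Measurable (S.indicator fun _ => (1 : ℝ)) := measurable_const.indicator hS
  have hb1 : ∀ v, |S.indicator (fun _ => (1 : ℝ)) v| ≤ 1 := fun v => by
    by_cases h : v ∈ S <;> simp [h]
  have hei : Integrable (fun ω => e (Z i ω)) μ :=
    ((hZ.ident i).comp he).integrable_iff.2 hint
  have hsample : ∀ ω, a (Z i ω, fun j : T => Z j ω) = sample X n ω := by
    intro ω
    funext k
    by_cases h : k = i
    · simp [ha, h, sample, hZdef]
    · simp [ha, h, sample, hZdef]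
  have hGm : Measurable fun q : ((Fin d → ℝ) × ℝ) × (T → (Fin d → ℝ) × ℝ) =>
      S.indicator (fun _ => (1 : ℝ)) (a q) * e q.1 :=
    (hind1.comp ham).mul (he.comp measurable_fst)
  have key := integral_eq_zero_of_indepFun (U := Z i) (V := fun ω (j : T) => Z j ω)
    (hZ.measurable i) (measurable_pi_lambda _ fun j => hZ.measurable j) hind' hGm
    (hei.bdd_mul (c := 1) ((hind1.comp ham).comp ((hZ.measurable i).prodMk
      (measurable_pi_lambda _ fun j => hZ.measurable j))).aestronglyMeasurable
      (ae_of_all _ fun ω => hb1 _))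
    (fun v => by
      have hφ : Measurable fun x : Fin d → ℝ => S.indicator (fun _ => (1 : ℝ)) (a ((x, 0), v)) :=
        (hind1.comp ham).comp (by fun_prop)
      have h1 := hmean _ hφ ⟨1, fun x => hb1 _⟩
      have h2 : Measurable fun z : (Fin d → ℝ) × ℝ =>
          S.indicator (fun _ => (1 : ℝ)) (a ((z.1, 0), v)) * e z :=
        (hφ.comp measurable_fst).mul he
      exact (((hZ.ident i).comp h2).integral_eq).trans h1)
  simp only [hsample] at key
  exact key

/-- The conditional law of the outcomes given all covariates has the regression function as the
mean of each coordinate. -/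
theorem ae_integral_condLaw_eq (hX : ∀ i, Measurable (X i)) (hY : ∀ i, Measurable (Y i))
    (hZ : IsIIDSample μ fun i ω => (X i ω, Y i ω)) {r : ℝ → ℝ} (hr : Measurable r)
    (hrint : Integrable (fun ω => r (Y 0 ω)) μ) {m : (Fin d → ℝ) → ℝ} (hm : Measurable m)
    (hmint : Integrable (fun ω => m (X 0 ω)) μ)
    (hmean : ∀ φ : (Fin d → ℝ) → ℝ, Measurable φ → (∃ a, ∀ x, |φ x| ≤ a) →
      ∫ ω, φ (X 0 ω) * (r (Y 0 ω) - m (X 0 ω)) ∂μ = 0) (n : ℕ) (i : Fin n) :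
    ∀ᵐ ω ∂μ, Integrable (fun y : Fin n → ℝ => r (y i)) (condLaw μ X Y n ω) ∧
      ∫ y, r (y i) ∂(condLaw μ X Y n ω) = m (X i ω) := by
  have hXn := measurable_sample hX n
  have hYn := measurable_sample hY n
  have hri : Integrable (fun ω => r (Y i ω)) μ :=
    ((hZ.ident i).comp (hr.comp measurable_snd)).integrable_iff.2 hrint
  have hmi : Integrable (fun ω => m (X i ω)) μ :=
    ((hZ.ident i).comp (hm.comp measurable_fst)).integrable_iff.2 hmint
  have hrm : Measurable fun y : Fin n → ℝ => r (y i) := hr.comp (measurable_pi_apply i)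
  have h1 := condExp_ae_eq_integral_condDistrib (μ := μ) hXn hYn.aemeasurable
    hrm.stronglyMeasurable hri
  have hci : ∀ᵐ ω ∂μ, Integrable (fun y : Fin n → ℝ => r (y i))
      (condDistrib (sample Y n) (sample X n) μ (sample X n ω)) := by
    refine Integrable.condDistrib_ae (f := fun q : (Fin n → Fin d → ℝ) × (Fin n → ℝ) =>
      r (q.2 i)) hXn.aemeasurable hYn.aemeasurable ?_
    have hq : Measurable fun q : (Fin n → Fin d → ℝ) × (Fin n → ℝ) => r (q.2 i) :=
      hrm.comp measurable_snd
    rw [integrable_map_measure hq.aestronglyMeasurable (hXn.prodMk hYn).aemeasurable]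
    exact hri
  have h2 : (fun ω => m (X i ω)) =ᵐ[μ]
      μ[fun ω => r (Y i ω) | MeasurableSpace.comap (sample X n) inferInstance] := by
    refine ae_eq_condExp_of_forall_setIntegral_eq hXn.comap_le hri
      (fun _ _ _ => hmi.integrableOn) ?_ ?_
    · rintro _ ⟨S, hS, rfl⟩ _
      have h3 := integral_indicator_sample_mul_eq_zero hZ (e := fun z => r z.2 - m z.1)
        ((hr.comp measurable_snd).sub (hm.comp measurable_fst)) (hrint.sub hmint) hmean i hS
      have h4 : ∫ ω in sample X n ⁻¹' S, (r (Y i ω) - m (X i ω)) ∂μ = 0 := by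
        rw [← h3, ← integral_indicator (hXn hS)]
        refine integral_congr_ae (ae_of_all _ fun ω => ?_)
        by_cases h : sample X n ω ∈ S
        · simp [h, Set.indicator]
        · simp [h, Set.indicator]
      rw [integral_sub hri.integrableOn hmi.integrableOn] at h4
      linarith
    · refine (StronglyMeasurable.aestronglyMeasurable ?_)
      have : Measurable[MeasurableSpace.comap (sample X n) inferInstance] fun ω => X i ω :=
        (measurable_pi_apply i).comp (comap_measurable (sample X n))
      exact (hm.comp this).stronglyMeasurable
  filter_upwards [h1, h2, hci] with ω a1 a2 a3
  exact ⟨a3, by rw [a2]; exact a1.symm⟩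

theorem tendsto_integral_indicator_Iic {E : Type*} [MeasurableSpace E] (κ : Measure E)
    [IsFiniteMeasure κ] {V : E → ℝ} (hV : Measurable V) {q : ℕ → ℝ} {t : ℝ}
    (hqt : ∀ k, t ≤ q k) (hq : Tendsto q atTop (𝓝 t)) :
    Tendsto (fun k => ∫ z, (Set.Iic (q k)).indicator (fun _ => (1 : ℝ)) (V z) ∂κ) atTop
      (𝓝 (∫ z, (Set.Iic t).indicator (fun _ => (1 : ℝ)) (V z) ∂κ)) := by
  refine tendsto_integral_of_dominated_convergence (fun _ => 1)
    (fun k => ((measurable_const.indicator measurableSet_Iic).comp hV).aestronglyMeasurable)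
    (integrable_const _) (fun k => ae_of_all _ fun z => ?_) (ae_of_all _ fun z => ?_)
  · by_cases h : V z ≤ q k <;> simp [Set.indicator, h]
  · rcases le_or_gt (V z) t with h | h
    · refine tendsto_const_nhds.congr fun k => ?_
      simp [Set.indicator, h, h.trans (hqt k)]
    · refine tendsto_const_nhds.congr' ?_
      filter_upwards [hq.eventually_lt_const h] with k hk
      simp [Set.indicator, not_le.2 h, not_le.2 hk]

end CondLaw

/-! ### The regression model and the regression functions of the indicators -/

section Regression

/-- The indicator function of `(-∞, t]`. -/
noncomputable def cutoff (t : ℝ) : ℝ → ℝ := (Set.Iic t).indicator fun _ => (1 : ℝ)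

theorem cutoff_mem (t : ℝ) : cutoff t ∈ R₁ ∪ R₂ := Or.inr ⟨t, rfl⟩

theorem id_mem : id ∈ R₁ ∪ R₂ := Or.inl rfl

theorem measurable_cutoff (t : ℝ) : Measurable (cutoff t) :=
  measurable_const.indicator measurableSet_Iic

theorem cutoff_nonneg (t y : ℝ) : 0 ≤ cutoff t y := Set.indicator_nonneg (fun _ _ => zero_le_one) y

theorem cutoff_le_one (t y : ℝ) : cutoff t y ≤ 1 :=
  Set.indicator_le_self' (fun _ _ => zero_le_one) y

theorem monotone_cutoff (y : ℝ) : Monotone fun t => cutoff t y := fun _ _ hst =>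
  Set.indicator_le_indicator_of_subset (Set.Iic_subset_Iic.2 hst) (fun _ => zero_le_one) y

theorem measurable_of_mem {r : ℝ → ℝ} (hr : r ∈ R₁ ∪ R₂) : Measurable r := by
  rcases hr with rfl | ⟨t, rfl⟩
  · exact measurable_id
  · exact measurable_cutoff t

/-- An i.i.d. sample whose covariates have a density between `f₀` and `f₁` on the unit cube, and
regression functions with derivatives of order `p + 1` bounded by `M`. -/
structure RegressionModel {Ω : Type*} [MeasurableSpace Ω] (μ : Measure Ω) {d : ℕ} (p : ℕ)
    (X : ℕ → Ω → Fin d → ℝ) (Y : ℕ → Ω → ℝ) (θ : (Fin d → ℝ) → (ℝ → ℝ) → ℝ) (f₀ f₁ M : ℝ) :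
    Prop where
  measurable_X : ∀ i, Measurable (X i)
  measurable_Y : ∀ i, Measurable (Y i)
  iid : IsIIDSample μ fun i ω => (X i ω, Y i ω)
  integrable_Y : Integrable (Y 0) μ
  lower_pos : 0 < f₀
  upper_nonneg : 0 ≤ f₁
  lower : ENNReal.ofReal f₀ • volume.restrict (Set.Icc (0 : Fin d → ℝ) 1) ≤ μ.map (X 0)
  upper : μ.map (X 0) ≤ ENNReal.ofReal f₁ • volume
  cube : ∀ᵐ x ∂μ.map (X 0), x ∈ Set.Icc (0 : Fin d → ℝ) 1
  regression : ∀ r ∈ R₁ ∪ R₂, (fun ω => θ (X 0 ω) r) =ᵐ[μ]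
    μ[fun ω => r (Y 0 ω) | MeasurableSpace.comap (X 0) inferInstance]
  smooth : ∀ r ∈ R₁ ∪ R₂,
    ContDiffOn ℝ ((p + 1 : ℕ) : WithTop ℕ∞) (fun w => θ w r) (Set.Icc 0 1)
  bound : ∀ r ∈ R₁ ∪ R₂, ∀ w ∈ Set.Icc (0 : Fin d → ℝ) 1,
    ‖iteratedFDerivWithin ℝ (p + 1) (fun w => θ w r) (Set.Icc 0 1) w‖ ≤ M

/-- The regression function, extended by zero off the unit cube. -/
noncomputable def cubeTheta {d : ℕ} (θ : (Fin d → ℝ) → (ℝ → ℝ) → ℝ) (r : ℝ → ℝ) :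
    (Fin d → ℝ) → ℝ := (Set.Icc 0 1).indicator fun x => θ x r

theorem cubeTheta_of_mem {d : ℕ} (θ : (Fin d → ℝ) → (ℝ → ℝ) → ℝ) (r : ℝ → ℝ) {x : Fin d → ℝ}
    (hx : x ∈ Set.Icc (0 : Fin d → ℝ) 1) : cubeTheta θ r x = θ x r := Set.indicator_of_mem hx _

namespace RegressionModel

variable {Ω : Type*} [MeasurableSpace Ω] {μ : Measure Ω} {d p : ℕ}
  {X : ℕ → Ω → Fin d → ℝ} {Y : ℕ → Ω → ℝ} {θ : (Fin d → ℝ) → (ℝ → ℝ) → ℝ} {f₀ f₁ M : ℝ}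

theorem ae_mem_cube (D : RegressionModel μ p X Y θ f₀ f₁ M) :
    ∀ᵐ ω ∂μ, ∀ i, X i ω ∈ Set.Icc (0 : Fin d → ℝ) 1 := by
  refine ae_all_iff.2 fun i => ?_
  have h0 : ∀ᵐ ω ∂μ, (X 0 ω, Y 0 ω) ∈ (Prod.fst ⁻¹' Set.Icc (0 : Fin d → ℝ) 1 : Set (_ × ℝ)) :=
    ae_of_ae_map (D.measurable_X 0).aemeasurable D.cube
  exact (D.iid.ident i).symm.ae_mem_snd (measurable_fst measurableSet_Icc) h0

theorem measurable_cubeTheta (D : RegressionModel μ p X Y θ f₀ f₁ M) {r : ℝ → ℝ}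
    (hr : r ∈ R₁ ∪ R₂) : Measurable (cubeTheta θ r) := by
  classical
  rw [cubeTheta, ← Set.piecewise_eq_indicator]
  exact (D.smooth r hr).continuousOn.measurable_piecewise continuousOn_const measurableSet_Icc

theorem exists_abs_cubeTheta_le (D : RegressionModel μ p X Y θ f₀ f₁ M) {r : ℝ → ℝ}
    (hr : r ∈ R₁ ∪ R₂) : ∃ T, ∀ x, |cubeTheta θ r x| ≤ T := by
  obtain ⟨T, hT⟩ := isCompact_Icc.exists_bound_of_continuousOn (D.smooth r hr).continuousOn
  refine ⟨max T 0, fun x => ?_⟩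
  by_cases hx : x ∈ Set.Icc (0 : Fin d → ℝ) 1
  · rw [cubeTheta_of_mem θ r hx]; exact (hT x hx).trans (le_max_left _ _)
  · rw [cubeTheta, Set.indicator_of_notMem hx, abs_zero]; exact le_max_right _ _

theorem cubeTheta_ae_eq (D : RegressionModel μ p X Y θ f₀ f₁ M) {r : ℝ → ℝ} (hr : r ∈ R₁ ∪ R₂) :
    (fun ω => cubeTheta θ r (X 0 ω)) =ᵐ[μ]
      μ[fun ω => r (Y 0 ω) | MeasurableSpace.comap (X 0) inferInstance] := by
  filter_upwards [D.regression r hr, D.ae_mem_cube] with ω h1 h2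
  rw [cubeTheta_of_mem θ r (h2 0)]
  exact h1

/-- As the density is bounded below, Lebesgue null sets of the cube are controlled by null sets of
the law; continuity of `min u v` and `u` then gives every point. -/
theorem le_of_ae_le (D : RegressionModel μ p X Y θ f₀ f₁ M) {u v : (Fin d → ℝ) → ℝ}
    (hu : ContinuousOn u (Set.Icc 0 1)) (hv : ContinuousOn v (Set.Icc 0 1))
    (h : ∀ᵐ x ∂μ.map (X 0), u x ≤ v x) : ∀ x ∈ Set.Icc (0 : Fin d → ℝ) 1, u x ≤ v x := by
  have hac : volume.restrict (Set.Icc (0 : Fin d → ℝ) 1) ≪ μ.map (X 0) := by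
    intro s hs
    have h1 := (D.lower s).trans_eq hs
    rw [Measure.smul_apply, smul_eq_mul, nonpos_iff_eq_zero, mul_eq_zero] at h1
    exact h1.resolve_left (by simpa using D.lower_pos)
  have h1 : (fun x => min (u x) (v x)) =ᵐ[volume.restrict (Set.Icc (0 : Fin d → ℝ) 1)] u := by
    filter_upwards [hac.ae_le h] with x hx using min_eq_left hx
  have h2 := Measure.eqOn_of_ae_eq h1 (fun x hx => (hu x hx).inf (hv x hx)) hu
    (subset_closure_interior_Icc fun i => zero_lt_one)
  intro x hx
  rw [← h2 hx]
  exact min_le_right _ _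

variable [IsProbabilityMeasure μ]

theorem isProbabilityMeasure_map (D : RegressionModel μ p X Y θ f₀ f₁ M) :
    IsProbabilityMeasure (μ.map (X 0)) :=
  Measure.isProbabilityMeasure_map (D.measurable_X 0).aemeasurable

theorem integrable_comp (D : RegressionModel μ p X Y θ f₀ f₁ M) {r : ℝ → ℝ} (hr : r ∈ R₁ ∪ R₂) :
    Integrable (fun ω => r (Y 0 ω)) μ := by
  rcases hr with rfl | ⟨t, rfl⟩
  · exact D.integrable_Y
  · refine Integrable.of_bound ((measurable_cutoff t).comp (D.measurable_Y 0)).aestronglyMeasurable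
      1 (ae_of_all _ fun ω => ?_)
    exact (Real.norm_of_nonneg (cutoff_nonneg t _)).trans_le (cutoff_le_one t _)

theorem integrable_cubeTheta (D : RegressionModel μ p X Y θ f₀ f₁ M) {r : ℝ → ℝ}
    (hr : r ∈ R₁ ∪ R₂) : Integrable (fun ω => cubeTheta θ r (X 0 ω)) μ := by
  obtain ⟨T, hT⟩ := D.exists_abs_cubeTheta_le hr
  exact Integrable.of_bound
    ((D.measurable_cubeTheta hr).comp (D.measurable_X 0)).aestronglyMeasurable T
    (ae_of_all _ fun ω => hT _)

theorem integral_mul_eq (D : RegressionModel μ p X Y θ f₀ f₁ M) {r : ℝ → ℝ} (hr : r ∈ R₁ ∪ R₂)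
    {φ : (Fin d → ℝ) → ℝ} (hφ : Measurable φ) (ha : ∃ a, ∀ x, |φ x| ≤ a) :
    ∫ ω, φ (X 0 ω) * r (Y 0 ω) ∂μ = ∫ ω, φ (X 0 ω) * cubeTheta θ r (X 0 ω) ∂μ := by
  obtain ⟨a, ha⟩ := ha
  rw [integral_comp_mul_eq_integral_comp_mul_condExp (D.measurable_X 0) (D.integrable_comp hr)
    hφ ha]
  refine integral_congr_ae ?_
  filter_upwards [D.cubeTheta_ae_eq hr] with ω h
  rw [h]

theorem integral_mul_residual (D : RegressionModel μ p X Y θ f₀ f₁ M) {r : ℝ → ℝ}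
    (hr : r ∈ R₁ ∪ R₂) (φ : (Fin d → ℝ) → ℝ) (hφ : Measurable φ) (ha : ∃ a, ∀ x, |φ x| ≤ a) :
    ∫ ω, φ (X 0 ω) * (r (Y 0 ω) - cubeTheta θ r (X 0 ω)) ∂μ = 0 := by
  have h1 := D.integral_mul_eq hr hφ ha
  obtain ⟨a, ha⟩ := ha
  have hφm : AEStronglyMeasurable (fun ω => φ (X 0 ω)) μ :=
    (hφ.comp (D.measurable_X 0)).aestronglyMeasurable
  simp only [mul_sub]
  rw [integral_sub ((D.integrable_comp hr).bdd_mul (c := a) hφm (ae_of_all _ fun ω => ha _))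
    ((D.integrable_cubeTheta hr).bdd_mul (c := a) hφm (ae_of_all _ fun ω => ha _)), h1, sub_self]

/-- Monotonicity of the regression functions, from monotonicity of the responses. -/
theorem theta_le (D : RegressionModel μ p X Y θ f₀ f₁ M) {r r' : ℝ → ℝ} (hr : r ∈ R₁ ∪ R₂)
    (hr' : r' ∈ R₁ ∪ R₂) (h : ∀ y, r y ≤ r' y) :
    ∀ x ∈ Set.Icc (0 : Fin d → ℝ) 1, θ x r ≤ θ x r' := by
  refine D.le_of_ae_le (D.smooth r hr).continuousOn (D.smooth r' hr').continuousOn ?_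
  have h1 : ∀ᵐ ω ∂μ, cubeTheta θ r (X 0 ω) ≤ cubeTheta θ r' (X 0 ω) := by
    filter_upwards [D.cubeTheta_ae_eq hr, D.cubeTheta_ae_eq hr',
      condExp_mono (m := MeasurableSpace.comap (X 0) inferInstance) (D.integrable_comp hr)
        (D.integrable_comp hr') (ae_of_all _ fun ω => h (Y 0 ω))] with ω a1 a2 a3
    rw [a1, a2]
    exact a3
  have h2 : ∀ᵐ x ∂μ.map (X 0), cubeTheta θ r x ≤ cubeTheta θ r' x :=
    (ae_map_iff (D.measurable_X 0).aemeasurable (measurableSet_le (D.measurable_cubeTheta hr)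
      (D.measurable_cubeTheta hr'))).2 h1
  filter_upwards [h2, D.cube] with x hx hc
  rwa [cubeTheta_of_mem θ r hc, cubeTheta_of_mem θ r' hc] at hx

theorem theta_cutoff_mem_Icc (D : RegressionModel μ p X Y θ f₀ f₁ M) (t : ℝ) {x : Fin d → ℝ}
    (hx : x ∈ Set.Icc (0 : Fin d → ℝ) 1) : 0 ≤ θ x (cutoff t) ∧ θ x (cutoff t) ≤ 1 := by
  have hr := cutoff_mem t
  have h1 : ∀ᵐ ω ∂μ, 0 ≤ cubeTheta θ (cutoff t) (X 0 ω) ∧ cubeTheta θ (cutoff t) (X 0 ω) ≤ 1 := by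
    filter_upwards [D.cubeTheta_ae_eq hr,
      condExp_nonneg (μ := μ) (m := MeasurableSpace.comap (X 0) inferInstance)
        (f := fun ω => cutoff t (Y 0 ω)) (ae_of_all _ fun ω => cutoff_nonneg t _),
      condExp_mono (μ := μ) (m := MeasurableSpace.comap (X 0) inferInstance)
        (D.integrable_comp hr) (integrable_const (1 : ℝ))
        (ae_of_all _ fun ω => cutoff_le_one t (Y 0 ω))] with ω a1 a2 a3
    rw [condExp_const (D.measurable_X 0).comap_le] at a3
    rw [a1]
    exact ⟨a2, a3⟩
  have hm := D.measurable_cubeTheta hr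
  have h2 : ∀ᵐ x ∂μ.map (X 0), 0 ≤ cubeTheta θ (cutoff t) x ∧ cubeTheta θ (cutoff t) x ≤ 1 :=
    (ae_map_iff (D.measurable_X 0).aemeasurable ((measurableSet_le measurable_const hm).inter
      (measurableSet_le hm measurable_const))).2 h1
  have hc := (D.smooth _ hr).continuousOn
  constructor
  · refine D.le_of_ae_le continuousOn_const hc ?_ x hx
    filter_upwards [h2, D.cube] with x hx hc
    rw [cubeTheta_of_mem θ _ hc] at hx
    exact hx.1
  · refine D.le_of_ae_le hc continuousOn_const ?_ x hx
    filter_upwards [h2, D.cube] with x hx hc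
    rw [cubeTheta_of_mem θ _ hc] at hx
    exact hx.2

theorem cubeTheta_cutoff_nonneg (D : RegressionModel μ p X Y θ f₀ f₁ M) (t : ℝ) (x : Fin d → ℝ) :
    0 ≤ cubeTheta θ (cutoff t) x :=
  Set.indicator_nonneg (fun _ hx => (D.theta_cutoff_mem_Icc t hx).1) x

theorem cubeTheta_cutoff_le_one (D : RegressionModel μ p X Y θ f₀ f₁ M) (t : ℝ) (x : Fin d → ℝ) :
    cubeTheta θ (cutoff t) x ≤ 1 :=
  Set.indicator_apply_le' (fun hx => (D.theta_cutoff_mem_Icc t hx).2) fun _ => zero_le_one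

theorem monotone_cubeTheta_cutoff (D : RegressionModel μ p X Y θ f₀ f₁ M) (x : Fin d → ℝ) :
    Monotone fun t => cubeTheta θ (cutoff t) x := by
  intro s t hst
  by_cases hx : x ∈ Set.Icc (0 : Fin d → ℝ) 1
  · simp only [cubeTheta_of_mem θ _ hx]
    exact D.theta_le (cutoff_mem s) (cutoff_mem t) (fun y => monotone_cutoff y hst) x hx
  · simp [cubeTheta, Set.indicator_of_notMem hx]

end RegressionModel

end Regression

/-! ### Right continuity in the cutoff and simultaneous conditional means -/

section Deviations

variable {Ω : Type*} [MeasurableSpace Ω] {μ : Measure Ω} [IsProbabilityMeasure μ] {d p : ℕ}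
  {X : ℕ → Ω → Fin d → ℝ} {Y : ℕ → Ω → ℝ} {θ : (Fin d → ℝ) → (ℝ → ℝ) → ℝ} {f₀ f₁ M : ℝ}
  {K : (Fin d → ℝ) → ℝ} {b : ℕ → ℝ} {B ρ A : ℝ}

/-- Both values are approximated by population fits with the auxiliary bandwidth `β`, at the cost of
two biases. The fits differ by kernel moments of a nonnegative function whose mean is the increment
of the distribution function of the outcome. -/
theorem RegressionModel.theta_cutoff_sub_le (D : RegressionModel μ p X Y θ f₀ f₁ M) (hρ : 1 ≤ ρ)
    (hK : ∀ ν ν', IsBump ρ A (kernelMonomial K p ν ν')) {c β : ℝ} (hβ : 0 < β) (hc : 0 < c)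
    {x : Fin d → ℝ} (hx : x ∈ Set.Icc (0 : Fin d → ℝ) 1)
    (hH : Coercive c (gram K p β (μ.map (X 0)) x))
    {s t : ℝ} (hst : s ≤ t) :
    θ x (cutoff t) - θ x (cutoff s) ≤
      2 * (Fintype.card (MultiIdx d p) / c * (M * (ρ * β) ^ (p + 1) * (A * f₁ * (2 * ρ) ^ d))) +
      Fintype.card (MultiIdx d p) / c * (A * (β ^ d)⁻¹ *
        (∫ ω, cutoff t (Y 0 ω) ∂μ - ∫ ω, cutoff s (Y 0 ω) ∂μ)) := by
  have hP := D.isProbabilityMeasure_map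
  have hA := (hK (MultiIdx.zero d p) (MultiIdx.zero d p)).nonneg_const
  have e1 := abs_inv_gram_mulVec_integral_sub_le hβ hρ hK (D.smooth _ (cutoff_mem s))
    (D.bound _ (cutoff_mem s)) hx D.upper_nonneg D.upper D.cube hc hH
  have e2 := abs_inv_gram_mulVec_integral_sub_le hβ hρ hK (D.smooth _ (cutoff_mem t))
    (D.bound _ (cutoff_mem t)) hx D.upper_nonneg D.upper D.cube hc hH
  set v : ℝ → MultiIdx d p → ℝ := fun t ν =>
    ∫ x', localize β (kernelMonomial K p ν (MultiIdx.zero d p)) x x' * θ x' (cutoff t) ∂μ.map (X 0)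
    with hv
  have hmap : ∀ t, ∫ ω, cubeTheta θ (cutoff t) (X 0 ω) ∂μ = ∫ ω, cutoff t (Y 0 ω) ∂μ := by
    intro t
    have := D.integral_mul_eq (cutoff_mem t) (φ := fun _ => 1) measurable_const ⟨1, by simp⟩
    simpa using this.symm
  have hint : ∀ t, Integrable (cubeTheta θ (cutoff t)) (μ.map (X 0)) := fun t =>
    (integrable_map_measure (D.measurable_cubeTheta (cutoff_mem t)).aestronglyMeasurable
      (D.measurable_X 0).aemeasurable).2 (D.integrable_cubeTheta (cutoff_mem t))
  have hvt : ∀ t ν, v t ν = ∫ x', localize β (kernelMonomial K p ν (MultiIdx.zero d p)) x x' *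
      cubeTheta θ (cutoff t) x' ∂μ.map (X 0) := by
    intro t ν
    refine integral_congr_ae ?_
    filter_upwards [D.cube] with x' hx'
    rw [cubeTheta_of_mem θ _ hx']
  have hdiff : ‖v t - v s‖ ≤ A * (β ^ d)⁻¹ *
      (∫ ω, cutoff t (Y 0 ω) ∂μ - ∫ ω, cutoff s (Y 0 ω) ∂μ) := by
    have hnn : 0 ≤ ∫ ω, cutoff t (Y 0 ω) ∂μ - ∫ ω, cutoff s (Y 0 ω) ∂μ :=
      sub_nonneg.2 (integral_mono (D.integrable_comp (cutoff_mem s))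
        (D.integrable_comp (cutoff_mem t)) fun ω => monotone_cutoff _ hst)
    refine (pi_norm_le_iff_of_nonneg (by positivity)).2 fun ν => ?_
    have hg := hK ν (MultiIdx.zero d p)
    have hi : ∀ t, Integrable (fun x' => localize β (kernelMonomial K p ν (MultiIdx.zero d p)) x x' *
        cubeTheta θ (cutoff t) x') (μ.map (X 0)) := fun t =>
      (hint t).bdd_mul (c := A * (β ^ d)⁻¹) (hg.continuous_localize x).aestronglyMeasurable
        (ae_of_all _ fun x' => hg.abs_localize_le hβ _ _)
    rw [Pi.sub_apply, hvt, hvt, ← integral_sub (hi t) (hi s)]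
    calc _ ≤ ∫ x', A * (β ^ d)⁻¹ * (cubeTheta θ (cutoff t) x' - cubeTheta θ (cutoff s) x')
          ∂μ.map (X 0) := by
          refine norm_integral_le_of_norm_le (((hint t).sub (hint s)).const_mul _)
            (ae_of_all _ fun x' => ?_)
          have h0 := sub_nonneg.2 (D.monotone_cubeTheta_cutoff x' hst)
          rw [← mul_sub, Real.norm_eq_abs, abs_mul, abs_of_nonneg h0]
          exact mul_le_mul_of_nonneg_right (hg.abs_localize_le hβ _ _) h0
      _ = _ := by
          rw [integral_const_mul, integral_sub (hint t) (hint s), ← hmap, ← hmap,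
            integral_map (D.measurable_X 0).aemeasurable
              (D.measurable_cubeTheta (cutoff_mem t)).aestronglyMeasurable,
            integral_map (D.measurable_X 0).aemeasurable
              (D.measurable_cubeTheta (cutoff_mem s)).aestronglyMeasurable]
  have e3 : |(gram K p β (μ.map (X 0)) x)⁻¹.mulVec (v t) (MultiIdx.zero d p) -
      (gram K p β (μ.map (X 0)) x)⁻¹.mulVec (v s) (MultiIdx.zero d p)| ≤
      Fintype.card (MultiIdx d p) / c * (A * (β ^ d)⁻¹ *
        (∫ ω, cutoff t (Y 0 ω) ∂μ - ∫ ω, cutoff s (Y 0 ω) ∂μ)) := by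
    rw [← Pi.sub_apply, ← Matrix.mulVec_sub]
    refine (norm_le_pi_norm (((gram K p β (μ.map (X 0)) x)⁻¹).mulVec (v t - v s)) _).trans ?_
    exact (hH.norm_inv_mulVec_le hc _).trans (by gcongr)
  rw [abs_le] at e1 e2 e3
  linarith [e1.1, e1.2, e2.1, e2.2, e3.1, e3.2]

/-- For every point of the cube, the regression functions of the indicators are continuous from
the right in the cutoff. -/
theorem RegressionModel.tendsto_theta_cutoff (D : RegressionModel μ p X Y θ f₀ f₁ M) (hρ : 1 ≤ ρ)
    (hK : ∀ ν ν', IsBump ρ A (kernelMonomial K p ν ν')) {c : ℝ} (hB : 0 < B) (hc : 0 < c)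
    (hH : ∀ β, 0 < β → β ≤ B → ∀ w ∈ Set.Icc (0 : Fin d → ℝ) 1,
      Coercive c (gram K p β (μ.map (X 0)) w))
    {x : Fin d → ℝ} (hx : x ∈ Set.Icc (0 : Fin d → ℝ) 1) {q : ℕ → ℝ} {t : ℝ}
    (hqt : ∀ k, t ≤ q k) (hq : Tendsto q atTop (𝓝 t)) :
    Tendsto (fun k => θ x (cutoff (q k))) atTop (𝓝 (θ x (cutoff t))) := by
  have hG := tendsto_integral_indicator_Iic μ (D.measurable_Y 0) hqt hq
  set N : ℝ := Fintype.card (MultiIdx d p) / c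
  set e : ℝ → ℝ := fun β => 2 * (N * (M * (ρ * β) ^ (p + 1) * (A * f₁ * (2 * ρ) ^ d)))
  have he : Tendsto e (𝓝 0) (𝓝 0) := by
    have : Continuous e := by fun_prop
    have h := this.tendsto 0
    simpa [e] using h
  rw [Metric.tendsto_atTop']
  intro ε hε
  -- `β` is fixed first to make the bias small; only then does the index `k` grow, so the factor
  -- `β^{-d}` is harmless.
  obtain ⟨β, hβ0, hβB, hβ⟩ : ∃ β, 0 < β ∧ β ≤ B ∧ e β < ε / 2 := by
    have h1 : ∀ᶠ β in 𝓝[>] (0 : ℝ), e β < ε / 2 :=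
      (he.mono_left nhdsWithin_le_nhds).eventually_lt_const (half_pos hε)
    have h2 : ∀ᶠ β in 𝓝[>] (0 : ℝ), β ≤ B :=
      nhdsWithin_le_nhds (eventually_le_nhds hB)
    obtain ⟨β, h⟩ := (h1.and (h2.and self_mem_nhdsWithin)).exists
    exact ⟨β, h.2.2, h.2.1, h.1⟩
  have h3 : Tendsto (fun k => N * (A * (β ^ d)⁻¹ * (∫ ω, cutoff (q k) (Y 0 ω) ∂μ -
      ∫ ω, cutoff t (Y 0 ω) ∂μ))) atTop (𝓝 0) := by
    have h4 := ((hG.sub_const (∫ ω, cutoff t (Y 0 ω) ∂μ)).const_mul (A * (β ^ d)⁻¹)).const_mul N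
    have h5 : N * (A * (β ^ d)⁻¹ * (∫ ω, (Set.Iic t).indicator (fun _ => (1 : ℝ)) (Y 0 ω) ∂μ -
      ∫ ω, cutoff t (Y 0 ω) ∂μ)) = 0 := by
      rw [← cutoff, sub_self, mul_zero, mul_zero]
    rw [h5] at h4
    exact h4
  obtain ⟨k₀, hk₀⟩ := eventually_atTop.1 (h3.eventually_lt_const (half_pos hε))
  refine ⟨k₀, fun k hk => ?_⟩
  have h6 := D.theta_cutoff_sub_le hρ hK hβ0 hc hx (hH β hβ0 hβB x hx) (hqt k)
  have h7 : θ x (cutoff t) ≤ θ x (cutoff (q k)) :=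
    D.theta_le (cutoff_mem _) (cutoff_mem _) (fun y => monotone_cutoff y (hqt k)) x hx
  rw [Real.dist_eq, abs_of_nonneg (sub_nonneg.2 h7)]
  have h8 := hk₀ k hk.le
  simp only [e] at hβ
  linarith

/-- The conditional law of the outcomes has the right coordinate means, for all responses at the
same time. -/
theorem RegressionModel.ae_integral_condLaw (D : RegressionModel μ p X Y θ f₀ f₁ M) (hρ : 1 ≤ ρ)
    (hK : ∀ ν ν', IsBump ρ A (kernelMonomial K p ν ν')) {c : ℝ} (hB : 0 < B) (hc : 0 < c)
    (hH : ∀ β, 0 < β → β ≤ B → ∀ w ∈ Set.Icc (0 : Fin d → ℝ) 1,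
      Coercive c (gram K p β (μ.map (X 0)) w)) :
    ∀ᵐ ω ∂μ, ∀ n, ∀ i : Fin n, ∀ r ∈ R₁ ∪ R₂,
      Integrable (fun y : Fin n → ℝ => r (y i)) (condLaw μ X Y n ω) ∧
        ∫ y, r (y i) ∂(condLaw μ X Y n ω) = θ (X i ω) r := by
  have key : ∀ r ∈ R₁ ∪ R₂, ∀ n, ∀ i : Fin n,
      ∀ᵐ ω ∂μ, Integrable (fun y : Fin n → ℝ => r (y i)) (condLaw μ X Y n ω) ∧
        ∫ y, r (y i) ∂(condLaw μ X Y n ω) = cubeTheta θ r (X i ω) := fun r hr n i =>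
    ae_integral_condLaw_eq D.measurable_X D.measurable_Y D.iid (measurable_of_mem hr)
      (D.integrable_comp hr) (D.measurable_cubeTheta hr) (D.integrable_cubeTheta hr)
      (D.integral_mul_residual hr) n i
  have k1 : ∀ᵐ ω ∂μ, ∀ n, ∀ i : Fin n, Integrable (fun y : Fin n → ℝ => id (y i))
      (condLaw μ X Y n ω) ∧ ∫ y, id (y i) ∂(condLaw μ X Y n ω) = cubeTheta θ id (X i ω) :=
    ae_all_iff.2 fun n => ae_all_iff.2 fun i => key id id_mem n i
  -- The null set depends on the response, so only countably many cutoffs are treated directly.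
  have k2 : ∀ᵐ ω ∂μ, ∀ q : ℚ, ∀ n, ∀ i : Fin n,
      Integrable (fun y : Fin n → ℝ => cutoff q (y i)) (condLaw μ X Y n ω) ∧
        ∫ y, cutoff q (y i) ∂(condLaw μ X Y n ω) = cubeTheta θ (cutoff q) (X i ω) :=
    ae_all_iff.2 fun q => ae_all_iff.2 fun n => ae_all_iff.2 fun i => key _ (cutoff_mem q) n i
  filter_upwards [k1, k2, D.ae_mem_cube] with ω h1 h2 h3 n i r hr
  have : IsFiniteMeasure (condLaw μ X Y n ω) := by unfold condLaw; infer_instance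
  rcases hr with rfl | ⟨t, rfl⟩
  · obtain ⟨a, a'⟩ := h1 n i
    exact ⟨a, by rw [a', cubeTheta_of_mem θ id (h3 i)]⟩
  · change Integrable (fun y : Fin n → ℝ => cutoff t (y i)) _ ∧
      ∫ y, cutoff t (y i) ∂(condLaw μ X Y n ω) = θ (X i ω) (cutoff t)
    -- Rational cutoffs approach `t` from the right, where both the conditional law and `θ` are
    -- continuous.
    have hq : ∀ k : ℕ, ∃ q : ℚ, t < q ∧ (q : ℝ) < t + 1 / (k + 1) := fun k =>
      exists_rat_btwn (by have : (0 : ℝ) < 1 / (k + 1) := by positivity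
                          linarith)
    choose q hq1 hq2 using hq
    have hlim : Tendsto (fun k => (q k : ℝ)) atTop (𝓝 t) := by
      refine tendsto_of_tendsto_of_tendsto_of_le_of_le tendsto_const_nhds ?_
        (fun k => (hq1 k).le) fun k => (hq2 k).le
      simpa using tendsto_one_div_add_atTop_nhds_zero_nat.const_add t
    refine ⟨?_, ?_⟩
    · refine Integrable.of_bound ((measurable_cutoff t).comp
        (measurable_pi_apply i)).aestronglyMeasurable 1 (ae_of_all _ fun y => ?_)
      exact (Real.norm_of_nonneg (cutoff_nonneg t _)).trans_le (cutoff_le_one t _)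
    · have l1 := tendsto_integral_indicator_Iic (condLaw μ X Y n ω) (V := fun y : Fin n → ℝ => y i)
        (measurable_pi_apply i) (fun k => (hq1 k).le) hlim
      have l2 := D.tendsto_theta_cutoff hρ hK hB hc hH (h3 i) (fun k => (hq1 k).le) hlim
      refine tendsto_nhds_unique l1 (l2.congr fun k => ?_)
      rw [← cubeTheta_of_mem θ _ (h3 i), ← (h2 (q k) n i).2]
      rfl

end Deviations

/-! ### Gram matrix and score as sample averages -/

section SampleAverages

variable {Ω : Type*} {d p : ℕ} {X : ℕ → Ω → Fin d → ℝ}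

theorem gramHat_sample_apply (K : (Fin d → ℝ) → ℝ) (p : ℕ) (β : ℝ) (X : ℕ → Ω → Fin d → ℝ)
    (Y : ℕ → Ω → ℝ) (n : ℕ) (ω : Ω) (w : Fin d → ℝ) (ν ν' : MultiIdx d p) :
    gramHat K p β (sample X n ω) w ν ν' =
      avg (fun i ω => (X i ω, Y i ω)) n (fun z => localize β (kernelMonomial K p ν ν') w z.1) ω := by
  simp only [gramHat, Matrix.smul_apply, Matrix.sum_apply, gramTerm_apply, smul_eq_mul, avg,
    Finset.sum_range, sample]

theorem score_sample_apply (K : (Fin d → ℝ) → ℝ) (p : ℕ) (β : ℝ)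
    (θ : (Fin d → ℝ) → (ℝ → ℝ) → ℝ) (Y : ℕ → Ω → ℝ) (n : ℕ) {ω : Ω}
    (hω : ∀ i, X i ω ∈ Set.Icc (0 : Fin d → ℝ) 1) (w : Fin d → ℝ) (r : ℝ → ℝ) (ν : MultiIdx d p) :
    score K p β θ (sample X n ω) (sample Y n ω) w r ν =
      avg (fun i ω => (X i ω, Y i ω)) n (fun z =>
        localize β (kernelMonomial K p ν (MultiIdx.zero d p)) w z.1 *
          (r z.2 - cubeTheta θ r z.1)) ω := by
  simp only [score, Pi.smul_apply, smul_eq_mul, Finset.sum_apply, avg, Finset.sum_range, sample,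
    localize, kernelMonomial_zero_right]
  congr 1
  refine Finset.sum_congr rfl fun i _ => ?_
  rw [cubeTheta_of_mem θ r (hω i)]
  ring

end SampleAverages

/-! ### Gram matrix, score, non-linearity error and bias -/

section Assembly

theorem supIsBigOAS_of_forall {Ω α : Type*} [MeasurableSpace Ω] {μ : Measure Ω} {W : Set α}
    {R : Set (ℝ → ℝ)} {T : ℕ → α → (ℝ → ℝ) → Ω → ℝ} {a : ℕ → ℝ} (C : ℝ)
    (h : ∀ᵐ ω ∂μ, ∀ᶠ n in atTop, ∀ w ∈ W, ∀ r ∈ R, |T n w r ω| ≤ C * a n) :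
    SupIsBigOAS μ W R T a := by
  refine ⟨C, ?_⟩
  filter_upwards [h] with ω hω
  filter_upwards [hω] with n hn
  exact iSup₂_le fun w hw => iSup₂_le fun r hr => ENNReal.ofReal_le_ofReal (hn w hw r hr)

variable {Ω : Type*} [MeasurableSpace Ω] {μ : Measure Ω} [IsProbabilityMeasure μ] {d p : ℕ}
  {X : ℕ → Ω → Fin d → ℝ} {Y : ℕ → Ω → ℝ} {θ : (Fin d → ℝ) → (ℝ → ℝ) → ℝ} {f₀ f₁ M : ℝ}
  {K : (Fin d → ℝ) → ℝ} {b : ℕ → ℝ} {B ρ A : ℝ}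

/-- Uniform consistency of the sample Gram matrix. -/
theorem RegressionModel.exists_abs_gramHat_sub_gram_le (D : RegressionModel μ p X Y θ f₀ f₁ M)
    (hb : Bandwidths d b B) (hρ : 0 ≤ ρ) (hK : ∀ ν ν', IsBump ρ A (kernelMonomial K p ν ν')) :
    ∃ C, 0 ≤ C ∧ ∀ᵐ ω ∂μ, ∀ᶠ n in atTop, ∀ w ∈ Set.Icc (0 : Fin d → ℝ) 1, ∀ ν ν',
      |gramHat K p (b n) (sample X n ω) w ν ν' - gram K p (b n) (μ.map (X 0)) w ν ν'| ≤
        C * rate (b n ^ d) n := by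
  choose C hC0 hC using fun q : MultiIdx d p × MultiIdx d p =>
    exists_ae_eventually_abs_avg_localize_mul_le D.iid hb D.upper_nonneg D.upper hρ
      -- A single constant function `1`, hence the exponent `0` in the cardinality bound.
      (hK q.1 q.2) (fun _ => {()}) (fun _ _ _ => 1) (fun _ _ => measurable_const)
      (fun _ _ _ => zero_le_one) (fun _ _ _ => le_rfl) 0 (Eventually.of_forall fun n => by simp)
  refine ⟨∑ q, C q, Finset.sum_nonneg fun q _ => hC0 q, ?_⟩
  filter_upwards [ae_all_iff.2 hC] with ω hω
  filter_upwards [eventually_all.2 hω] with n hn w hw ν ν'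
  have h1 := hn (ν, ν') w hw () (Finset.mem_singleton_self _)
  simp only [mul_one] at h1
  have h2 : gram K p (b n) (μ.map (X 0)) w ν ν' =
      ∫ ω, localize (b n) (kernelMonomial K p ν ν') w (X 0 ω) ∂μ := by
    simp only [gram, Matrix.of_apply, gramTerm_apply]
    rw [integral_map (D.measurable_X 0).aemeasurable
      ((hK ν ν').continuous_localize w).aestronglyMeasurable]
  rw [gramHat_sample_apply K p (b n) X Y, h2]
  refine h1.trans (mul_le_mul_of_nonneg_right ?_ (rate_nonneg _ _))
  exact Finset.single_le_sum (fun q _ => hC0 q) (Finset.mem_univ (ν, ν'))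

/-- The residual is a difference of two families that are monotone in the cutoff with values in `[0,
1]`. Their kernel means agree, so the centerings cancel. -/
theorem RegressionModel.exists_norm_score_le_of_R₂ (D : RegressionModel μ p X Y θ f₀ f₁ M)
    (hb : Bandwidths d b B) (hρ : 0 ≤ ρ) (hK : ∀ ν ν', IsBump ρ A (kernelMonomial K p ν ν')) :
    ∃ C, 0 ≤ C ∧ ∀ᵐ ω ∂μ, ∀ᶠ n in atTop, ∀ w ∈ Set.Icc (0 : Fin d → ℝ) 1, ∀ r ∈ R₂,
      ‖score K p (b n) θ (sample X n ω) (sample Y n ω) w r‖ ≤ C * rate (b n ^ d) n := by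
  choose C hC0 hC using fun ν : MultiIdx d p =>
    exists_ae_eventually_abs_avg_localize_mul_monotone_le D.iid hb D.upper_nonneg D.upper hρ
      (hK ν (MultiIdx.zero d p)) (fun t z => cutoff t z.2)
      (fun t => (measurable_cutoff t).comp measurable_snd) (fun t z => cutoff_nonneg t _)
      (fun t z => cutoff_le_one t _) (fun z => monotone_cutoff _)
  choose C' hC0' hC' using fun ν : MultiIdx d p =>
    exists_ae_eventually_abs_avg_localize_mul_monotone_le D.iid hb D.upper_nonneg D.upper hρ
      (hK ν (MultiIdx.zero d p)) (fun t z => cubeTheta θ (cutoff t) z.1)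
      (fun t => (D.measurable_cubeTheta (cutoff_mem t)).comp measurable_fst)
      (fun t z => D.cubeTheta_cutoff_nonneg t _) (fun t z => D.cubeTheta_cutoff_le_one t _)
      (fun z => D.monotone_cubeTheta_cutoff _)
  have hS0 : 0 ≤ ∑ ν, (C ν + C' ν) :=
    Finset.sum_nonneg fun ν _ => add_nonneg (hC0 ν) (hC0' ν)
  refine ⟨∑ ν, (C ν + C' ν), hS0, ?_⟩
  filter_upwards [ae_all_iff.2 hC, ae_all_iff.2 hC', D.ae_mem_cube] with ω hω hω' hcube
  filter_upwards [eventually_all.2 hω, eventually_all.2 hω'] with n hn hn' w hw r hr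
  obtain ⟨t, rfl⟩ := hr
  have hrate := rate_nonneg (b n ^ d) n
  refine (pi_norm_le_iff_of_nonneg (mul_nonneg hS0 hrate)).2 fun ν => ?_
  have h1 := hn ν w hw t
  have h2 := hn' ν w hw t
  have h3 := D.integral_mul_eq (cutoff_mem t)
    ((hK ν (MultiIdx.zero d p)).continuous_localize (b := b n) w).measurable
    ⟨_, (hK ν (MultiIdx.zero d p)).abs_localize_le (hb.pos n) w⟩
  change |score K p (b n) θ (sample X n ω) (sample Y n ω) w (cutoff t) ν| ≤ _
  rw [score_sample_apply K p (b n) θ Y n hcube]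
  have h4 : ∀ F G H : (Fin d → ℝ) × ℝ → ℝ,
      avg (fun i ω => (X i ω, Y i ω)) n (fun z => F z * (G z - H z)) ω =
      avg (fun i ω => (X i ω, Y i ω)) n (fun z => F z * G z) ω -
      avg (fun i ω => (X i ω, Y i ω)) n (fun z => F z * H z) ω := by
    intro F G H
    simp only [avg, mul_sub, Finset.sum_sub_distrib]
  rw [h4]
  rw [h3] at h1
  have h5 : C ν + C' ν ≤ ∑ ν, (C ν + C' ν) :=
    Finset.single_le_sum (fun ν _ => add_nonneg (hC0 ν) (hC0' ν)) (Finset.mem_univ ν)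
  refine le_trans ?_ (mul_le_mul_of_nonneg_right h5 hrate)
  rw [abs_le] at *
  constructor <;> linarith

theorem RegressionModel.exists_norm_score_le_of_R₁ (D : RegressionModel μ p X Y θ f₀ f₁ M)
    (hb : Bandwidths d b B) (hρ : 0 ≤ ρ) (hK : ∀ ν ν', IsBump ρ A (kernelMonomial K p ν ν'))
    (hexp : Integrable (fun ω => Real.exp |Y 0 ω|) μ)
    (hexp2 : μ[fun ω => Real.exp |Y 0 ω| | MeasurableSpace.comap (X 0) inferInstance]
        ≤ᵐ[μ] fun _ => (2 : ℝ)) :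
    ∃ C, 0 ≤ C ∧ ∀ᵐ ω ∂μ, ∀ᶠ n in atTop, ∀ w ∈ Set.Icc (0 : Fin d → ℝ) 1, ∀ r ∈ R₁,
      ‖score K p (b n) θ (sample X n ω) (sample Y n ω) w r‖ ≤ C * rate (b n ^ d) n := by
  obtain ⟨T, hT⟩ := D.exists_abs_cubeTheta_le id_mem
  have h2 : ∀ φ : (Fin d → ℝ) → ℝ, Measurable φ → (∃ a, ∀ x, |φ x| ≤ a) → (∀ x, 0 ≤ φ x) →
      ∫ ω, φ (X 0 ω) * Real.exp |Y 0 ω| ∂μ ≤ 2 * ∫ ω, φ (X 0 ω) ∂μ := by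
    rintro φ hφ ⟨a, ha⟩ hφ0
    have hφm : AEStronglyMeasurable (fun ω => φ (X 0 ω)) μ :=
      (hφ.comp (D.measurable_X 0)).aestronglyMeasurable
    have hφi : Integrable (fun ω => φ (X 0 ω)) μ :=
      Integrable.of_bound hφm a (ae_of_all _ fun ω => ha _)
    rw [integral_comp_mul_eq_integral_comp_mul_condExp (D.measurable_X 0) hexp hφ ha,
      ← integral_const_mul]
    refine integral_mono_ae (integrable_condExp.bdd_mul hφm (ae_of_all _ fun ω => ha _))
      (hφi.const_mul 2) ?_
    filter_upwards [hexp2] with ω hω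
    rw [mul_comm 2]
    exact mul_le_mul_of_nonneg_left hω (hφ0 _)
  choose C hC0 hC using fun ν : MultiIdx d p =>
    exists_ae_eventually_abs_avg_localize_mul_residual_le D.iid hb D.upper_nonneg D.upper hρ
      (hK ν (MultiIdx.zero d p)) (D.measurable_cubeTheta id_mem) hT D.integrable_Y
      (D.integral_mul_residual id_mem) hexp h2
  have hS0 : 0 ≤ ∑ ν, C ν := Finset.sum_nonneg fun ν _ => hC0 ν
  refine ⟨∑ ν, C ν, hS0, ?_⟩
  filter_upwards [ae_all_iff.2 hC, D.ae_mem_cube] with ω hω hcube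
  filter_upwards [eventually_all.2 hω] with n hn w hw r hr
  obtain rfl : r = id := hr
  have hrate := rate_nonneg (b n ^ d) n
  refine (pi_norm_le_iff_of_nonneg (mul_nonneg hS0 hrate)).2 fun ν => ?_
  rw [score_sample_apply K p (b n) θ Y n hcube]
  exact (hn ν w hw).trans (mul_le_mul_of_nonneg_right
    (Finset.single_le_sum (fun ν _ => hC0 ν) (Finset.mem_univ ν)) hrate)

theorem RegressionModel.exists_coercive_gramHat (D : RegressionModel μ p X Y θ f₀ f₁ M)
    (hb : Bandwidths d b B) (hρ : 0 ≤ ρ) (hK : ∀ ν ν', IsBump ρ A (kernelMonomial K p ν ν'))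
    {c : ℝ} (hc : 0 < c) (hH : ∀ β, 0 < β → β ≤ B → ∀ w ∈ Set.Icc (0 : Fin d → ℝ) 1,
      Coercive c (gram K p β (μ.map (X 0)) w)) :
    ∃ C, 0 ≤ C ∧ ∀ᵐ ω ∂μ, ∀ᶠ n in atTop, ∀ w ∈ Set.Icc (0 : Fin d → ℝ) 1,
      Coercive (c / 2) (gramHat K p (b n) (sample X n ω) w) ∧
      ∀ ν ν', |gramHat K p (b n) (sample X n ω) w ν ν' - gram K p (b n) (μ.map (X 0)) w ν ν'| ≤
        C * rate (b n ^ d) n := by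
  obtain ⟨C, hC0, hC⟩ := D.exists_abs_gramHat_sub_gram_le hb hρ hK
  refine ⟨C, hC0, ?_⟩
  set N : ℝ := (Fintype.card (MultiIdx d p) : ℝ) ^ 2
  have hN : 0 ≤ N := by positivity
  filter_upwards [hC] with ω hω
  -- The threshold makes `N * C` times the rate at most `c / 2`, as `Coercive.perturb` requires; `+
  -- 1` avoids a zero denominator.
  filter_upwards [hω, hb.eventually_rate_le (ε := c / 2 / (N * C + 1)) (by positivity)]
    with n hn hr w hw
  refine ⟨(hH _ (hb.pos n) (hb.le n) w hw).perturb
    (mul_nonneg hC0 (rate_nonneg _ _)) (hn w hw) ?_, hn w hw⟩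
  calc N * (C * rate (b n ^ d) n) ≤ (N * C + 1) * rate (b n ^ d) n := by
        have := rate_nonneg (b n ^ d) n
        nlinarith
    _ ≤ (N * C + 1) * (c / 2 / (N * C + 1)) := by gcongr
    _ = c / 2 := by field_simp

theorem Coercive.mono {ι : Type*} [Fintype ι] {c c' : ℝ} {H : Matrix ι ι ℝ} (hH : Coercive c H)
    (h : c' ≤ c) : Coercive c' H := fun a => (by gcongr : c' * ‖a‖ ^ 2 ≤ c * ‖a‖ ^ 2).trans (hH a)

/-- The non-linearity error is of the order of the squared rate wherever the score is of the
order of the rate. -/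
theorem RegressionModel.exists_abs_nonlinError_le (D : RegressionModel μ p X Y θ f₀ f₁ M)
    (hb : Bandwidths d b B) (hρ : 0 ≤ ρ) (hK : ∀ ν ν', IsBump ρ A (kernelMonomial K p ν ν'))
    {c : ℝ} (hc : 0 < c) (hH : ∀ β, 0 < β → β ≤ B → ∀ w ∈ Set.Icc (0 : Fin d → ℝ) 1,
      Coercive c (gram K p β (μ.map (X 0)) w)) {R : Set (ℝ → ℝ)}
    (hS : ∃ C, 0 ≤ C ∧ ∀ᵐ ω ∂μ, ∀ᶠ n in atTop, ∀ w ∈ Set.Icc (0 : Fin d → ℝ) 1, ∀ r ∈ R,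
      ‖score K p (b n) θ (sample X n ω) (sample Y n ω) w r‖ ≤ C * rate (b n ^ d) n) :
    ∃ C, 0 ≤ C ∧ ∀ᵐ ω ∂μ, ∀ᶠ n in atTop, ∀ w ∈ Set.Icc (0 : Fin d → ℝ) 1, ∀ r ∈ R,
      |nonlinError K p (b n) (μ.map (X 0)) θ (sample X n ω) (sample Y n ω) w r| ≤
        C * (((n : ℝ) * b n ^ d)⁻¹ * Real.log n) := by
  obtain ⟨C, hC0, hC⟩ := D.exists_coercive_gramHat hb hρ hK hc hH
  obtain ⟨C', hC0', hC'⟩ := hS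
  set N : ℝ := (Fintype.card (MultiIdx d p) : ℝ)
  refine ⟨(N / (c / 2)) ^ 2 * N * C * C', by positivity, ?_⟩
  filter_upwards [hC, hC'] with ω hω hω'
  filter_upwards [hω, hω'] with n hn hn' w hw r hr
  obtain ⟨h1, h2⟩ := hn w hw
  have hr0 := rate_nonneg (b n ^ d) n
  rw [nonlinError, e₁_dotProduct, ← rate_sq (pow_pos (hb.pos n) d)]
  refine (norm_le_pi_norm (((gramHat K p (b n) (sample X n ω) w)⁻¹ -
    (gram K p (b n) (μ.map (X 0)) w)⁻¹).mulVec
      (score K p (b n) θ (sample X n ω) (sample Y n ω) w r)) (MultiIdx.zero d p)).trans ?_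
  refine (Coercive.norm_inv_sub_inv_mulVec_le (half_pos hc) (mul_nonneg hC0 hr0)
    ((hH _ (hb.pos n) (hb.le n) w hw).mono (half_le_self hc.le)) h1 h2 _).trans ?_
  calc _ ≤ (N / (c / 2)) ^ 2 * N * (C * rate (b n ^ d) n) * (C' * rate (b n ^ d) n) := by
        gcongr
        exact hn' w hw r hr
    _ = _ := by ring

/-- For fixed covariates the estimator is a finite linear combination of the `r (y i)`, so it is
integrable and its mean is the fit to the conditional means. -/
theorem condMeanThetaHat_eq {n : ℕ} {β : ℝ} (hβ : 0 < β) {c : ℝ} (hc : 0 < c) {ω : Ω}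
    {w : Fin d → ℝ} (hH : Coercive c (gramHat K p β (sample X n ω) w)) {r : ℝ → ℝ}
    {m : (Fin d → ℝ) → ℝ}
    (h : ∀ i : Fin n, Integrable (fun y : Fin n → ℝ => r (y i)) (condLaw μ X Y n ω) ∧
      ∫ y, r (y i) ∂(condLaw μ X Y n ω) = m (X i ω)) :
    Integrable (fun y => thetaHat K p β (sample X n ω) y w r) (condLaw μ X Y n ω) ∧
    condMeanThetaHat μ K p β X Y n w r ω = ((gramHat K p β (sample X n ω) w)⁻¹.mulVec
      (moment K p β (sample X n ω) w fun i => m (sample X n ω i))) (MultiIdx.zero d p) := by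
  have h1 : (fun y => thetaHat K p β (sample X n ω) y w r) =
      fun y => ∑ i, fitWeight K p β (sample X n ω) w i * r (y i) := by
    funext y
    rw [thetaHat_eq hβ hc hH, inv_gramHat_mulVec_moment_zero]
  have hint : ∀ i : Fin n, Integrable (fun y : Fin n → ℝ =>
      fitWeight K p β (sample X n ω) w i * r (y i)) (condLaw μ X Y n ω) := fun i =>
    (h i).1.const_mul _
  refine ⟨h1 ▸ integrable_finsetSum _ fun i _ => hint i, ?_⟩
  rw [condMeanThetaHat, h1, integral_finsetSum _ fun i _ => hint i,
    inv_gramHat_mulVec_moment_zero]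
  refine Finset.sum_congr rfl fun i _ => ?_
  rw [integral_const_mul, (h i).2]
  rfl

theorem gram_apply_le (D : RegressionModel μ p X Y θ f₀ f₁ M) (hρ : 0 ≤ ρ)
    (hK : ∀ ν ν', IsBump ρ A (kernelMonomial K p ν ν')) {β : ℝ} (hβ : 0 < β) (w : Fin d → ℝ)
    (ν ν' : MultiIdx d p) :
    gram K p β (μ.map (X 0)) w ν ν' ≤ A * f₁ * (2 * ρ) ^ d := by
  have hP := D.isProbabilityMeasure_map
  simp only [gram, Matrix.of_apply, gramTerm_apply]
  refine le_trans ?_ ((hK ν ν').integral_abs_localize_le hρ hβ D.upper_nonneg D.upper w)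
  exact integral_mono ((hK ν ν').integrable_localize hβ _ w)
    ((hK ν ν').integrable_localize hβ _ w).abs fun x => le_abs_self _

/-- The conditional bias of the local polynomial estimator. -/
theorem RegressionModel.exists_abs_condMeanThetaHat_sub_le
    (D : RegressionModel μ p X Y θ f₀ f₁ M) (hKnonneg : ∀ u, 0 ≤ K u)
    (hb : Bandwidths d b B) (hρ : 1 ≤ ρ) (hK : ∀ ν ν', IsBump ρ A (kernelMonomial K p ν ν'))
    {c : ℝ} (hc : 0 < c) (hH : ∀ β, 0 < β → β ≤ B → ∀ w ∈ Set.Icc (0 : Fin d → ℝ) 1,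
      Coercive c (gram K p β (μ.map (X 0)) w)) :
    ∃ C, ∀ᵐ ω ∂μ, ∀ᶠ n in atTop, ∀ w ∈ Set.Icc (0 : Fin d → ℝ) 1, ∀ r ∈ R₁ ∪ R₂,
      |condMeanThetaHat μ K p (b n) X Y n w r ω - θ w r| ≤ C * b n ^ (1 + p) := by
  have hρ0 := zero_le_one.trans hρ
  obtain ⟨C, hC0, hC⟩ := D.exists_coercive_gramHat hb hρ0 hK hc hH
  set N : ℝ := (Fintype.card (MultiIdx d p) : ℝ)
  set G : ℝ := A * f₁ * (2 * ρ) ^ d + C with hG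
  refine ⟨N / (c / 2) * (ρ ^ p * (M * ρ ^ (p + 1)) * G), ?_⟩
  filter_upwards [hC, D.ae_integral_condLaw hρ hK hb.bound_pos hc hH, D.ae_mem_cube]
    with ω hω hlaw hcube
  filter_upwards [hω, hb.eventually_rate_le zero_lt_one] with n hn hr w hw r hrR
  obtain ⟨h1, h2⟩ := hn w hw
  -- The average kernel weight is at most its population bound plus a deviation, at most `C` once
  -- the rate is below `1`.
  have hle : gramHat K p (b n) (sample X n ω) w (MultiIdx.zero d p) (MultiIdx.zero d p) ≤ G := by
    have h3 := (abs_le.1 (h2 (MultiIdx.zero d p) (MultiIdx.zero d p))).2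
    have h4 := gram_apply_le D hρ0 hK (hb.pos n) w (MultiIdx.zero d p) (MultiIdx.zero d p)
    have h5 : C * rate (b n ^ d) n ≤ C * 1 := by gcongr
    linarith
  rw [(condMeanThetaHat_eq (hb.pos n) (half_pos hc) h1 (m := fun x => θ x r)
    fun i => hlaw n i r hrR).2]
  refine (abs_inv_gramHat_mulVec_moment_sub_le (hb.pos n) hρ hK hKnonneg (D.smooth r hrR)
    (D.bound r hrR) hw (fun i => hcube i) (half_pos hc) h1 hle).trans (le_of_eq ?_)
  rw [mul_pow]
  ring

end Assembly

end LocalPoly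

/-! ### The main theorem -/

theorem mainTheorem11 {Ω : Type*} [MeasurableSpace Ω] (μ : Measure Ω) [IsProbabilityMeasure μ]
    (d p : ℕ) (hd : 1 ≤ d)
    -- the random sample
    (X : ℕ → Ω → Fin d → ℝ) (Y : ℕ → Ω → ℝ)
    (hX : ∀ i, Measurable (X i)) (hY : ∀ i, Measurable (Y i))
    (hindep : iIndepFun (fun i ω => (X i ω, Y i ω)) μ)
    (hident : ∀ i, IdentDistrib (fun ω => (X i ω, Y i ω)) (fun ω => (X 0 ω, Y 0 ω)) μ μ)
    (hYint : Integrable (Y 0) μ)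
    -- the covariates have a continuous positive density on the unit cube
    (f : (Fin d → ℝ) → ℝ) (hf : ContinuousOn f (Set.Icc 0 1))
    (hfpos : ∀ x ∈ Set.Icc (0 : Fin d → ℝ) 1, 0 < f x)
    (hlaw : μ.map (X 0) =
      (volume.restrict (Set.Icc (0 : Fin d → ℝ) 1)).withDensity fun x => ENNReal.ofReal (f x))
    -- the kernel and the bandwidths
    (K : (Fin d → ℝ) → ℝ) (hKnonneg : ∀ u, 0 ≤ K u) (hKzero : 0 < K 0)
    (hKlip : ∃ L, LipschitzWith L K) (hKsupp : HasCompactSupport K)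
    (b : ℕ → ℝ) (hbpos : ∀ n, 0 < b n) (hbbdd : ∃ B, ∀ n, b n ≤ B)
    (hrate : Tendsto (fun n : ℕ => ((n : ℝ) * b n ^ d)⁻¹ * Real.log n) atTop (𝓝 0))
    -- the evaluation points and the regression functions
    (W : Set (Fin d → ℝ)) (hW : W ⊆ Set.Icc 0 1)
    (θ : (Fin d → ℝ) → (ℝ → ℝ) → ℝ)
    (hθ : ∀ r ∈ LocalPoly.R₁ ∪ LocalPoly.R₂, (fun ω => θ (X 0 ω) r) =ᵐ[μ]
      μ[fun ω => r (Y 0 ω) | MeasurableSpace.comap (X 0) inferInstance])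
    (hθsmooth : ∀ r ∈ LocalPoly.R₁ ∪ LocalPoly.R₂,
      ContDiffOn ℝ ((p + 1 : ℕ) : WithTop ℕ∞) (fun w => θ w r) (Set.Icc 0 1))
    (hθbdd : ∃ M : ℝ, ∀ r ∈ LocalPoly.R₁ ∪ LocalPoly.R₂, ∀ w ∈ Set.Icc (0 : Fin d → ℝ) 1,
      ‖iteratedFDerivWithin ℝ (p + 1) (fun w => θ w r) (Set.Icc 0 1) w‖ ≤ M) :
    -- the objects below are well defined
    (∀ n, ∀ w ∈ W, IsUnit (LocalPoly.gram K p (b n) (μ.map (X 0)) w).det) ∧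
    (∀ᵐ ω ∂μ, ∀ᶠ n in atTop, ∀ w ∈ W,
      IsUnit (LocalPoly.gramHat K p (b n) (LocalPoly.sample X n ω) w).det ∧
      (∀ (r : ℝ → ℝ) (y : Fin n → ℝ),
        ∃! β, LocalPoly.IsFit K p (b n) (LocalPoly.sample X n ω) y w r β) ∧
      ∀ r ∈ LocalPoly.R₁ ∪ LocalPoly.R₂,
        Integrable (fun y => LocalPoly.thetaHat K p (b n) (LocalPoly.sample X n ω) y w r)
          (LocalPoly.condLaw μ X Y n ω)) ∧
    -- the non-linearity error over the indicators
    LocalPoly.SupIsBigOAS μ W LocalPoly.R₂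
      (fun n w r ω => LocalPoly.nonlinError K p (b n) (μ.map (X 0)) θ
        (LocalPoly.sample X n ω) (LocalPoly.sample Y n ω) w r)
      (fun n => ((n : ℝ) * b n ^ d)⁻¹ * Real.log n) ∧
    -- the smoothing bias over both classes
    (∀ R ∈ ({LocalPoly.R₁, LocalPoly.R₂} : Set (Set (ℝ → ℝ))),
      LocalPoly.SupIsBigOAS μ W R
        (fun n w r ω => LocalPoly.condMeanThetaHat μ K p (b n) X Y n w r ω - θ w r)
        (fun n => b n ^ (1 + p))) ∧
    -- the non-linearity error over the identity, under conditional exponential moments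
    (Integrable (fun ω => Real.exp |Y 0 ω|) μ →
      (μ[fun ω => Real.exp |Y 0 ω| | MeasurableSpace.comap (X 0) inferInstance]
        ≤ᵐ[μ] fun _ => (2 : ℝ)) →
      LocalPoly.SupIsBigOAS μ W LocalPoly.R₁
        (fun n w r ω => LocalPoly.nonlinError K p (b n) (μ.map (X 0)) θ
          (LocalPoly.sample X n ω) (LocalPoly.sample Y n ω) w r)
        (fun n => ((n : ℝ) * b n ^ d)⁻¹ * Real.log n +
          (((n : ℝ) * b n ^ d)⁻¹) ^ ((3 : ℝ) / 2) * Real.log n ^ ((5 : ℝ) / 2))) := by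
  obtain ⟨ρ, A, hρ, hA, hK⟩ := LocalPoly.exists_isBump_kernelMonomial hKlip hKsupp p
  obtain ⟨B, hB⟩ := hbbdd
  obtain ⟨M, hM⟩ := hθbdd
  have hKc : Continuous K := hKlip.choose_spec.continuous
  have hbw : LocalPoly.Bandwidths d b B := ⟨hd, hbpos, hB, hrate⟩
  obtain ⟨f₀, hf₀, hff₀⟩ : ∃ f₀ > 0, ∀ x ∈ Set.Icc (0 : Fin d → ℝ) 1, f₀ ≤ f x := by
    obtain ⟨x₀, hx₀, hmin⟩ := isCompact_Icc.exists_isMinOn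
      (Set.nonempty_Icc.2 (zero_le_one : (0 : Fin d → ℝ) ≤ 1)) hf
    exact ⟨f x₀, hfpos x₀ hx₀, fun x hx => hmin hx⟩
  obtain ⟨f₁, hff₁⟩ := isCompact_Icc.exists_bound_of_continuousOn hf
  have hlower : ENNReal.ofReal f₀ • volume.restrict (Set.Icc (0 : Fin d → ℝ) 1) ≤ μ.map (X 0) := by
    rw [hlaw, ← withDensity_const]
    exact withDensity_mono ((ae_restrict_iff' measurableSet_Icc).2
      (ae_of_all _ fun x hx => ENNReal.ofReal_le_ofReal (hff₀ x hx)))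
  have hupper : μ.map (X 0) ≤ ENNReal.ofReal (max f₁ 0) • volume := by
    rw [hlaw]
    refine le_trans (withDensity_mono (g := fun _ => ENNReal.ofReal (max f₁ 0))
      ((ae_restrict_iff' measurableSet_Icc).2 (ae_of_all _ fun x hx =>
        ENNReal.ofReal_le_ofReal (((le_abs_self _).trans (hff₁ x hx)).trans (le_max_left _ _))))) ?_
    rw [withDensity_const]
    refine Measure.le_iff.2 fun s _ => ?_
    simp only [Measure.smul_apply, smul_eq_mul]
    gcongr
    exact Measure.restrict_le_self
  have hcube : ∀ᵐ x ∂μ.map (X 0), x ∈ Set.Icc (0 : Fin d → ℝ) 1 := by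
    rw [hlaw]
    exact (withDensity_absolutelyContinuous _ _).ae_le (ae_restrict_mem measurableSet_Icc)
  have D : LocalPoly.RegressionModel μ p X Y θ f₀ (max f₁ 0) M :=
    { measurable_X := hX
      measurable_Y := hY
      iid := ⟨fun i => (hX i).prodMk (hY i), hindep, hident⟩
      integrable_Y := hYint
      lower_pos := hf₀
      upper_nonneg := le_max_right _ _
      lower := hlower
      upper := hupper
      cube := hcube
      regression := hθ
      smooth := hθsmooth
      bound := hM }
  have hprob := D.isProbabilityMeasure_map
  have hρ0 : 0 ≤ ρ := zero_le_one.trans hρ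
  obtain ⟨c, hc, hH⟩ := LocalPoly.exists_coercive_gram hK hKc hKnonneg hKzero hf₀ hlower B
  refine ⟨fun n w hw => (hH _ (hbpos n) (hB n) w (hW hw)).isUnit_det hc, ?_, ?_, ?_, ?_⟩
  · obtain ⟨C, -, hC⟩ := D.exists_coercive_gramHat hbw hρ0 hK hc hH
    filter_upwards [hC, D.ae_integral_condLaw hρ hK hbw.bound_pos hc hH] with ω hω hlawω
    filter_upwards [hω] with n hn w hw
    have h1 := (hn w (hW hw)).1
    exact ⟨h1.isUnit_det (half_pos hc),
      fun r y => LocalPoly.existsUnique_isFit (hbpos n) (half_pos hc) h1 y r,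
      fun r hr => (LocalPoly.condMeanThetaHat_eq (hbpos n) (half_pos hc) h1
        (m := fun x => θ x r) fun i => hlawω n i r hr).1⟩
  · obtain ⟨C, -, hC⟩ := D.exists_abs_nonlinError_le hbw hρ0 hK hc hH
      (D.exists_norm_score_le_of_R₂ hbw hρ0 hK)
    refine LocalPoly.supIsBigOAS_of_forall C ?_
    filter_upwards [hC] with ω hω
    filter_upwards [hω] with n hn w hw r hr using hn w (hW hw) r hr
  · obtain ⟨C, hC⟩ := D.exists_abs_condMeanThetaHat_sub_le hKnonneg hbw hρ hK hc hH
    intro R hR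
    have hRsub : R ⊆ LocalPoly.R₁ ∪ LocalPoly.R₂ := by
      rcases hR with rfl | rfl
      · exact Set.subset_union_left
      · exact Set.subset_union_right
    refine LocalPoly.supIsBigOAS_of_forall C ?_
    filter_upwards [hC] with ω hω
    filter_upwards [hω] with n hn w hw r hr using hn w (hW hw) r (hRsub hr)
  · intro hexp hexp2
    obtain ⟨C, hC0, hC⟩ := D.exists_abs_nonlinError_le hbw hρ0 hK hc hH
      (D.exists_norm_score_le_of_R₁ hbw hρ0 hK hexp hexp2)
    refine LocalPoly.supIsBigOAS_of_forall C ?_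
    filter_upwards [hC] with ω hω
    filter_upwards [hω] with n hn w hw r hr
    refine (hn w (hW hw) r hr).trans ?_
    have hb0 := hbpos n
    have hlog := Real.log_natCast_nonneg n
    gcongr
    -- The bound already holds with the first summand alone; the second is nonnegative.
    exact le_add_of_nonneg_right (by positivity)
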